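/- Let $X$ be a complex manifold of dimension $d\ge 1$ (Hausdorff, $\sigma$-compact) and $j\colon D\hookrightarrow X$ a smooth divisor, i.e. a closed complex submanifold of dimension $d-1$. A *local equation* of $D$ on an open set $U\subset X$ is a holomorphic $f\colon U\to\mathbb C$ with $D\cap U=\{f=0\}$ and $df\neq 0$ at every point of $D\cap U$. Let $\mu\colon X\to[0,\infty)$ be a smooth function vanishing exactly on $D$ and belonging to the canonical conformal class: for every local equation $f$, $\mu/|f|^2$ extends to a positive smooth function on the domain of $f$. All forms are complex-valued. Let $\omega$ be a differential form on $X\smallsetminus D$ such that locally on $X$ some $\mu^N\omega$ extends to a smooth form. We say that $\omega$ is *tame* if $\mu\,\omega$ and $d\mu\wedge\omega$ extend to smooth forms on $X$. We say that $\omega$ is *bilogarithmic for* a local equation $f$ on $U$ if there are smooth forms $\omega_{11},\omega_{10},\omega_{01},\omega_{00}$ on $U$ such that on $U\smallsetminus D$ $$\omega=\frac{df}{f}\wedge\frac{d\bar f}{\bar f}\wedge\omega_{11}+\frac{df}{f}\wedge\omega_{10}+\frac{d\bar f}{\bar f}\wedge\omega_{01}+\omega_{00}.\qquad(*)$$ Then: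 1. $\omega$ is tame if and only if it is bilogarithmic for every local equation of $D$ (on every open set $U$); equivalently, if and only if every point of $D$ has a neighbourhood with a local equation for which $\omega$ is bilogarithmic. 2. Suppose $\omega$ is tame, and orient $X$ and $D$ by their complex structures. For a compactly supported smooth form $\varphi$ on $X$ put $\zeta(s)=\int_X\mu^{s/2}\,\omega\wedge\varphi$ for $\operatorname{Re}s\gg0$, continued meromorphically to a half-plane $\operatorname{Re}s>-\delta$ for some $\delta>0$. There is a unique smooth form $R(\omega)$ on $D$ (the residue of $\omega$) such that $$\operatorname{res}_{s=0}\zeta(s)=\int_D R(\omega)\wedge j^*\varphi$$ for all compactly supported smooth forms $\varphi$ on $X$, and for every local equation $f$ on $U$ and every representation $(*)$ of $\omega$ on $U$, $$R(\omega)|_{D\cap U}=-4\pi\sqrt{-1}\;\omega_{11}|_{D\cap U}.$$ -/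

import Mathlib

open scoped Manifold ContDiff Topology

noncomputable section

namespace HadamardResidue

/-! Throughout, a complex manifold of dimension `n` is a space charted on `Fin n → ℂ` with
holomorphic transition maps.  Real tangent spaces, real differentials and smoothness of functions
refer to the underlying real manifold (model `𝓘(ℝ, Fin n → ℂ)`, same charts). -/

/-- The real smooth manifold underlying a complex manifold. -/
theorem isManifold_real (n : ℕ) (X : Type*) [TopologicalSpace X] [ChartedSpace (Fin n → ℂ) X]
    [IsManifold 𝓘(ℂ, Fin n → ℂ) ω X] : IsManifold 𝓘(ℝ, Fin n → ℂ) ∞ X := by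
  refine isManifold_of_contDiffOn _ _ _ fun e e' he he' => ?_
  have h : ContDiffOn ℂ ω (e.symm ≫ₕ e') (e.symm ≫ₕ e').source := by
    have h₀ := (contDiffGroupoid ω 𝓘(ℂ, Fin n → ℂ)).compatible he he'
    have h₁ : ContDiffOn ℂ ω (𝓘(ℂ, Fin n → ℂ) ∘ (e.symm ≫ₕ e') ∘ 𝓘(ℂ, Fin n → ℂ).symm)
      (𝓘(ℂ, Fin n → ℂ).symm ⁻¹' (e.symm ≫ₕ e').source ∩ Set.range 𝓘(ℂ, Fin n → ℂ)) :=
      (mem_groupoid_of_pregroupoid.mp h₀).1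
    simpa using h₁
  simpa using (h.restrict_scalars ℝ).of_le (m := ∞) le_top

section Forms

variable {m n : ℕ} {X Y : Type*} [TopologicalSpace X] [ChartedSpace (Fin n → ℂ) X]
  [TopologicalSpace Y] [ChartedSpace (Fin m → ℂ) Y]

/-- The complexified real cotangent space `T*ₓX ⊗ ℂ`: the real-linear maps `TₓX → ℂ`. -/
abbrev Cotangent (n : ℕ) {X : Type*} [TopologicalSpace X] [ChartedSpace (Fin n → ℂ) X]
    (x : X) : Type :=
  TangentSpace 𝓘(ℝ, Fin n → ℂ) x →L[ℝ] ℂ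

/-- Complex-valued differential forms (sections of `Λ(T*X ⊗ ℂ)`, a priori without any regularity).
The product `*` is the wedge product. A form may have components in several degrees. -/
abbrev Form (n : ℕ) (X : Type*) [TopologicalSpace X] [ChartedSpace (Fin n → ℂ) X] : Type _ :=
  ∀ x : X, ExteriorAlgebra ℂ (Cotangent n x)

/-- Precomposition with a real-linear map, the transpose on complexified dual spaces. -/
def transpose {V W : Type*} [AddCommGroup V] [Module ℝ V] [TopologicalSpace V]
    [AddCommGroup W] [Module ℝ W] [TopologicalSpace W] (L : V →L[ℝ] W) :
    (W →L[ℝ] ℂ) →ₗ[ℂ] (V →L[ℝ] ℂ) where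
  toFun θ := θ.comp L
  map_add' _ _ := rfl
  map_smul' _ _ := rfl

/-- The pullback `g^* η` of a differential form. -/
def pullback (g : Y → X) (η : Form n X) : Form m Y := fun y =>
  ExteriorAlgebra.map
    (transpose (mfderiv 𝓘(ℝ, Fin m → ℂ) 𝓘(ℝ, Fin n → ℂ) g y)) (η (g y))

/-- The expression of a form in a chart `e`, a function with values in the fixed finite-dimensional
algebra `Λ((ℂⁿ)* ⊗ ℂ)`. -/
def inChart (e : OpenPartialHomeomorph X (Fin n → ℂ)) (η : Form n X) :
    (Fin n → ℂ) → ExteriorAlgebra ℂ ((Fin n → ℂ) →L[ℝ] ℂ) :=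
  fun y => pullback (m := n) e.symm η y

/-- `η` is smooth on the open set `U`: in every chart all its coefficients are smooth. -/
def IsSmoothOn (η : Form n X) (U : Set X) : Prop :=
  ∀ e ∈ atlas (Fin n → ℂ) X, ∀ l : ExteriorAlgebra ℂ ((Fin n → ℂ) →L[ℝ] ℂ) →ₗ[ℂ] ℂ,
    ContDiffOn ℝ ∞ (fun y => l (inChart e η y)) (e.target ∩ e.symm ⁻¹' U)

/-- The differential `df` of a complex-valued function, as a form of degree one. -/
def d (f : X → ℂ) : Form n X := fun x =>
  ExteriorAlgebra.ι ℂ (M := Cotangent n x) (mfderiv 𝓘(ℝ, Fin n → ℂ) 𝓘(ℝ, ℂ) f x)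

/-- The form `η`, of interest outside `S` only, extends to a smooth form on the open set `U`. -/
def ExtendsSmoothly (S : Set X) (η : Form n X) (U : Set X) : Prop :=
  ∃ η' : Form n X, IsSmoothOn η' U ∧ ∀ x ∈ U \ S, η' x = η x

end Forms

section Integration

/-- The oriented real frame `e₁, i e₁, e₂, i e₂, …` of `ℂⁿ`. -/
def realFrame (n : ℕ) (k : Fin (n * 2)) : Fin n → ℂ :=
  Pi.single (finProdFinEquiv.symm k).1
    (if (finProdFinEquiv.symm k).2 = 0 then 1 else Complex.I)

/-- The alternating map `(θ₁, …, θ₂ₙ) ↦ det (θᵢ(vⱼ))`, with `v` the frame above. -/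
def frameDet (n : ℕ) : ((Fin n → ℂ) →L[ℝ] ℂ) [⋀^Fin (n * 2)]→ₗ[ℂ] ℂ :=
  (Matrix.detRowAlternating (R := ℂ) (n := Fin (n * 2))).compLinearMap
    { toFun := fun θ k => θ (realFrame n k)
      map_add' := fun _ _ => rfl
      map_smul' := fun _ _ => rfl }

/-- The coefficient of `dx₁ ∧ dy₁ ∧ ⋯ ∧ dxₙ ∧ dyₙ` in an element of `Λ((ℂⁿ)* ⊗ ℂ)`;
all components of degree less than `2n` are sent to `0`. -/
def topCoeff (n : ℕ) : ExteriorAlgebra ℂ ((Fin n → ℂ) →L[ℝ] ℂ) →ₗ[ℂ] ℂ :=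
  ExteriorAlgebra.liftAlternating (Pi.single (n * 2) (frameDet n))

variable {n : ℕ} {X : Type*} [TopologicalSpace X] [ChartedSpace (Fin n → ℂ) X]

variable (n X) in
/-- A smooth partition of unity subordinate to the cover by the preferred charts. -/
def chartPartition [T2Space X] [SigmaCompactSpace X] [IsManifold 𝓘(ℂ, Fin n → ℂ) ω X] :
    SmoothPartitionOfUnity X 𝓘(ℝ, Fin n → ℂ) X :=
  haveI := isManifold_real n X
  (SmoothPartitionOfUnity.exists_isSubordinate_chartAt_source 𝓘(ℝ, Fin n → ℂ) X).choose

theorem chartPartition_isSubordinate [T2Space X] [SigmaCompactSpace X]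
    [IsManifold 𝓘(ℂ, Fin n → ℂ) ω X] :
    (chartPartition n X).IsSubordinate fun x => (chartAt (Fin n → ℂ) x).source :=
  haveI := isManifold_real n X
  (SmoothPartitionOfUnity.exists_isSubordinate_chartAt_source 𝓘(ℝ, Fin n → ℂ) X).choose_spec

/-- The density, in the preferred chart at `c`, of the top-degree part of `ρ_c η`, where `ρ` is
the partition of unity. -/
def density [T2Space X] [SigmaCompactSpace X] [IsManifold 𝓘(ℂ, Fin n → ℂ) ω X]
    (η : Form n X) (c : X) (y : Fin n → ℂ) : ℂ :=
  (chartPartition n X c ((chartAt (Fin n → ℂ) c).symm y) : ℂ) *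
    topCoeff n (inChart (chartAt (Fin n → ℂ) c) η y)

/-- Absolute convergence of `∫_X η`, for forms vanishing outside a compact set. -/
def IsIntegrable [T2Space X] [SigmaCompactSpace X] [IsManifold 𝓘(ℂ, Fin n → ℂ) ω X]
    (η : Form n X) : Prop :=
  ∀ c : X, MeasureTheory.IntegrableOn (density η c) (chartAt (Fin n → ℂ) c).target

/-- `∫_X η`, the integral of the top-degree part of a form vanishing outside a compact set, for the
orientation of `X` given by the complex structure. -/
def integral [T2Space X] [SigmaCompactSpace X] [IsManifold 𝓘(ℂ, Fin n → ℂ) ω X]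
    (η : Form n X) : ℂ :=
  ∑ᶠ c : X, ∫ y in (chartAt (Fin n → ℂ) c).target, density η c y

/-- `η` vanishes outside a compact set. -/
def IsCompactlySupported (η : Form n X) : Prop :=
  ∃ K : Set X, IsCompact K ∧ ∀ x, x ∉ K → η x = 0

/-- `c` is the residue at `s = 0` of the zeta function `ζ(s; μ, η) = ∫_X μ^{s/2} η`: the integral
converges absolutely for `Re s` large, continues meromorphically to a half-plane containing `0`
in its interior, and the continuation `Z` has residue `c` at `0`. -/
def IsZetaResidue [T2Space X] [SigmaCompactSpace X] [IsManifold 𝓘(ℂ, Fin n → ℂ) ω X]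
    (μ : X → ℝ) (η : Form n X) (c : ℂ) : Prop :=
  ∃ (δ : ℝ) (A : ℝ) (Z : ℂ → ℂ), 0 < δ ∧ MeromorphicOn Z {s : ℂ | -δ < s.re} ∧
    (∀ s : ℂ, A < s.re →
      IsIntegrable (fun x => ((μ x : ℂ) ^ (s / 2)) • η x) ∧
      Z s = integral (fun x => ((μ x : ℂ) ^ (s / 2)) • η x)) ∧
    ∀ᶠ r : ℝ in 𝓝[>] 0, (∮ s in C(0, r), Z s) = 2 * Real.pi * Complex.I * c

end Integration

section Hypersurface

variable {n : ℕ} {X : Type*} [TopologicalSpace X] [ChartedSpace (Fin n → ℂ) X]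

/-- `f` is a local equation on the open set `U` for the complex hypersurface `D`. -/
structure IsLocalEquation (D U : Set X) (f : X → ℂ) : Prop where
  isOpen : IsOpen U
  holomorphic : ContMDiffOn 𝓘(ℂ, Fin n → ℂ) 𝓘(ℂ, ℂ) ω f U
  zero_iff : ∀ x ∈ U, f x = 0 ↔ x ∈ D
  mfderiv_ne_zero : ∀ x ∈ U ∩ D, mfderiv 𝓘(ℂ, Fin n → ℂ) 𝓘(ℂ, ℂ) f x ≠ 0

/-- `μ` belongs to the canonical conformal class of nonnegative Morse–Bott functions with zero set
the complex hypersurface `D`: for every local equation `f`, the quotient `μ / |f|²` extends to a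
positive smooth function. (The Hessian of `μ` then has rank two along `D`.) -/
structure IsCanonicalMorseBott (D : Set X) (μ : X → ℝ) : Prop where
  smooth : ContMDiff 𝓘(ℝ, Fin n → ℂ) 𝓘(ℝ, ℝ) ∞ μ
  nonneg : ∀ x, 0 ≤ μ x
  zero_iff : ∀ x, μ x = 0 ↔ x ∈ D
  conformal : ∀ (U : Set X) (f : X → ℂ), IsLocalEquation (n := n) D U f →
    ∃ h : X → ℝ, ContMDiffOn 𝓘(ℝ, Fin n → ℂ) 𝓘(ℝ, ℝ) ∞ h U ∧
      ∀ x ∈ U, 0 < h x ∧ μ x = h x * ‖f x‖ ^ 2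

/-- The global sections of the sheaf `𝒜_{X,μ}`: forms `η` on `X ∖ D` such that locally on `X`
some `μ^N η` extends smoothly. (Off `D` this says that `η` is smooth.) -/
def HasFinitePole (D : Set X) (μ : X → ℝ) (η : Form n X) : Prop :=
  ∀ x : X, ∃ U : Set X, IsOpen U ∧ x ∈ U ∧
    ∃ N : ℕ, ExtendsSmoothly D (fun y => ((μ y : ℂ) ^ N) • η y) U

/-- Tame singularities along `D` of half-codimension `r`: `η` is a section of `𝒜_{X,μ}`, and
`μ^r η` and `μ^{r-1} dμ ∧ η` extend to smooth forms on `X`. -/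
structure IsTame (D : Set X) (r : ℕ) (μ : X → ℝ) (η : Form n X) : Prop where
  finitePole : HasFinitePole D μ η
  pow_smul : ExtendsSmoothly D (fun x => ((μ x : ℂ) ^ r) • η x) Set.univ
  d_mul : ExtendsSmoothly D
    (fun x => ((μ x : ℂ) ^ (r - 1)) • (d (n := n) (fun y => (μ y : ℂ)) x * η x)) Set.univ

/-- On `U ∖ D` the form `η` equals
`df/f ∧ df̄/f̄ ∧ η₁₁ + df/f ∧ η₁₀ + df̄/f̄ ∧ η₀₁ + η₀₀`, with `ηᵢⱼ` smooth on `U`. -/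
structure IsBilogarithmic (D U : Set X) (f : X → ℂ) (η η₁₁ η₁₀ η₀₁ η₀₀ : Form n X) : Prop where
  smooth₁₁ : IsSmoothOn η₁₁ U
  smooth₁₀ : IsSmoothOn η₁₀ U
  smooth₀₁ : IsSmoothOn η₀₁ U
  smooth₀₀ : IsSmoothOn η₀₀ U
  eq : ∀ x ∈ U \ D,
    η x = ((f x)⁻¹ • d f x) * ((starRingEnd ℂ (f x))⁻¹ • d (fun y => starRingEnd ℂ (f y)) x)
          * η₁₁ x
      + ((f x)⁻¹ • d f x) * η₁₀ x
      + ((starRingEnd ℂ (f x))⁻¹ • d (fun y => starRingEnd ℂ (f y)) x) * η₀₁ x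
      + η₀₀ x

/-- `ρ` is the residue `R(η)`: the smooth form on the submanifold `i : Y → X` such that
`res_{s=0} ζ(s; μ, η ∧ φ) = ∫_Y ρ ∧ i^*φ` for all compactly supported smooth forms `φ` on `X`. -/
structure IsResidue {m : ℕ} {Y : Type*} [TopologicalSpace Y] [ChartedSpace (Fin m → ℂ) Y]
    [T2Space X] [SigmaCompactSpace X] [IsManifold 𝓘(ℂ, Fin n → ℂ) ω X]
    [T2Space Y] [SigmaCompactSpace Y] [IsManifold 𝓘(ℂ, Fin m → ℂ) ω Y]
    (i : Y → X) (μ : X → ℝ) (η : Form n X) (ρ : Form m Y) : Prop where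
  smooth : IsSmoothOn ρ Set.univ
  pairing : ∀ φ : Form n X, IsSmoothOn φ Set.univ → IsCompactlySupported φ →
    IsZetaResidue μ (fun x => η x * φ x) (integral (fun y => ρ y * pullback i φ y))

end Hypersurface

end HadamardResidue

end

/-!
Let `D` be the image of the embedding `i`, `f` a local equation of `D`, and `μ = h |f|²` with
`h > 0`. Everything is local until the end, and forms are studied through their expressions in
holomorphic charts, which are functions with values in a fixed exterior algebra.

**Tame and bilogarithmic.** If `η` is bilogarithmic then `|f|² η` and
`d|f|² ∧ η = f̄ df ∧ η + f df̄ ∧ η` visibly have no poles, and multiplying by `h` changes nothing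
(`isTame_of_isBilogarithmic`). Conversely suppose that `α = |f|² η` and `β = d|f|² ∧ η` are smooth.
Contracting with the gradients of `f` and `f̄` in a chart splits every form as
`g² η = - df df̄ k(η) + df k(df̄ η) - df̄ k(df η) - k(df df̄ η)`, where `g` is the squared length
of the gradient of `f` (`IsLocalEquation.exists_contraction`). The four terms must be shown to have
the poles allowed in a bilogarithmic expression. For the first one this holds as
`|f|² k(η) = k(α)`. For the second and the last one it follows from the principle that `θ` is
smooth as soon as `f θ` and `f̄ θ` are, applied to `θ = f k(df̄ η)` and `θ = k(df df̄ η)`, whose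
products with `f` and `f̄` are expressed by `α` and `β`; for the third one,
`f̄ k(df η) = k(β) - f k(df̄ η)`. Off `D`, where `g` may vanish, `(g + |f|²)²` takes the place of
`g²`. The principle (`exists_contDiffOn_div`) says that `a / f` is smooth if `f̄ a = f b` with `a`,
`b` smooth; repeated differentiation of this relation by a vector field `∂` with `∂ f = 1`,
`∂ f̄ = 0` writes `a / f` as a polynomial in `f` with smooth coefficients plus a smooth multiple of
`f ^ k / f̄`, for every `k`, and the latter function is as smooth as desired.

**Residues.** By a partition of unity (`hasSimpleZetaPole_of_local`) only test forms supported in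
small charts matter. Off `D` there is no pole. Near `D` the chart can be chosen with first
coordinate `f` (`IsLocalEquation.exists_isAdapted`), and the zeta function becomes
`∫ |z| ^ (s - 2) e ^ (s k) Ψ(z, w)` with a test function `Ψ` whose restriction to `z = 0` is the
coefficient of `df df̄ η₁₁ φ`, that is `-2i` times that of the restriction of `η₁₁ φ` to `D`.
Subtracting the value on `z = 0` improves the singularity by one order and leaves a function
holomorphic for `Re s > -1`; the subtracted part is `∫_{|z| ≤ R} |z| ^ (s - 2) = 2π R ^ s / s`
times an entire function (`exists_zeta_continuation`). Hence the residue at `0` is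
`2π · (-2i) = -4πi` times `∫_D η₁₁ ∧ φ`.

Residues of meromorphic continuations are unique, and a smooth form on `D` is determined by its
pairings with test forms of small support (`IsAdapted.eq_of_integral_eq`, which rests on Poincaré
duality in the exterior algebra). So the local forms `-4πi η₁₁` agree for all local equations and
all representations (`IsBilogarithmic.pullback_eq`); they glue to the residue form, which is unique
for the same reason.
-/

noncomputable section

namespace HadamardResidue

/-! ### Linear algebra of the exterior algebra of complexified covectors -/

/-- The exterior algebra `Λ((ℂⁿ)* ⊗ ℂ)` in which chart expressions of forms take their values. -/
abbrev CovectorAlgebra (n : ℕ) : Type := ExteriorAlgebra ℂ ((Fin n → ℂ) →L[ℝ] ℂ)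

/-- The oriented real frame `realFrame n` as a basis of `ℂⁿ` over `ℝ`. -/
def frameBasis (n : ℕ) : Module.Basis (Fin (n * 2)) ℝ (Fin n → ℂ) :=
  (Pi.basis fun _ : Fin n => Complex.basisOneI).reindex
    ((Equiv.sigmaEquivProd (Fin n) (Fin 2)).trans finProdFinEquiv)

theorem frameBasis_apply (n : ℕ) (k : Fin (n * 2)) : frameBasis n k = realFrame n k := by
  obtain ⟨⟨j, c⟩, rfl⟩ := finProdFinEquiv.surjective k
  have h : (finProdFinEquiv : Fin n × Fin 2 ≃ Fin (n * 2)).symm (finProdFinEquiv (j, c)) = (j, c) :=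
    Equiv.symm_apply_apply _ _
  simp only [frameBasis, Module.Basis.reindex_apply, realFrame, h, Equiv.symm_trans_apply,
    Equiv.sigmaEquivProd_symm_apply, Pi.basis_apply]
  fin_cases c <;> simp

/-- A complexified covector is determined by its values on the real frame. -/
def covectorEquiv (n : ℕ) : ((Fin n → ℂ) →L[ℝ] ℂ) ≃ₗ[ℂ] (Fin (n * 2) → ℂ) where
  toFun θ k := θ (realFrame n k)
  map_add' _ _ := rfl
  map_smul' _ _ := rfl
  invFun c := LinearMap.toContinuousLinearMap ((frameBasis n).constr ℝ c)
  left_inv θ := by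
    apply ContinuousLinearMap.coe_injective
    refine (frameBasis n).ext fun k => ?_
    rw [frameBasis_apply]
    change (frameBasis n).constr ℝ (fun k => θ (realFrame n k)) (realFrame n k) = _
    rw [← frameBasis_apply, Module.Basis.constr_basis, frameBasis_apply]
    rfl
  right_inv c := by
    funext k
    simp [← frameBasis_apply]

/-- The basis of the complexified covectors dual to the real frame. -/
def covectorBasis (n : ℕ) : Module.Basis (Fin (n * 2)) ℂ ((Fin n → ℂ) →L[ℝ] ℂ) :=
  Module.Basis.ofEquivFun (covectorEquiv n)

theorem covectorBasis_apply (n : ℕ) (j k : Fin (n * 2)) :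
    covectorBasis n j (realFrame n k) = if j = k then 1 else 0 := by
  have h : (covectorBasis n).equivFun (covectorBasis n j) k =
      (Pi.single j 1 : Fin (n * 2) → ℂ) k := by
    simp [Pi.single_apply, eq_comm]
  have h' : (covectorBasis n).equivFun = covectorEquiv n := by
    simp [covectorBasis]
  rw [h'] at h
  simpa [covectorEquiv, Pi.single_apply, eq_comm] using h

instance covectorAlgebra_finite (n : ℕ) : Module.Finite ℂ (CovectorAlgebra n) :=
  Module.Finite.of_basis (covectorBasis n).ExteriorAlgebra

theorem topCoeff_ιMulti (n m : ℕ) (v : Fin m → ((Fin n → ℂ) →L[ℝ] ℂ)) :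
    topCoeff n (ExteriorAlgebra.ιMulti ℂ m v) =
      if h : m = n * 2 then
        (Matrix.of fun i j : Fin (n * 2) => v (Fin.cast h.symm i) (realFrame n j)).det
      else 0 := by
  rw [topCoeff, ExteriorAlgebra.liftAlternating_apply_ιMulti]
  split_ifs with h
  · subst h
    rw [Pi.single_eq_same]
    rfl
  · rw [Pi.single_eq_of_ne h]
    rfl

theorem covectorAlgebra_ext {n : ℕ} {N : Type*} [AddCommGroup N] [Module ℂ N]
    {f g : CovectorAlgebra n →ₗ[ℂ] N}
    (h : ∀ (m : ℕ) (v : Fin m → ((Fin n → ℂ) →L[ℝ] ℂ)),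
      f (ExteriorAlgebra.ιMulti ℂ m v) = g (ExteriorAlgebra.ιMulti ℂ m v)) : f = g :=
  ExteriorAlgebra.lhom_ext fun m => AlternatingMap.ext (h m)

/-- The top coefficient transforms by the real Jacobian determinant. -/
theorem topCoeff_map_transpose {n : ℕ} (L : (Fin n → ℂ) →L[ℝ] (Fin n → ℂ))
    (a : CovectorAlgebra n) :
    topCoeff n (ExteriorAlgebra.map (transpose L) a) = (L.det : ℂ) * topCoeff n a := by
  have key : (topCoeff n).comp (ExteriorAlgebra.map (transpose L)).toLinearMap
      = (L.det : ℂ) • topCoeff n := by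
    refine covectorAlgebra_ext fun m v => ?_
    rw [LinearMap.comp_apply, AlgHom.toLinearMap_apply, ExteriorAlgebra.map_apply_ιMulti,
      LinearMap.smul_apply, topCoeff_ιMulti, topCoeff_ιMulti]
    split_ifs with h
    · subst h
      have hL : L.det = (LinearMap.toMatrix (frameBasis n) (frameBasis n) L.toLinearMap).det := by
        rw [LinearMap.det_toMatrix]
      have hmap : ((LinearMap.toMatrix (frameBasis n) (frameBasis n) L.toLinearMap).det : ℂ) =
          ((LinearMap.toMatrix (frameBasis n) (frameBasis n) L.toLinearMap).map
            (algebraMap ℝ ℂ)).det := by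
        rw [← RingHom.mapMatrix_apply, ← RingHom.map_det]; rfl
      rw [hL, hmap, smul_eq_mul, mul_comm (Matrix.det (Matrix.map _ _)), ← Matrix.det_mul]
      congr 1
      ext i j
      have hexp : L (realFrame n j) = ∑ k, (LinearMap.toMatrix (frameBasis n) (frameBasis n)
          L.toLinearMap) k j • realFrame n k := by
        have := (frameBasis n).sum_repr (L (realFrame n j))
        simp_rw [LinearMap.toMatrix_apply, frameBasis_apply] at this ⊢
        exact this.symm
      simp only [Matrix.of_apply, Matrix.mul_apply, Matrix.map_apply, Function.comp_apply]
      change v _ (L (realFrame n j)) = _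
      rw [hexp, map_sum]
      refine Finset.sum_congr rfl fun k _ => ?_
      rw [map_smul, Complex.real_smul, mul_comm]
      rfl
    · simp
  have := LinearMap.congr_fun key a
  simpa using this

theorem det_restrictScalars_nonneg {n : ℕ} (L : (Fin n → ℂ) →L[ℂ] (Fin n → ℂ)) :
    0 ≤ (L.restrictScalars ℝ).det := by
  have h : (L.restrictScalars ℝ).det = Complex.normSq (LinearMap.det L.toLinearMap) := by
    rw [← Algebra.norm_complex_apply, ← LinearMap.det_restrictScalars]
    rfl
  rw [h]
  exact Complex.normSq_nonneg _

/-- The linear inclusion of `ℂⁿ` into `ℂⁿ⁺¹` as the hyperplane where the first coordinate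
vanishes. -/
def hyperplaneInclusion (n : ℕ) : (Fin n → ℂ) →L[ℂ] (Fin (n + 1) → ℂ) :=
  LinearMap.toContinuousLinearMap
    { toFun := fun w => Fin.cons 0 w
      map_add' := fun w w' => by
        funext j; refine Fin.cases ?_ (fun j => ?_) j <;> simp
      map_smul' := fun c w => by
        funext j; refine Fin.cases ?_ (fun j => ?_) j <;> simp }

@[simp] theorem hyperplaneInclusion_apply (n : ℕ) (w : Fin n → ℂ) :
    hyperplaneInclusion n w = Fin.cons 0 w := rfl

/-- The first coordinate of `ℂⁿ⁺¹`. -/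
def firstCoord (n : ℕ) : (Fin (n + 1) → ℂ) →L[ℂ] ℂ :=
  ContinuousLinearMap.proj 0

@[simp] theorem firstCoord_apply (n : ℕ) (z : Fin (n + 1) → ℂ) : firstCoord n z = z 0 := rfl

/-- The differential `dz₀` of the first coordinate, as a complexified covector. -/
def dz (n : ℕ) : (Fin (n + 1) → ℂ) →L[ℝ] ℂ := (firstCoord n).restrictScalars ℝ

/-- The differential `dz̄₀` of the conjugate of the first coordinate. -/
def dzbar (n : ℕ) : (Fin (n + 1) → ℂ) →L[ℝ] ℂ :=
  (Complex.conjCLE : ℂ →L[ℝ] ℂ).comp (dz n)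

theorem realFrame_finProd (n : ℕ) (j : Fin n) (c : Fin 2) :
    realFrame n (finProdFinEquiv (j, c)) = Pi.single j (if c = 0 then 1 else Complex.I) := by
  simp only [realFrame, Equiv.symm_apply_apply]

/-- The two parts of the real frame of `ℂⁿ⁺¹`: the frame of the first factor, and that of the
hyperplane. -/
def frameSplit (n : ℕ) : Fin 2 ⊕ Fin (n * 2) ≃ Fin ((n + 1) * 2) :=
  finSumFinEquiv.trans (finCongr (by ring))

theorem realFrame_frameSplit_inl (n : ℕ) (c : Fin 2) :
    realFrame (n + 1) (frameSplit n (Sum.inl c)) =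
      Pi.single 0 (if c = 0 then 1 else Complex.I) := by
  have : frameSplit n (Sum.inl c) = finProdFinEquiv ((0 : Fin (n + 1)), c) := by
    apply Fin.ext
    simp [frameSplit]
  rw [this, realFrame_finProd]

theorem realFrame_frameSplit_inr (n : ℕ) (k : Fin (n * 2)) :
    realFrame (n + 1) (frameSplit n (Sum.inr k)) = hyperplaneInclusion n (realFrame n k) := by
  obtain ⟨⟨j, c⟩, rfl⟩ := finProdFinEquiv.surjective k
  have : frameSplit n (Sum.inr (finProdFinEquiv (j, c))) =
      finProdFinEquiv ((j.succ : Fin (n + 1)), c) := by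
    apply Fin.ext
    simp [frameSplit]
    ring
  rw [this, realFrame_finProd, realFrame_finProd]
  funext i
  refine Fin.cases ?_ (fun i => ?_) i
  · simp
  · by_cases h : i = j
    · subst h; simp
    · simp [h, Pi.single_eq_of_ne]

/-- Integration along the normal direction of the hyperplane on the level of covectors:
`dz₀ ∧ dz̄₀ = -2i dx₀ ∧ dy₀`. -/
theorem topCoeff_dz_dzbar_mul (n : ℕ) (a : CovectorAlgebra (n + 1)) :
    topCoeff (n + 1) (ExteriorAlgebra.ι ℂ (dz n) * ExteriorAlgebra.ι ℂ (dzbar n) * a) =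
      (-2 * Complex.I) * topCoeff n (ExteriorAlgebra.map
        (transpose ((hyperplaneInclusion n).restrictScalars ℝ)) a) := by
  have key : (topCoeff (n + 1)).comp (LinearMap.mulLeft ℂ
      (ExteriorAlgebra.ι ℂ (dz n) * ExteriorAlgebra.ι ℂ (dzbar n)))
      = (-2 * Complex.I) • (topCoeff n).comp (ExteriorAlgebra.map
        (transpose ((hyperplaneInclusion n).restrictScalars ℝ))).toLinearMap := by
    refine covectorAlgebra_ext fun m v => ?_
    have h2 : ExteriorAlgebra.ι ℂ (dz n) * ExteriorAlgebra.ι ℂ (dzbar n) *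
        ExteriorAlgebra.ιMulti ℂ m v =
        ExteriorAlgebra.ιMulti ℂ (m + 2) (Matrix.vecCons (dz n) (Matrix.vecCons (dzbar n) v)) := by
      rw [ExteriorAlgebra.ιMulti_succ_apply, mul_assoc]
      congr 1
      rw [ExteriorAlgebra.ιMulti_succ_apply]
      rfl
    rw [LinearMap.comp_apply, LinearMap.mulLeft_apply, h2, LinearMap.smul_apply,
      LinearMap.comp_apply, AlgHom.toLinearMap_apply, ExteriorAlgebra.map_apply_ιMulti,
      topCoeff_ιMulti, topCoeff_ιMulti]
    by_cases h : m = n * 2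
    · subst h
      rw [dif_pos (by ring), dif_pos rfl, ← Matrix.det_submatrix_equiv_self (frameSplit n),
        smul_eq_mul]
      set D : Matrix (Fin (n * 2)) (Fin (n * 2)) ℂ := Matrix.of fun i j =>
        v i (hyperplaneInclusion n (realFrame n j)) with hD
      set C : Matrix (Fin (n * 2)) (Fin 2) ℂ := Matrix.of fun i c =>
        v i (Pi.single 0 (if c = 0 then 1 else Complex.I)) with hC
      set A : Matrix (Fin 2) (Fin 2) ℂ := !![1, Complex.I; 1, -Complex.I] with hA
      -- The covectors `dz₀`, `dz̄₀` vanish on the part of the frame inside the hyperplane.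
      have hblock : (Matrix.of fun i j : Fin ((n + 1) * 2) =>
          Matrix.vecCons (dz n) (Matrix.vecCons (dzbar n) v)
            (Fin.cast (show (n + 1) * 2 = n * 2 + 2 by ring) i)
            (realFrame (n + 1) j)).submatrix (frameSplit n) (frameSplit n)
          = Matrix.fromBlocks A 0 C D := by
        ext i j
        have h0 : (Fin.cast (show (n + 1) * 2 = n * 2 + 2 by ring) (frameSplit n (Sum.inl 0))) =
            0 := by
          apply Fin.ext; simp [frameSplit]
        have h1 : (Fin.cast (show (n + 1) * 2 = n * 2 + 2 by ring) (frameSplit n (Sum.inl 1))) =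
            1 := by
          apply Fin.ext; simp [frameSplit]
        have hi : ∀ i, (Fin.cast (show (n + 1) * 2 = n * 2 + 2 by ring)
            (frameSplit n (Sum.inr i))) = i.succ.succ := by
          intro i
          apply Fin.ext; simp [frameSplit]
        rcases i with i | i <;> rcases j with j | j
        · rw [Matrix.submatrix_apply, Matrix.of_apply, realFrame_frameSplit_inl,
            Matrix.fromBlocks_apply₁₁]
          fin_cases i <;> fin_cases j
          · simp [h0, dz, A]
          · simp [h0, dz, A]
          · simp [h1, dz, dzbar, A]
          · simp [h1, dz, dzbar, A]
        · rw [Matrix.submatrix_apply, Matrix.of_apply, realFrame_frameSplit_inr,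
            Matrix.fromBlocks_apply₁₂]
          fin_cases i
          · simp [h0, dz]
          · simp [h1, dz, dzbar]
        · rw [Matrix.submatrix_apply, Matrix.of_apply, realFrame_frameSplit_inl, hi,
            Matrix.fromBlocks_apply₂₁]
          rfl
        · rw [Matrix.submatrix_apply, Matrix.of_apply, realFrame_frameSplit_inr, hi,
            Matrix.fromBlocks_apply₂₂]
          rfl
      rw [hblock, Matrix.det_fromBlocks_zero₁₂]
      congr 1
      rw [hA, Matrix.det_fin_two_of]
      ring
    · rw [dif_neg (by omega), dif_neg h, smul_zero]
  exact LinearMap.congr_fun key a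

/-- Poincaré duality: the pairing `(a, b) ↦ topCoeff (a ∧ b)` is nondegenerate. -/
theorem eq_zero_of_forall_topCoeff_mul_eq_zero {n : ℕ} {a : CovectorAlgebra n}
    (h : ∀ b, topCoeff n (a * b) = 0) : a = 0 := by
  set B := (covectorBasis n).ExteriorAlgebra with hB
  have hBs : ∀ s : Finset (Fin (n * 2)), B s = ExteriorAlgebra.ιMulti ℂ s.card
      (fun k => covectorBasis n (s.orderEmbOfFin rfl k)) := fun s => by
    rw [hB, ExteriorAlgebra.basis_apply]
    rfl
  have htop : topCoeff n (B Finset.univ) ≠ 0 := by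
    rw [hBs, topCoeff_ιMulti, dif_pos (by simp)]
    have hmat : (Matrix.of fun i j : Fin (n * 2) => covectorBasis n
        ((Finset.univ : Finset (Fin (n * 2))).orderEmbOfFin rfl (Fin.cast (by simp) i))
          (realFrame n j)) = 1 := by
      have hid : ∀ i : Fin (n * 2), (Finset.univ : Finset (Fin (n * 2))).orderEmbOfFin rfl
          (Fin.cast (by simp) i) = i := by
        have := Finset.orderEmbOfFin_unique (s := (Finset.univ : Finset (Fin (n * 2)))) (k := n * 2)
          (by simp) (f := id) (by simp) strictMono_id
        intro i
        have h2 := congrFun this i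
        rw [id] at h2
        conv_rhs => rw [h2]
        apply Finset.orderEmbOfFin_eq_orderEmbOfFin_iff.mpr
        rfl
      ext i j
      rw [Matrix.of_apply, hid, covectorBasis_apply, Matrix.one_apply]
    rw [hmat, Matrix.det_one]
    exact one_ne_zero
  apply B.ext_elem
  intro s
  rw [map_zero, Finsupp.zero_apply]
  -- Wedging with the complementary basis element isolates the coefficient of `B s`.
  have hs := h (B sᶜ)
  have hcard : ∀ t : Finset (Fin (n * 2)), t ≠ s → topCoeff n (B t * B sᶜ) = 0 := by
    intro t hts
    by_cases hd : Disjoint t sᶜ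
    · have hsub : t ⊆ s := by simpa [disjoint_compl_right_iff] using hd
      have hlt : t.card < s.card := Finset.card_lt_card (hsub.ssubset_of_ne hts)
      rw [hBs, hBs, ExteriorAlgebra.ιMulti_mul_ιMulti, topCoeff_ιMulti, dif_neg]
      have := Finset.card_compl s
      have h3 := Finset.card_le_univ s
      simp only [Fintype.card_fin] at this h3
      omega
    · rw [ExteriorAlgebra.basis_mul_of_not_disjoint (covectorBasis n)
        (⟨t, rfl⟩ : Set.powersetCard _ t.card) (⟨sᶜ, rfl⟩ : Set.powersetCard _ (sᶜ).card) hd,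
        map_zero]
  have hss : topCoeff n (B s * B sᶜ) ≠ 0 := by
    have hd : Disjoint s sᶜ := disjoint_compl_right
    rw [ExteriorAlgebra.basis_mul_of_disjoint (covectorBasis n)
        (s := (⟨s, rfl⟩ : Set.powersetCard _ s.card))
        (t := (⟨sᶜ, rfl⟩ : Set.powersetCard _ (sᶜ).card)) hd]
    have : ((Set.powersetCard.disjUnion (s := (⟨s, rfl⟩ : Set.powersetCard _ s.card))
        (t := (⟨sᶜ, rfl⟩ : Set.powersetCard _ (sᶜ).card)) hd).val) = Finset.univ := by
      simp
    rw [this, Units.smul_def, map_zsmul]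
    exact smul_ne_zero (Units.ne_zero _) htop
  rw [← B.sum_repr a, Finset.sum_mul, map_sum, Finset.sum_eq_single s] at hs
  · rw [smul_mul_assoc, map_smul, smul_eq_mul] at hs
    exact (mul_eq_zero.mp hs).resolve_right hss
  · intro t _ hts
    rw [smul_mul_assoc, map_smul, hcard t hts, smul_zero]
  · simp

/-- The interior product with a linear form on the covectors (a complexified tangent vector). -/
def interior {M : Type*} [AddCommGroup M] [Module ℂ M] (v : Module.Dual ℂ M) :
    ExteriorAlgebra ℂ M →ₗ[ℂ] ExteriorAlgebra ℂ M :=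
  CliffordAlgebra.contractLeft v

theorem interior_ι_mul {M : Type*} [AddCommGroup M] [Module ℂ M] (v : Module.Dual ℂ M) (θ : M)
    (a : ExteriorAlgebra ℂ M) :
    interior v (ExteriorAlgebra.ι ℂ θ * a) = v θ • a - ExteriorAlgebra.ι ℂ θ * interior v a :=
  CliffordAlgebra.contractLeft_ι_mul v θ a

/-! ### Smoothness of functions with values in a finite-dimensional space, tested by coefficients -/

/-- All coefficients of the vector-valued function `F` are smooth at `y`. The target carries no
topology: this is applied to exterior algebras. -/
def CoeffSmoothAt {G A : Type*} [NormedAddCommGroup G] [NormedSpace ℝ G] [AddCommGroup A]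
    [Module ℂ A] (F : G → A) (y : G) : Prop :=
  ∀ l : A →ₗ[ℂ] ℂ, ContDiffAt ℝ ∞ (fun z => l (F z)) y

namespace CoeffSmoothAt

variable {G G' A B C : Type*} [NormedAddCommGroup G] [NormedSpace ℝ G]
  [NormedAddCommGroup G'] [NormedSpace ℝ G']
  [AddCommGroup A] [Module ℂ A] [AddCommGroup B] [Module ℂ B] [AddCommGroup C] [Module ℂ C]
  {F F' : G → A} {y : G}

theorem congr (h : CoeffSmoothAt F y) (h' : F' =ᶠ[𝓝 y] F) : CoeffSmoothAt F' y := fun l =>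
  (h l).congr_of_eventuallyEq (h'.mono fun z hz => by simp only [hz])

theorem const (a : A) : CoeffSmoothAt (fun _ : G => a) y := fun _ => contDiffAt_const

theorem add (h : CoeffSmoothAt F y) (h' : CoeffSmoothAt F' y) :
    CoeffSmoothAt (fun z => F z + F' z) y := fun l => by
  simpa only [map_add] using (h l).add (h' l)

theorem sub (h : CoeffSmoothAt F y) (h' : CoeffSmoothAt F' y) :
    CoeffSmoothAt (fun z => F z - F' z) y := fun l => by
  simpa only [map_sub] using (h l).sub (h' l)

theorem smul {c : G → ℂ} (hc : ContDiffAt ℝ ∞ c y) (h : CoeffSmoothAt F y) :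
    CoeffSmoothAt (fun z => c z • F z) y := fun l => by
  simpa only [map_smul, smul_eq_mul] using hc.mul (h l)

theorem sum {κ : Type*} {s : Finset κ} {F : κ → G → A} (h : ∀ k ∈ s, CoeffSmoothAt (F k) y) :
    CoeffSmoothAt (fun z => ∑ k ∈ s, F k z) y := fun l => by
  simpa only [map_sum] using ContDiffAt.sum fun k hk => h k hk l

theorem linearMap (T : A →ₗ[ℂ] B) (h : CoeffSmoothAt F y) :
    CoeffSmoothAt (fun z => T (F z)) y := fun l => h (l.comp T)

theorem comp {g : G' → G} {x : G'} (hF : CoeffSmoothAt F (g x)) (hg : ContDiffAt ℝ ∞ g x) :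
    CoeffSmoothAt (fun z => F (g z)) x := fun l =>
  ContDiffAt.comp x (g := fun z => l (F z)) (hF l) hg

theorem bilin [Module.Finite ℂ A] (T : A →ₗ[ℂ] B →ₗ[ℂ] C) {F : G → A} {F' : G → B}
    (h : CoeffSmoothAt F y) (h' : CoeffSmoothAt F' y) :
    CoeffSmoothAt (fun z => T (F z) (F' z)) y := by
  let b := Module.finBasis ℂ A
  have : (fun z => T (F z) (F' z)) = fun z => ∑ k, b.coord k (F z) • T (b k) (F' z) := by
    funext z
    conv_lhs => rw [← b.sum_repr (F z)]
    simp only [map_sum, map_smul, LinearMap.sum_apply, LinearMap.smul_apply,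
      Module.Basis.coord_apply]
  rw [this]
  exact sum fun k _ => smul (h (b.coord k)) (h'.linearMap (T (b k)))

theorem mul {A : Type*} [Ring A] [Algebra ℂ A] [Module.Finite ℂ A] {F F' : G → A}
    (h : CoeffSmoothAt F y) (h' : CoeffSmoothAt F' y) :
    CoeffSmoothAt (fun z => F z * F' z) y :=
  bilin (LinearMap.mul ℂ A) h h'

theorem of_contDiffAt {V : Type*} [NormedAddCommGroup V] [NormedSpace ℂ V]
    [FiniteDimensional ℂ V] {F : G → V} (h : ContDiffAt ℝ ∞ F y) : CoeffSmoothAt F y := fun l =>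
  ((l.toContinuousLinearMap.restrictScalars ℝ).contDiff.contDiffAt).comp y h

end CoeffSmoothAt

instance covector_finite (n : ℕ) : Module.Finite ℂ ((Fin n → ℂ) →L[ℝ] ℂ) :=
  Module.Finite.of_basis (covectorBasis n)

/-- The coefficients of a pulled back form are polynomial in the derivative of the map. -/
theorem CoeffSmoothAt.map_transpose {m n : ℕ} {G : Type*} [NormedAddCommGroup G]
    [NormedSpace ℝ G] {y : G} {L : G → (Fin m → ℂ) →L[ℝ] (Fin n → ℂ)} {F : G → CovectorAlgebra n}
    (hL : ContDiffAt ℝ ∞ L y) (hF : CoeffSmoothAt F y) :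
    CoeffSmoothAt (fun z => ExteriorAlgebra.map (transpose (L z)) (F z)) y := by
  have key : ∀ a : CovectorAlgebra n,
      CoeffSmoothAt (fun z => ExteriorAlgebra.map (transpose (L z)) a) y := by
    intro a
    induction a using ExteriorAlgebra.induction with
    | algebraMap r => simpa only [AlgHom.commutes] using CoeffSmoothAt.const _
    | ι θ =>
      simp only [ExteriorAlgebra.map_apply_ι]
      have h : ContDiffAt ℝ ∞ (fun z => θ.comp (L z)) y := contDiffAt_const.clm_comp hL
      exact (CoeffSmoothAt.of_contDiffAt h).linearMap (ExteriorAlgebra.ι ℂ)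
    | mul a b ha hb => simpa only [map_mul] using ha.mul hb
    | add a b ha hb => simpa only [map_add] using ha.add hb
  let b := Module.finBasis ℂ (CovectorAlgebra n)
  have : (fun z => ExteriorAlgebra.map (transpose (L z)) (F z)) =
      fun z => ∑ k, b.coord k (F z) • ExteriorAlgebra.map (transpose (L z)) (b k) := by
    funext z
    conv_lhs => rw [← b.sum_repr (F z)]
    simp only [map_sum, map_smul, Module.Basis.coord_apply]
  rw [this]
  exact CoeffSmoothAt.sum fun k _ => CoeffSmoothAt.smul (hF (b.coord k)) (key (b k))

theorem CoeffSmoothAt.interior {n : ℕ} {G : Type*} [NormedAddCommGroup G] [NormedSpace ℝ G]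
    {y : G} {v : G → Module.Dual ℂ ((Fin n → ℂ) →L[ℝ] ℂ)} {F : G → CovectorAlgebra n}
    (hv : CoeffSmoothAt v y) (hF : CoeffSmoothAt F y) :
    CoeffSmoothAt (fun z => HadamardResidue.interior (v z) (F z)) y :=
  CoeffSmoothAt.bilin (CliffordAlgebra.contractLeft) hv hF

theorem covectorAlgebra_eq_of_forall {n : ℕ} {a b : CovectorAlgebra n}
    (h : ∀ l : CovectorAlgebra n →ₗ[ℂ] ℂ, l a = l b) : a = b := by
  refine (Module.finBasis ℂ (CovectorAlgebra n)).ext_elem fun k => ?_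
  exact h ((Module.finBasis ℂ (CovectorAlgebra n)).coord k)

/-! ### Forms in charts -/

section Charts

variable {m n k : ℕ} {X Y Z : Type*} [TopologicalSpace X] [ChartedSpace (Fin n → ℂ) X]
  [TopologicalSpace Y] [ChartedSpace (Fin m → ℂ) Y]
  [TopologicalSpace Z] [ChartedSpace (Fin k → ℂ) Z]

variable (n X) in
/-- The holomorphic charts of a complex manifold. -/
abbrev holoAtlas : Set (OpenPartialHomeomorph X (Fin n → ℂ)) :=
  IsManifold.maximalAtlas 𝓘(ℂ, Fin n → ℂ) ω X

/-- The value of a form at `x`, in the algebra of covectors of the model space (to which the tangent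
space of `X` at `x` is definitionally equal). -/
def Form.val (η : Form n X) (x : X) : CovectorAlgebra n := η x

/-- The real derivative of a map between complex manifolds, on the model spaces. -/
def tderiv (g : Y → X) (y : Y) : (Fin m → ℂ) →L[ℝ] (Fin n → ℂ) :=
  mfderiv 𝓘(ℝ, Fin m → ℂ) 𝓘(ℝ, Fin n → ℂ) g y

theorem pullback_val (g : Y → X) (η : Form n X) (y : Y) :
    (pullback (m := m) g η).val y = ExteriorAlgebra.map (transpose (tderiv g y)) (η.val (g y)) :=
  rfl

theorem inChart_eq (e : OpenPartialHomeomorph X (Fin n → ℂ)) (η : Form n X) (y : Fin n → ℂ) :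
    inChart e η y = ExteriorAlgebra.map (transpose (tderiv e.symm y)) (η.val (e.symm y)) :=
  rfl

theorem tderiv_comp {g : Y → X} {h : Z → Y} {z : Z}
    (hg : MDifferentiableAt 𝓘(ℝ, Fin m → ℂ) 𝓘(ℝ, Fin n → ℂ) g (h z))
    (hh : MDifferentiableAt 𝓘(ℝ, Fin k → ℂ) 𝓘(ℝ, Fin m → ℂ) h z) :
    tderiv (g ∘ h) z = (tderiv (n := n) g (h z)).comp (tderiv (m := k) (n := m) h z) :=
  mfderiv_comp z hg hh

theorem tderiv_congr {g g' : Y → X} {y : Y} (h : g =ᶠ[𝓝 y] g') :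
    tderiv (m := m) (n := n) g y = tderiv g' y :=
  h.mfderiv_eq

theorem tderiv_eq_fderiv (g : (Fin m → ℂ) → (Fin n → ℂ)) (y : Fin m → ℂ) :
    tderiv g y = fderiv ℝ g y :=
  mfderiv_eq_fderiv

theorem transpose_comp {V W U : Type*} [AddCommGroup V] [Module ℝ V] [TopologicalSpace V]
    [AddCommGroup W] [Module ℝ W] [TopologicalSpace W] [AddCommGroup U] [Module ℝ U]
    [TopologicalSpace U] (L : V →L[ℝ] W) (L' : W →L[ℝ] U) :
    transpose (L'.comp L) = (transpose L).comp (transpose L') := rfl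

theorem transpose_id {V : Type*} [AddCommGroup V] [Module ℝ V] [TopologicalSpace V] :
    transpose (ContinuousLinearMap.id ℝ V) = LinearMap.id := rfl

theorem map_transpose_comp (L : (Fin k → ℂ) →L[ℝ] (Fin m → ℂ))
    (L' : (Fin m → ℂ) →L[ℝ] (Fin n → ℂ)) (a : CovectorAlgebra n) :
    ExteriorAlgebra.map (transpose (L'.comp L)) a =
      ExteriorAlgebra.map (transpose L) (ExteriorAlgebra.map (transpose L') a) := by
  rw [transpose_comp, ← ExteriorAlgebra.map_comp_map, AlgHom.comp_apply]

theorem map_transpose_id (a : CovectorAlgebra n) :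
    ExteriorAlgebra.map (transpose (ContinuousLinearMap.id ℝ (Fin n → ℂ))) a = a := by
  rw [transpose_id, ExteriorAlgebra.map_id, AlgHom.id_apply]

theorem pullback_comp {g : Y → X} {h : Z → Y} {z : Z} (η : Form n X)
    (hg : MDifferentiableAt 𝓘(ℝ, Fin m → ℂ) 𝓘(ℝ, Fin n → ℂ) g (h z))
    (hh : MDifferentiableAt 𝓘(ℝ, Fin k → ℂ) 𝓘(ℝ, Fin m → ℂ) h z) :
    (pullback (m := k) (g ∘ h) η).val z = (pullback (m := k) h (pullback (m := m) g η)).val z := by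
  rw [pullback_val, pullback_val, pullback_val, tderiv_comp hg hh, map_transpose_comp]
  rfl

theorem pullback_congr {g g' : Y → X} {y : Y} (η : Form n X) (h : g =ᶠ[𝓝 y] g') :
    (pullback (m := m) g η).val y = (pullback (m := m) g' η).val y := by
  rw [pullback_val, pullback_val, tderiv_congr h, h.eq_of_nhds]

theorem pullback_mul (g : Y → X) (η η' : Form n X) :
    pullback (m := m) g (fun x => η x * η' x) = fun y => pullback g η y * pullback g η' y := by
  funext y; exact map_mul _ _ _

/-- The real derivative of a function on a complex manifold, on the model space. -/
def realDeriv (f : X → ℂ) (x : X) : (Fin n → ℂ) →L[ℝ] ℂ :=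
  mfderiv 𝓘(ℝ, Fin n → ℂ) 𝓘(ℝ, ℂ) f x

theorem d_val (f : X → ℂ) (x : X) : (d f : Form n X).val x = ExteriorAlgebra.ι ℂ (realDeriv f x) :=
  rfl

theorem pullback_d {g : Y → X} {f : X → ℂ} {y : Y}
    (hf : MDifferentiableAt 𝓘(ℝ, Fin n → ℂ) 𝓘(ℝ, ℂ) f (g y))
    (hg : MDifferentiableAt 𝓘(ℝ, Fin m → ℂ) 𝓘(ℝ, Fin n → ℂ) g y) :
    (pullback (m := m) g (d (n := n) f)).val y = (d (f ∘ g)).val y := by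
  rw [pullback_val, d_val, d_val, ExteriorAlgebra.map_apply_ι]
  have : realDeriv (f ∘ g) y = (realDeriv (n := n) f (g y)).comp (tderiv (m := m) g y) :=
    mfderiv_comp y hf hg
  rw [this]
  rfl

theorem groupoid_real {f : OpenPartialHomeomorph (Fin n → ℂ) (Fin n → ℂ)}
    (hf : f ∈ contDiffGroupoid ω 𝓘(ℂ, Fin n → ℂ)) :
    f ∈ contDiffGroupoid ∞ 𝓘(ℝ, Fin n → ℂ) := by
  have h := (contDiffGroupoid ω 𝓘(ℂ, Fin n → ℂ)).symm hf
  have aux : ∀ g : OpenPartialHomeomorph (Fin n → ℂ) (Fin n → ℂ),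
      g ∈ contDiffGroupoid ω 𝓘(ℂ, Fin n → ℂ) → ContDiffOn ℝ ∞ g g.source := by
    intro g hg
    have h₁ : ContDiffOn ℂ ω (𝓘(ℂ, Fin n → ℂ) ∘ g ∘ 𝓘(ℂ, Fin n → ℂ).symm)
        (𝓘(ℂ, Fin n → ℂ).symm ⁻¹' g.source ∩ Set.range 𝓘(ℂ, Fin n → ℂ)) :=
      (mem_groupoid_of_pregroupoid.mp hg).1
    have h₂ : ContDiffOn ℂ ω g g.source := by simpa using h₁
    exact (h₂.restrict_scalars ℝ).of_le le_top
  rw [contDiffGroupoid, mem_groupoid_of_pregroupoid]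
  constructor
  · simpa [contDiffPregroupoid] using aux _ hf
  · simpa [contDiffPregroupoid] using aux _ h

/-- Holomorphic charts are charts of the underlying real manifold. -/
theorem mem_realAtlas {e : OpenPartialHomeomorph X (Fin n → ℂ)} (he : e ∈ holoAtlas n X) :
    e ∈ IsManifold.maximalAtlas 𝓘(ℝ, Fin n → ℂ) ∞ X := by
  intro e' he'
  exact ⟨groupoid_real (he e' he').1, groupoid_real (he e' he').2⟩

variable {e e' : OpenPartialHomeomorph X (Fin n → ℂ)}

theorem contDiffOn_transition (he : e ∈ holoAtlas n X) (he' : e' ∈ holoAtlas n X) :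
    ContDiffOn ℂ ω (e' ∘ e.symm) (e.symm ≫ₕ e').source := by
  have h := IsManifold.compatible_of_mem_maximalAtlas he he'
  have h₁ : ContDiffOn ℂ ω (𝓘(ℂ, Fin n → ℂ) ∘ (e.symm ≫ₕ e') ∘ 𝓘(ℂ, Fin n → ℂ).symm)
        (𝓘(ℂ, Fin n → ℂ).symm ⁻¹' (e.symm ≫ₕ e').source ∩ Set.range 𝓘(ℂ, Fin n → ℂ)) :=
      (mem_groupoid_of_pregroupoid.mp h).1
  simpa using h₁

theorem contDiffAt_transition (he : e ∈ holoAtlas n X) (he' : e' ∈ holoAtlas n X)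
    {y : Fin n → ℂ} (hy : y ∈ e.target) (hy' : e.symm y ∈ e'.source) :
    ContDiffAt ℂ ω (e' ∘ e.symm) y :=
  (contDiffOn_transition he he').contDiffAt
    ((e.symm ≫ₕ e').open_source.mem_nhds ⟨hy, hy'⟩)

theorem contDiffAt_real_transition (he : e ∈ holoAtlas n X) (he' : e' ∈ holoAtlas n X)
    {y : Fin n → ℂ} (hy : y ∈ e.target) (hy' : e.symm y ∈ e'.source) :
    ContDiffAt ℝ ∞ (e' ∘ e.symm) y :=
  ((contDiffAt_transition he he' hy hy').restrict_scalars ℝ).of_le le_top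

theorem contMDiffAt_chart (he : e ∈ holoAtlas n X) {x : X} (hx : x ∈ e.source) :
    ContMDiffAt 𝓘(ℝ, Fin n → ℂ) 𝓘(ℝ, Fin n → ℂ) ∞ e x :=
  contMDiffAt_of_mem_maximalAtlas (mem_realAtlas he) hx

theorem contMDiffAt_chart_symm (he : e ∈ holoAtlas n X) {y : Fin n → ℂ} (hy : y ∈ e.target) :
    ContMDiffAt 𝓘(ℝ, Fin n → ℂ) 𝓘(ℝ, Fin n → ℂ) ∞ e.symm y :=
  contMDiffAt_symm_of_mem_maximalAtlas (mem_realAtlas he) hy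

theorem mdifferentiableAt_chart (he : e ∈ holoAtlas n X) {x : X} (hx : x ∈ e.source) :
    MDifferentiableAt 𝓘(ℝ, Fin n → ℂ) 𝓘(ℝ, Fin n → ℂ) e x :=
  (contMDiffAt_chart he hx).mdifferentiableAt (by simp)

theorem mdifferentiableAt_chart_symm (he : e ∈ holoAtlas n X) {y : Fin n → ℂ}
    (hy : y ∈ e.target) :
    MDifferentiableAt 𝓘(ℝ, Fin n → ℂ) 𝓘(ℝ, Fin n → ℂ) e.symm y :=
  (contMDiffAt_chart_symm he hy).mdifferentiableAt (by simp)

theorem inChart_change (he : e ∈ holoAtlas n X) (he' : e' ∈ holoAtlas n X) (η : Form n X)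
    {y : Fin n → ℂ} (hy : y ∈ e.target) (hy' : e.symm y ∈ e'.source) :
    inChart e η y = ExteriorAlgebra.map (transpose (fderiv ℝ (e' ∘ e.symm) y))
      (inChart e' η (e' (e.symm y))) := by
  have h1 : e.symm =ᶠ[𝓝 y] e'.symm ∘ (e' ∘ e.symm) := by
    filter_upwards [(e.symm ≫ₕ e').open_source.mem_nhds ⟨hy, hy'⟩] with z hz
    exact (e'.left_inv hz.2).symm
  have h2 : inChart e η y = (pullback (m := n) (e'.symm ∘ (e' ∘ e.symm)) η).val y :=
    pullback_congr η h1
  rw [h2, pullback_comp (m := n), pullback_val, tderiv_eq_fderiv]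
  · rfl
  · exact mdifferentiableAt_chart_symm he' (e'.map_source hy')
  · exact ((contDiffAt_real_transition he he' hy hy').differentiableAt (by simp)).mdifferentiableAt

theorem val_eq_map_inChart (he : e ∈ holoAtlas n X) (η : Form n X) {x : X} (hx : x ∈ e.source) :
    η.val x = ExteriorAlgebra.map (transpose (tderiv e x)) (inChart e η (e x)) := by
  have h1 : e.symm ∘ e =ᶠ[𝓝 x] id := by
    filter_upwards [e.open_source.mem_nhds hx] with z hz
    exact e.left_inv hz
  have h2 : (tderiv (m := n) (n := n) e.symm (e x)).comp (tderiv (m := n) (n := n) e x) =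
      ContinuousLinearMap.id ℝ _ := by
    rw [← tderiv_comp (mdifferentiableAt_chart_symm he (e.map_source hx))
      (mdifferentiableAt_chart he hx), tderiv_congr h1]
    exact mfderiv_id
  rw [inChart_eq, ← map_transpose_comp, h2, map_transpose_id, e.left_inv hx]

theorem eq_of_inChart_eq (he : e ∈ holoAtlas n X) {η η' : Form n X} {x : X} (hx : x ∈ e.source)
    (h : inChart e η (e x) = inChart e η' (e x)) : η x = η' x := by
  have := val_eq_map_inChart he η hx
  rw [h, ← val_eq_map_inChart he η' hx] at this
  exact this

/-- The form on the domain of the chart `e` with chart expression `F`. -/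
def ofChart (e : OpenPartialHomeomorph X (Fin n → ℂ)) (F : (Fin n → ℂ) → CovectorAlgebra n) :
    Form n X := fun x => ExteriorAlgebra.map (transpose (tderiv e x)) (F (e x))

theorem inChart_ofChart (he : e ∈ holoAtlas n X) (F : (Fin n → ℂ) → CovectorAlgebra n)
    {y : Fin n → ℂ} (hy : y ∈ e.target) : inChart e (ofChart e F) y = F y := by
  have h1 : e ∘ e.symm =ᶠ[𝓝 y] id := by
    filter_upwards [e.open_target.mem_nhds hy] with z hz
    exact e.right_inv hz
  have h2 : (tderiv (m := n) (n := n) e (e.symm y)).comp (tderiv (m := n) (n := n) e.symm y) =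
      ContinuousLinearMap.id ℝ _ := by
    rw [← tderiv_comp (mdifferentiableAt_chart he (e.map_target hy))
      (mdifferentiableAt_chart_symm he hy), tderiv_congr h1]
    exact mfderiv_id
  have h3 : (ofChart e F).val (e.symm y) = ExteriorAlgebra.map (transpose (tderiv e (e.symm y)))
    (F (e (e.symm y))) := rfl
  rw [inChart_eq, h3, ← map_transpose_comp, h2, map_transpose_id, e.right_inv hy]

/-! ### Smoothness of forms at a point -/

/-- The form `η` is smooth at `x`: so are its coefficients in one chart (equivalently, in every
chart) at this point. -/
def SmoothAt (η : Form n X) (x : X) : Prop :=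
  CoeffSmoothAt (inChart (chartAt (Fin n → ℂ) x) η) (chartAt (Fin n → ℂ) x x)

theorem CoeffSmoothAt.change (he : e ∈ holoAtlas n X) (he' : e' ∈ holoAtlas n X) {η : Form n X}
    {x : X} (hx : x ∈ e.source) (hx' : x ∈ e'.source)
    (h : CoeffSmoothAt (inChart e' η) (e' x)) : CoeffSmoothAt (inChart e η) (e x) := by
  have hy := e.map_source hx
  have hy' : e.symm (e x) ∈ e'.source := by rwa [e.left_inv hx]
  have ht := contDiffAt_real_transition he he' hy hy'
  have h' : CoeffSmoothAt (inChart e' η) ((e' ∘ e.symm) (e x)) := by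
    rwa [Function.comp_apply, e.left_inv hx]
  refine (CoeffSmoothAt.map_transpose (L := fun z => fderiv ℝ (e' ∘ e.symm) z)
    (ht.fderiv_right (m := ∞) (by simp)) (h'.comp ht)).congr ?_
  filter_upwards [(e.symm ≫ₕ e').open_source.mem_nhds ⟨hy, hy'⟩] with z hz
  exact inChart_change he he' η hz.1 hz.2

theorem contDiffAt_inChart_of_contMDiffAt {f : X → ℂ} {x : X} (he : e ∈ holoAtlas n X)
    (hx : x ∈ e.source) (hf : ContMDiffAt 𝓘(ℝ, Fin n → ℂ) 𝓘(ℝ, ℂ) ∞ f x) :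
    ContDiffAt ℝ ∞ (f ∘ e.symm) (e x) := by
  rw [← contMDiffAt_iff_contDiffAt]
  refine ContMDiffAt.comp (e x) (I' := 𝓘(ℝ, Fin n → ℂ)) ?_
    (contMDiffAt_chart_symm he (e.map_source hx))
  rwa [e.left_inv hx]

theorem inChart_d (he : e ∈ holoAtlas n X) {f : X → ℂ} {y : Fin n → ℂ} (hy : y ∈ e.target)
    (hf : MDifferentiableAt 𝓘(ℝ, Fin n → ℂ) 𝓘(ℝ, ℂ) f (e.symm y)) :
    inChart e (d f) y = ExteriorAlgebra.ι ℂ (fderiv ℝ (f ∘ e.symm) y) := by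
  have h := pullback_d (m := n) hf (mdifferentiableAt_chart_symm he hy)
  rw [d_val] at h
  refine h.trans ?_
  congr 1
  exact mfderiv_eq_fderiv

theorem inChart_congr {η η' : Form n X} {x : X} (hx : x ∈ e.source)
    (h : ∀ᶠ z in 𝓝 x, η z = η' z) : inChart e η =ᶠ[𝓝 (e x)] inChart e η' := by
  have hc : Filter.Tendsto e.symm (𝓝 (e x)) (𝓝 x) := by
    have := (e.symm.continuousAt (x := e x) (e.map_source hx))
    rwa [ContinuousAt, e.left_inv hx] at this
  filter_upwards [hc.eventually h] with z hz
  have : η.val (e.symm z) = η'.val (e.symm z) := hz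
  rw [inChart_eq, inChart_eq, this]

namespace SmoothAt

variable {η η' : Form n X} {x : X}

theorem congr (h : SmoothAt η x) (h' : ∀ᶠ z in 𝓝 x, η' z = η z) : SmoothAt η' x :=
  CoeffSmoothAt.congr h (inChart_congr (mem_chart_source _ x) h')

theorem zero : SmoothAt (fun _ => 0 : Form n X) x := by
  have : inChart (chartAt (Fin n → ℂ) x) (fun _ => 0 : Form n X) = fun _ => 0 := by
    funext y; exact map_zero _
  rw [SmoothAt, this]
  exact CoeffSmoothAt.const 0

theorem add (h : SmoothAt η x) (h' : SmoothAt η' x) : SmoothAt (fun z => η z + η' z) x := by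
  have := CoeffSmoothAt.add h h'
  refine this.congr (Filter.Eventually.of_forall fun y => ?_)
  exact map_add _ _ _

theorem sub (h : SmoothAt η x) (h' : SmoothAt η' x) : SmoothAt (fun z => η z - η' z) x := by
  have := CoeffSmoothAt.sub h h'
  refine this.congr (Filter.Eventually.of_forall fun y => ?_)
  exact map_sub _ _ _

theorem mul (h : SmoothAt η x) (h' : SmoothAt η' x) : SmoothAt (fun z => η z * η' z) x := by
  have := CoeffSmoothAt.mul h h'
  refine this.congr (Filter.Eventually.of_forall fun y => ?_)
  exact map_mul _ _ _

theorem sum {κ : Type*} {s : Finset κ} {η : κ → Form n X} (h : ∀ k ∈ s, SmoothAt (η k) x) :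
    SmoothAt (fun z => ∑ k ∈ s, η k z) x := by
  classical
  induction s using Finset.induction_on with
  | empty => simpa using zero
  | insert a s ha ih =>
    simp only [Finset.sum_insert ha]
    exact (h a (Finset.mem_insert_self _ _)).add
      (ih fun k hk => h k (Finset.mem_insert_of_mem hk))

end SmoothAt

variable [IsManifold 𝓘(ℂ, Fin n → ℂ) ω X]

theorem smoothAt_iff (he : e ∈ holoAtlas n X) {η : Form n X} {x : X} (hx : x ∈ e.source) :
    SmoothAt η x ↔ CoeffSmoothAt (inChart e η) (e x) :=
  ⟨fun h => CoeffSmoothAt.change he (IsManifold.chart_mem_maximalAtlas x) hx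
      (mem_chart_source _ x) h,
    fun h => CoeffSmoothAt.change (IsManifold.chart_mem_maximalAtlas x) he
      (mem_chart_source _ x) hx h⟩

theorem isSmoothOn_iff {η : Form n X} {U : Set X} (hU : IsOpen U) :
    IsSmoothOn η U ↔ ∀ x ∈ U, SmoothAt η x := by
  constructor
  · intro h x hx l
    refine (h _ (chart_mem_atlas _ x) l).contDiffAt ?_
    refine ((chartAt (Fin n → ℂ) x).isOpen_inter_preimage_symm hU).mem_nhds
      ⟨mem_chart_target _ x, ?_⟩
    rwa [Set.mem_preimage, (chartAt (Fin n → ℂ) x).left_inv (mem_chart_source _ x)]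
  · intro h e he l y hy
    have he' := IsManifold.subset_maximalAtlas (I := 𝓘(ℂ, Fin n → ℂ)) (n := ω) he
    have := (smoothAt_iff he' (e.map_target hy.1)).mp (h _ hy.2) l
    rw [e.right_inv hy.1] at this
    exact this.contDiffWithinAt

namespace SmoothAt

variable {η : Form n X} {x : X}

theorem smul {c : X → ℂ} (hc : ContMDiffAt 𝓘(ℝ, Fin n → ℂ) 𝓘(ℝ, ℂ) ∞ c x) (h : SmoothAt η x) :
    SmoothAt (fun z => c z • η z) x := by
  have := CoeffSmoothAt.smul (contDiffAt_inChart_of_contMDiffAt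
    (IsManifold.chart_mem_maximalAtlas x) (mem_chart_source _ x) hc) h
  refine this.congr (Filter.Eventually.of_forall fun y => ?_)
  exact map_smul _ _ _

end SmoothAt

theorem smoothAt_d {f : X → ℂ} {U : Set X} (hU : IsOpen U)
    (hf : ContMDiffOn 𝓘(ℝ, Fin n → ℂ) 𝓘(ℝ, ℂ) ∞ f U) {x : X} (hx : x ∈ U) :
    SmoothAt (d f : Form n X) x := by
  set e := chartAt (Fin n → ℂ) x with he
  have hem : e ∈ holoAtlas n X := IsManifold.chart_mem_maximalAtlas x
  have hxe : x ∈ e.source := mem_chart_source _ x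
  have hs := contDiffAt_inChart_of_contMDiffAt hem hxe (hf.contMDiffAt (hU.mem_nhds hx))
  have h1 : CoeffSmoothAt (fun y => ExteriorAlgebra.ι ℂ (fderiv ℝ (f ∘ e.symm) y)) (e x) :=
    (CoeffSmoothAt.of_contDiffAt (hs.fderiv_right (m := ∞) (by simp))).linearMap
      (ExteriorAlgebra.ι ℂ)
  refine h1.congr ?_
  have hopen := e.isOpen_inter_preimage_symm hU
  filter_upwards [hopen.mem_nhds ⟨e.map_source hxe, by rwa [Set.mem_preimage, e.left_inv hxe]⟩]
    with y hy
  exact inChart_d hem hy.1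
    ((hf.contMDiffAt (hU.mem_nhds hy.2)).mdifferentiableAt (by simp))

end Charts

/-! ### Gluing extensions of forms across a thin set -/

section Glue

variable {n : ℕ} {X : Type*} [TopologicalSpace X] [ChartedSpace (Fin n → ℂ) X]
  {S U : Set X} {η η' : Form n X} {x : X}

theorem SmoothAt.continuousAt_coeff (h : SmoothAt η x) (l : CovectorAlgebra n →ₗ[ℂ] ℂ) :
    ContinuousAt (fun z => l (inChart (chartAt (Fin n → ℂ) x) η (chartAt (Fin n → ℂ) x z))) x :=
  ContinuousAt.comp (g := fun y => l (inChart (chartAt (Fin n → ℂ) x) η y)) (h l).continuousAt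
    ((chartAt (Fin n → ℂ) x).continuousAt (mem_chart_source _ x))

variable [IsManifold 𝓘(ℂ, Fin n → ℂ) ω X]

/-- Forms smooth at a point of the closure of `Sᶜ` that agree off `S` agree at that point. -/
theorem SmoothAt.eq_of_eq_off (h : SmoothAt η x) (h' : SmoothAt η' x) (hx : x ∈ closure Sᶜ)
    (heq : ∀ᶠ z in 𝓝 x, z ∉ S → η z = η' z) : η x = η' x := by
  set e := chartAt (Fin n → ℂ) x with he
  have hem : e ∈ holoAtlas n X := IsManifold.chart_mem_maximalAtlas x
  refine eq_of_inChart_eq hem (mem_chart_source _ x) (covectorAlgebra_eq_of_forall fun l => ?_)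
  have : (𝓝[Sᶜ] x).NeBot := mem_closure_iff_nhdsWithin_neBot.mp hx
  have h1 := (h.continuousAt_coeff l).mono_left (nhdsWithin_le_nhds (s := Sᶜ))
  have h2 := (h'.continuousAt_coeff l).mono_left (nhdsWithin_le_nhds (s := Sᶜ))
  refine tendsto_nhds_unique h1 (h2.congr' ?_)
  filter_upwards [nhdsWithin_le_nhds heq, self_mem_nhdsWithin,
    nhdsWithin_le_nhds (e.open_source.mem_nhds (mem_chart_source _ x))] with z hz hzS hze
  have : η.val (e.symm (e z)) = η'.val (e.symm (e z)) := by
    rw [e.left_inv hze]; exact hz hzS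
  rw [inChart_eq, inChart_eq, this]

/-- A form extends smoothly across a set with dense complement if it does so locally. -/
theorem extendsSmoothly_of_local (hS : Dense Sᶜ) (hU : IsOpen U)
    (h : ∀ x ∈ U, ∃ (W : Set X) (θ : Form n X), IsOpen W ∧ x ∈ W ∧ (∀ z ∈ W, SmoothAt θ z) ∧
      ∀ z ∈ W \ S, θ z = η z) : ExtendsSmoothly S η U := by
  classical
  choose! W θ hW hxW hθ heq using h
  refine ⟨fun x => if x ∈ S then θ x x else η x, ?_, fun x hx => if_neg hx.2⟩
  rw [isSmoothOn_iff hU]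
  intro x hx
  refine (hθ x hx x (hxW x hx)).congr ?_
  filter_upwards [hU.mem_nhds hx, (hW x hx).mem_nhds (hxW x hx)] with z hzU hzW
  split_ifs with hzS
  · refine (hθ z hzU z (hxW z hzU)).eq_of_eq_off (hθ x hx z hzW) (hS z) ?_
    filter_upwards [(hW z hzU).mem_nhds (hxW z hzU), (hW x hx).mem_nhds hzW] with w hw hw' hwS
    rw [heq z hzU w ⟨hw, hwS⟩, heq x hx w ⟨hw', hwS⟩]
  · exact (heq x hx z ⟨hzW, hzS⟩).symm

end Glue

/-! ### Division by a holomorphic function and its conjugate -/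

/-- The function `z ^ p / z̄ ^ q` on `ℂ` (with value `0` at the origin) is of class `C ^ m` as soon
as `p > q + m`. -/
theorem contDiff_pow_div_conj_pow (m : ℕ) : ∀ p q : ℕ, q + m + 1 ≤ p →
    ContDiff ℝ m (fun z : ℂ => z ^ p / (starRingEnd ℂ z) ^ q) := by
  have hnorm : ∀ (p q : ℕ) (z : ℂ), q ≤ p →
      ‖z ^ p / (starRingEnd ℂ z) ^ q‖ ≤ ‖z‖ ^ (p - q) := by
    intro p q z hpq
    rw [norm_div, norm_pow, norm_pow, RCLike.norm_conj]
    by_cases hz : z = 0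
    · subst hz
      rcases Nat.eq_zero_or_pos q with rfl | hq
      · simp
      · simp [hq.ne']
    · rw [pow_sub₀ _ (norm_ne_zero_iff.mpr hz) hpq, div_eq_mul_inv]
  have hzero : ∀ p q : ℕ, q + 1 ≤ p → (0 : ℂ) ^ p / (starRingEnd ℂ (0 : ℂ)) ^ q = 0 := by
    intro p q h
    rw [zero_pow (by omega), zero_div]
  induction m with
  | zero =>
    intro p q hpq
    rw [Nat.cast_zero, contDiff_zero, continuous_iff_continuousAt]
    intro z
    by_cases hz : z = 0
    · subst hz
      rw [ContinuousAt, hzero p q (by omega)]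
      refine squeeze_zero_norm (fun z => hnorm p q z (by omega)) ?_
      have : Continuous fun z : ℂ => ‖z‖ ^ (p - q) := by fun_prop
      simpa [show p - q ≠ 0 by omega] using this.tendsto 0
    · have : (starRingEnd ℂ z) ^ q ≠ 0 := pow_ne_zero _ (by simpa using hz)
      have hc : ContinuousAt (fun z : ℂ => (starRingEnd ℂ z) ^ q) z :=
        (Complex.continuous_conj.pow q).continuousAt
      exact (continuousAt_id.pow p).div hc this
  | succ m ih =>
    intro p q hpq
    push_cast
    rw [contDiff_succ_iff_hasFDerivAt]
    refine ⟨fun z => (p * (z ^ (p - 1) / (starRingEnd ℂ z) ^ q)) •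
        (ContinuousLinearMap.id ℝ ℂ) -
        (q * (z ^ p / (starRingEnd ℂ z) ^ (q + 1))) • (Complex.conjCLE : ℂ →L[ℝ] ℂ), ?_, ?_⟩
    · refine ContDiff.sub ?_ ?_
      · exact (contDiff_const.mul (ih (p - 1) q (by omega))).smul contDiff_const
      · exact (contDiff_const.mul (ih p (q + 1) (by omega))).smul contDiff_const
    · intro z
      by_cases hz : z = 0
      · subst hz
        beta_reduce
        rw [hzero (p - 1) q (by omega), hzero p (q + 1) (by omega)]
        simp only [mul_zero]
        rw [hasFDerivAt_iff_isLittleO_nhds_zero]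
        simp only [zero_add, hzero p q (by omega), sub_zero]
        refine (Asymptotics.IsBigO.of_bound 1 ?_).trans_isLittleO
          (Asymptotics.isLittleO_norm_pow_id (n := p - q) (by omega))
        filter_upwards with w
        rw [one_mul, norm_pow, norm_norm]
        refine le_trans (le_of_eq ?_) (hnorm p q w (by omega))
        congr 1
        simp
      · have hz' : starRingEnd ℂ z ≠ 0 := by simpa using hz
        have hc : HasFDerivAt (fun z : ℂ => starRingEnd ℂ z) (Complex.conjCLE : ℂ →L[ℝ] ℂ) z :=
          Complex.conjCLE.hasFDerivAt
        have h1 : HasFDerivAt (fun z : ℂ => z ^ p) _ z := (hasFDerivAt_id (𝕜 := ℝ) z).pow p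
        have h2 : HasFDerivAt (fun z : ℂ => (starRingEnd ℂ z) ^ q) _ z := hc.pow q
        have h2' : HasFDerivAt (fun z : ℂ => ((starRingEnd ℂ z) ^ q)⁻¹) _ z :=
          ((hasDerivAt_inv (pow_ne_zero q hz')).hasFDerivAt.restrictScalars ℝ).comp z h2
        have h3 := h1.mul h2'
        simp only [div_eq_mul_inv]
        refine h3.congr_fderiv ?_
        ext w
        rcases Nat.eq_zero_or_pos q with rfl | hq
        · simp
        · obtain ⟨q, rfl⟩ : ∃ q', q = q' + 1 := ⟨q - 1, by omega⟩
          simp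
          field_simp
          ring

/-- The core of the division argument. Let `D` be a derivation with `D f = 1` and `D f̄ = 0`. If
`f̄ a = f b` with `a`, `b` smooth, then `a / f` extends smoothly across the zeros of `f`. The
extension is `D a - (f / f̄) D b`, which is of class `C ^ m` for every `m` since it equals
`∑_{j < k} (-1)^j / (j+1)! f^j D^{j+1} a + (-1)^k / k! (f^k / f̄) D^k b` for every `k ≥ 1`. -/
theorem exists_contDiffOn_div {G : Type*} [NormedAddCommGroup G] [NormedSpace ℝ G] {W : Set G}
    {f : G → ℂ} (hf : ContDiffOn ℝ ∞ f W) (D : (G → ℂ) → G → ℂ)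
    (hsmooth : ∀ u, ContDiffOn ℝ ∞ u W → ContDiffOn ℝ ∞ (D u) W)
    (hcongr : ∀ u v, Set.EqOn u v W → Set.EqOn (D u) (D v) W)
    (hadd : ∀ u v, ContDiffOn ℝ ∞ u W → ContDiffOn ℝ ∞ v W →
      ∀ y ∈ W, D (fun z => u z + v z) y = D u y + D v y)
    (hmul : ∀ u v, ContDiffOn ℝ ∞ u W → ContDiffOn ℝ ∞ v W →
      ∀ y ∈ W, D (fun z => u z * v z) y = u y * D v y + v y * D u y)
    (hconst : ∀ c : ℂ, ∀ y ∈ W, D (fun _ => c) y = 0)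
    (hDf : ∀ y ∈ W, D f y = 1) (hDfbar : ∀ y ∈ W, D (fun z => starRingEnd ℂ (f z)) y = 0)
    {a b : G → ℂ} (ha : ContDiffOn ℝ ∞ a W) (hb : ContDiffOn ℝ ∞ b W)
    (hab : ∀ y ∈ W, starRingEnd ℂ (f y) * a y = f y * b y) :
    ∃ v : G → ℂ, ContDiffOn ℝ ∞ v W ∧ ∀ y ∈ W, f y ≠ 0 → v y = a y / f y := by
  have hfbar : ContDiffOn ℝ ∞ (fun z => starRingEnd ℂ (f z)) W :=
    Complex.conjCLE.contDiff.comp_contDiffOn hf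
  have hak : ∀ k, ContDiffOn ℝ ∞ (D^[k] a) W := by
    intro k
    induction k with
    | zero => exact ha
    | succ k ih => rw [Function.iterate_succ_apply']; exact hsmooth _ ih
  have hbk : ∀ k, ContDiffOn ℝ ∞ (D^[k] b) W := by
    intro k
    induction k with
    | zero => exact hb
    | succ k ih => rw [Function.iterate_succ_apply']; exact hsmooth _ ih
  -- The relation `f̄ a = f b`, differentiated `k + 1` times.
  have hrec : ∀ k : ℕ, ∀ y ∈ W, starRingEnd ℂ (f y) * D^[k + 1] a y =
      f y * D^[k + 1] b y + (k + 1) * D^[k] b y := by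
    intro k
    induction k with
    | zero =>
      intro y hy
      have h := hcongr _ _ hab hy
      rw [hmul _ _ hfbar ha y hy, hmul _ _ hf hb y hy, hDf y hy, hDfbar y hy] at h
      simpa using h
    | succ k ih =>
      intro y hy
      have h := hcongr _ _ ih hy
      rw [hmul _ _ hfbar (hak _) y hy,
        hadd _ _ (hf.mul (hbk _)) (contDiffOn_const.mul (hbk _)) y hy,
        hmul _ _ hf (hbk _) y hy, hmul _ _ contDiffOn_const (hbk _) y hy, hconst _ y hy, hDf y hy,
        hDfbar y hy] at h
      simp only [← Function.iterate_succ_apply' D] at h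
      push_cast
      linear_combination h
  set V : ℕ → G → ℂ := fun k y =>
    ∑ j ∈ Finset.range k, ((-1) ^ j / ((j + 1).factorial : ℂ)) * (f y ^ j * D^[j + 1] a y) +
      ((-1) ^ k / (k.factorial : ℂ)) * (f y ^ k / (starRingEnd ℂ (f y)) ^ 1 * D^[k] b y) with hV
  have hstep : ∀ k : ℕ, ∀ y ∈ W, (1 ≤ k ∨ f y ≠ 0) → V (k + 1) y = V k y := by
    intro k y hy hk
    simp only [hV, Finset.sum_range_succ, add_assoc]
    congr 1
    have hfac : (((k + 1).factorial : ℕ) : ℂ) = (k + 1) * (k.factorial : ℂ) := by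
      rw [Nat.factorial_succ]; push_cast; ring
    have hk0 : (k.factorial : ℂ) ≠ 0 := Nat.cast_ne_zero.mpr (Nat.factorial_ne_zero k)
    have hk1 : (k : ℂ) + 1 ≠ 0 := Nat.cast_add_one_ne_zero k
    by_cases hfy : f y = 0
    · have hk' : k ≠ 0 := by
        rcases hk with hk | hk
        · omega
        · exact absurd hfy hk
      simp [hfy, hk']
    · have hfy' : starRingEnd ℂ (f y) ≠ 0 := by simpa using hfy
      have h := hrec k y hy
      rw [hfac, pow_one]
      field_simp
      rw [pow_succ, pow_succ]
      linear_combination ((-1) ^ k * f y ^ k) * h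
  have hV1 : ∀ k : ℕ, ∀ y ∈ W, V (k + 1) y = V 1 y := by
    intro k y hy
    induction k with
    | zero => rfl
    | succ k ih => rw [hstep (k + 1) y hy (Or.inl (by omega)), ih]
  refine ⟨V 1, ?_, ?_⟩
  · rw [contDiffOn_infty]
    intro m
    have hm : ContDiffOn ℝ m (V (m + 2)) W := by
      refine ContDiffOn.add ?_ ?_
      · refine ContDiffOn.sum fun j _ => contDiffOn_const.mul (ContDiffOn.mul ?_ ?_)
        · exact (hf.of_le (by exact_mod_cast le_top)).pow j
        · exact (hak _).of_le (by exact_mod_cast le_top)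
      · refine contDiffOn_const.mul (ContDiffOn.mul ?_ ?_)
        · exact (contDiff_pow_div_conj_pow m (m + 2) 1 (by omega)).comp_contDiffOn
            (hf.of_le (by exact_mod_cast le_top))
        · exact (hbk _).of_le (by exact_mod_cast le_top)
    exact hm.congr fun y hy => (hV1 (m + 1) y hy).symm
  · intro y hy hfy
    have hfy' : starRingEnd ℂ (f y) ≠ 0 := by simpa using hfy
    rw [hstep 0 y hy (Or.inr hfy)]
    simp only [hV, Finset.range_zero, Finset.sum_empty, Function.iterate_zero, id]
    have := hab y hy
    simp
    field_simp
    linear_combination -this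

/-- Division for a holomorphic function with nonvanishing derivative in a direction `e`. -/
theorem exists_contDiffOn_div_of_holomorphic {n : ℕ} {W : Set (Fin n → ℂ)} (hW : IsOpen W)
    {f : (Fin n → ℂ) → ℂ} (hf : ContDiffOn ℂ ω f W) (e : Fin n → ℂ)
    (he : ∀ y ∈ W, fderiv ℂ f y e ≠ 0)
    {a b : (Fin n → ℂ) → ℂ} (ha : ContDiffOn ℝ ∞ a W) (hb : ContDiffOn ℝ ∞ b W)
    (hab : ∀ y ∈ W, starRingEnd ℂ (f y) * a y = f y * b y) :
    ∃ v : (Fin n → ℂ) → ℂ, ContDiffOn ℝ ∞ v W ∧ ∀ y ∈ W, f y ≠ 0 → v y = a y / f y := by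
  have hfr : ContDiffOn ℝ ∞ f W := (hf.restrict_scalars ℝ).of_le le_top
  have hdiff : ∀ {u : (Fin n → ℂ) → ℂ}, ContDiffOn ℝ ∞ u W → ∀ y ∈ W, DifferentiableAt ℝ u y :=
    fun hu y hy => (hu.contDiffAt (hW.mem_nhds hy)).differentiableAt (by simp)
  have hfd : ∀ y ∈ W, fderiv ℝ f y = (fderiv ℂ f y).restrictScalars ℝ := fun y hy =>
    ((hf.contDiffAt (hW.mem_nhds hy)).differentiableAt (by simp)).fderiv_restrictScalars ℝ
  have hfI : ∀ y ∈ W, fderiv ℝ f y e - Complex.I * fderiv ℝ f y (Complex.I • e) =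
      2 * fderiv ℂ f y e := by
    intro y hy
    rw [hfd y hy]
    simp only [ContinuousLinearMap.coe_restrictScalars', map_smul, smul_eq_mul]
    linear_combination -(fderiv ℂ f y e) * Complex.I_mul_I
  have hdir : ∀ {u : (Fin n → ℂ) → ℂ}, ContDiffOn ℝ ∞ u W → ∀ w,
      ContDiffOn ℝ ∞ (fun y => fderiv ℝ u y w) W := fun hu w =>
    (hu.fderiv_of_isOpen (m := ∞) hW (by simp)).clm_apply contDiffOn_const
  have hop : ∀ {u : (Fin n → ℂ) → ℂ}, ContDiffOn ℝ ∞ u W →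
      ContDiffOn ℝ ∞ (fun y => fderiv ℝ u y e - Complex.I * fderiv ℝ u y (Complex.I • e)) W :=
    fun hu => (hdir hu _).sub (contDiffOn_const.mul (hdir hu _))
  -- The holomorphic Wirtinger derivative along `e`, normalised to be `1` on `f`.
  refine exists_contDiffOn_div hfr
    (fun u y => (fderiv ℝ f y e - Complex.I * fderiv ℝ f y (Complex.I • e))⁻¹ *
      (fderiv ℝ u y e - Complex.I * fderiv ℝ u y (Complex.I • e)))
    ?_ ?_ ?_ ?_ ?_ ?_ ?_ ha hb hab
  · intro u hu
    refine ((hop hfr).inv fun y hy => ?_).mul (hop hu)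
    rw [hfI y hy]
    exact mul_ne_zero two_ne_zero (he y hy)
  · intro u v huv y hy
    have : fderiv ℝ u y = fderiv ℝ v y :=
      (Filter.eventuallyEq_of_mem (hW.mem_nhds hy) huv).fderiv_eq
    simp only [this]
  · intro u v hu hv y hy
    have : fderiv ℝ (fun z => u z + v z) y = _ := fderiv_add (hdiff hu y hy) (hdiff hv y hy)
    simp only [this, add_apply]
    ring
  · intro u v hu hv y hy
    have : fderiv ℝ (fun z => u z * v z) y = _ := fderiv_mul (hdiff hu y hy) (hdiff hv y hy)
    simp only [this, add_apply, smul_apply, smul_eq_mul]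
    ring
  · intro c y hy
    simp
  · intro y hy
    refine inv_mul_cancel₀ ?_
    rw [hfI y hy]
    exact mul_ne_zero two_ne_zero (he y hy)
  · intro y hy
    have h1 : fderiv ℝ (fun z => starRingEnd ℂ (f z)) y =
        (Complex.conjCLE : ℂ →L[ℝ] ℂ).comp (fderiv ℝ f y) :=
      (Complex.conjCLE.hasFDerivAt.comp y (hdiff hfr y hy).hasFDerivAt).fderiv
    rw [h1, hfd y hy]
    simp only [ContinuousLinearMap.comp_apply, ContinuousLinearMap.coe_restrictScalars', map_smul,
      smul_eq_mul, ContinuousLinearEquiv.coe_coe, Complex.conjCLE_apply, map_mul, Complex.conj_I]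
    refine mul_eq_zero_of_right _ ?_
    linear_combination (starRingEnd ℂ (fderiv ℂ f y e)) * Complex.I_mul_I

/-! ### Local equations and adapted charts -/

section Equations

variable {n : ℕ} {X : Type*} [TopologicalSpace X] [ChartedSpace (Fin n → ℂ) X]
  {D U : Set X} {f : X → ℂ} {e : OpenPartialHomeomorph X (Fin n → ℂ)} {x : X}

theorem mdifferentiableAt_complex_chart_symm (he : e ∈ holoAtlas n X) {y : Fin n → ℂ}
    (hy : y ∈ e.target) :
    MDifferentiableAt 𝓘(ℂ, Fin n → ℂ) 𝓘(ℂ, Fin n → ℂ) e.symm y :=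
  (contMDiffAt_symm_of_mem_maximalAtlas he hy).mdifferentiableAt (by simp)

theorem mdifferentiableAt_complex_chart (he : e ∈ holoAtlas n X) (hx : x ∈ e.source) :
    MDifferentiableAt 𝓘(ℂ, Fin n → ℂ) 𝓘(ℂ, Fin n → ℂ) e x :=
  (contMDiffAt_of_mem_maximalAtlas he hx).mdifferentiableAt (by simp)

theorem contDiffOn_comp_chart_symm (he : e ∈ holoAtlas n X)
    (hU : IsOpen U) (hf : ContMDiffOn 𝓘(ℂ, Fin n → ℂ) 𝓘(ℂ, ℂ) ω f U) :
    ContDiffOn ℂ ω (f ∘ e.symm) (e.target ∩ e.symm ⁻¹' U) := by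
  intro y hy
  refine ContDiffAt.contDiffWithinAt ?_
  rw [← contMDiffAt_iff_contDiffAt]
  exact ContMDiffAt.comp y (I' := 𝓘(ℂ, Fin n → ℂ)) (hf.contMDiffAt (hU.mem_nhds hy.2))
    (contMDiffAt_symm_of_mem_maximalAtlas he hy.1)

theorem restr_mem_holoAtlas (he : e ∈ holoAtlas n X) {s : Set X} (hs : IsOpen s) :
    e.restr s ∈ holoAtlas n X :=
  restr_mem_maximalAtlas _ he hs

namespace IsLocalEquation

theorem mono (h : IsLocalEquation (n := n) D U f) {V : Set X} (hV : IsOpen V) (hVU : V ⊆ U) :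
    IsLocalEquation (n := n) D V f :=
  ⟨hV, h.holomorphic.mono hVU, fun x hx => h.zero_iff x (hVU hx),
    fun x hx => h.mfderiv_ne_zero x ⟨hVU hx.1, hx.2⟩⟩

theorem fderiv_ne_zero (h : IsLocalEquation (n := n) D U f) (he : e ∈ holoAtlas n X)
    (hx : x ∈ e.source) (hxU : x ∈ U ∩ D) : fderiv ℂ (f ∘ e.symm) (e x) ≠ 0 := by
  intro h0
  apply h.mfderiv_ne_zero x hxU
  have hF : DifferentiableAt ℂ (f ∘ e.symm) (e x) :=
    ((contDiffOn_comp_chart_symm he h.isOpen h.holomorphic).contDiffAt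
      ((e.isOpen_inter_preimage_symm h.isOpen).mem_nhds ⟨e.map_source hx, by
        rw [Set.mem_preimage, e.left_inv hx]; exact hxU.1⟩)).differentiableAt (by simp)
  have h1 : f =ᶠ[𝓝 x] (f ∘ e.symm) ∘ e := by
    filter_upwards [e.open_source.mem_nhds hx] with z hz
    simp [e.left_inv hz]
  rw [h1.mfderiv_eq, mfderiv_comp (I' := 𝓘(ℂ, Fin n → ℂ)) x hF.mdifferentiableAt
    (mdifferentiableAt_complex_chart he hx), mfderiv_eq_fderiv, h0]
  exact ContinuousLinearMap.zero_comp _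

end IsLocalEquation

variable [IsManifold 𝓘(ℂ, Fin n → ℂ) ω X]

theorem contMDiffOn_real_of_holomorphic (hU : IsOpen U)
    (hf : ContMDiffOn 𝓘(ℂ, Fin n → ℂ) 𝓘(ℂ, ℂ) ω f U) :
    ContMDiffOn 𝓘(ℝ, Fin n → ℂ) 𝓘(ℝ, ℂ) ∞ f U := by
  intro x hx
  refine ContMDiffAt.contMDiffWithinAt ?_
  set e := chartAt (Fin n → ℂ) x with he
  have hem : e ∈ holoAtlas n X := IsManifold.chart_mem_maximalAtlas x
  have hxe : x ∈ e.source := mem_chart_source _ x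
  have h1 : ContDiffAt ℝ ∞ (f ∘ e.symm) (e x) :=
    (((contDiffOn_comp_chart_symm hem hU hf).contDiffAt
      ((e.isOpen_inter_preimage_symm hU).mem_nhds ⟨e.map_source hxe, by
        rwa [Set.mem_preimage, e.left_inv hxe]⟩)).restrict_scalars ℝ).of_le le_top
  have h2 : ContMDiffAt 𝓘(ℝ, Fin n → ℂ) 𝓘(ℝ, ℂ) ∞ ((f ∘ e.symm) ∘ e) x :=
    ContMDiffAt.comp x h1.contMDiffAt (contMDiffAt_chart hem hxe)
  refine h2.congr_of_eventuallyEq ?_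
  filter_upwards [e.open_source.mem_nhds hxe] with z hz
  simp [e.left_inv hz]

namespace IsLocalEquation

theorem contMDiffOn_real (h : IsLocalEquation (n := n) D U f) :
    ContMDiffOn 𝓘(ℝ, Fin n → ℂ) 𝓘(ℝ, ℂ) ∞ f U :=
  contMDiffOn_real_of_holomorphic h.isOpen h.holomorphic

theorem contMDiffOn_conj (h : IsLocalEquation (n := n) D U f) :
    ContMDiffOn 𝓘(ℝ, Fin n → ℂ) 𝓘(ℝ, ℂ) ∞ (fun x => starRingEnd ℂ (f x)) U :=
  Complex.conjCLE.contDiff.contMDiff.comp_contMDiffOn h.contMDiffOn_real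

end IsLocalEquation

theorem trans_mem_holoAtlas (he : e ∈ holoAtlas n X)
    {g : OpenPartialHomeomorph (Fin n → ℂ) (Fin n → ℂ)} (hg : ContDiffOn ℂ ω g g.source)
    (hg' : ContDiffOn ℂ ω g.symm g.target) : e ≫ₕ g ∈ holoAtlas n X := by
  refine OpenPartialHomeomorph.mem_maximalAtlas_of_contMDiffOn _ ?_ ?_
  · refine (hg.contMDiffOn).comp (t := g.source)
      ((contMDiffOn_of_mem_maximalAtlas he).mono ?_) ?_
    · intro z hz; exact hz.1
    · intro z hz; exact hz.2
  · refine (contMDiffOn_symm_of_mem_maximalAtlas he).comp (t := e.target)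
      ((hg'.contMDiffOn).mono ?_) ?_
    · intro z hz; exact hz.1
    · intro z hz; exact hz.2

end Equations

section Adapted

variable {n : ℕ} {X Y : Type*} [TopologicalSpace X] [ChartedSpace (Fin (n + 1) → ℂ) X]
  [TopologicalSpace Y] [ChartedSpace (Fin n → ℂ) Y]

/-- Holomorphic charts `e` of `X` and `e'` of `Y` in which the map `i : Y → X` is the inclusion of
the hyperplane where the first coordinate vanishes, this coordinate being the function `f`. -/
structure IsAdapted (i : Y → X) (f : X → ℂ) (e : OpenPartialHomeomorph X (Fin (n + 1) → ℂ))
    (e' : OpenPartialHomeomorph Y (Fin n → ℂ)) : Prop where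
  mem : e ∈ holoAtlas (n + 1) X
  mem' : e' ∈ holoAtlas n Y
  coord : ∀ x ∈ e.source, f x = e x 0
  incl : ∀ y ∈ e'.source, e (i y) = Fin.cons 0 (e' y)
  source_iff : ∀ y, y ∈ e'.source ↔ i y ∈ e.source
  mem_range_iff : ∀ x ∈ e.source, x ∈ Set.range i ↔ f x = 0

/-- The decomposition of `ℂⁿ⁺¹` into the hyperplane and the first coordinate axis. -/
def consEquiv (n : ℕ) : ((Fin n → ℂ) × ℂ) ≃L[ℂ] (Fin (n + 1) → ℂ) :=
  LinearEquiv.toContinuousLinearEquiv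
    { toFun := fun p => Fin.cons p.2 p.1
      map_add' := fun p q => by
        funext j; refine Fin.cases ?_ (fun j => ?_) j <;> simp
      map_smul' := fun c p => by
        funext j; refine Fin.cases ?_ (fun j => ?_) j <;> simp
      invFun := fun z => (Fin.tail z, z 0)
      left_inv := fun p => by simp
      right_inv := fun z => by simp }

@[simp] theorem consEquiv_apply (n : ℕ) (p : (Fin n → ℂ) × ℂ) :
    consEquiv n p = Fin.cons p.2 p.1 := rfl

theorem isLocalEquation_coord {D : Set X} {e : OpenPartialHomeomorph X (Fin (n + 1) → ℂ)}
    (he : e ∈ holoAtlas (n + 1) X) (hD : ∀ x ∈ e.source, e x 0 = 0 ↔ x ∈ D) :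
    IsLocalEquation (n := n + 1) D e.source (fun x => e x 0) := by
  refine ⟨e.open_source, ?_, hD, ?_⟩
  · exact (firstCoord n).contDiff.contMDiff.comp_contMDiffOn (contMDiffOn_of_mem_maximalAtlas he)
  · intro x hx h0
    have hmd : MDifferentiableAt 𝓘(ℂ, Fin (n + 1) → ℂ) 𝓘(ℂ, ℂ) (fun x => e x 0)
        (e.symm (e x)) := by
      rw [e.left_inv hx.1]
      exact MDifferentiableAt.comp (g := firstCoord n) (I' := 𝓘(ℂ, Fin (n + 1) → ℂ)) x
        (firstCoord n).differentiableAt.mdifferentiableAt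
        (mdifferentiableAt_complex_chart he hx.1)
    have h1 := mfderiv_comp (I' := 𝓘(ℂ, Fin (n + 1) → ℂ)) (e x) hmd
      (mdifferentiableAt_complex_chart_symm he (e.map_source hx.1))
    have h2 : (fun x => e x 0) ∘ e.symm =ᶠ[𝓝 (e x)] firstCoord n := by
      filter_upwards [e.open_target.mem_nhds (e.map_source hx.1)] with z hz
      simp [e.right_inv hz]
    have h3 : mfderiv 𝓘(ℂ, Fin (n + 1) → ℂ) 𝓘(ℂ, ℂ) (fun x => e x 0) (e.symm (e x)) = 0 := by
      rw [e.left_inv hx.1]; exact h0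
    have h4 : mfderiv 𝓘(ℂ, Fin (n + 1) → ℂ) 𝓘(ℂ, ℂ) (firstCoord n) (e x) = firstCoord n := by
      rw [mfderiv_eq_fderiv]
      exact (firstCoord n).fderiv
    rw [h2.mfderiv_eq, h3, h4] at h1
    have h5 := DFunLike.congr_fun h1 (Pi.single 0 1 : Fin (n + 1) → ℂ)
    have h6 : firstCoord n (Pi.single 0 1 : Fin (n + 1) → ℂ) = 1 := by simp
    have h7 : (1 : ℂ) = 0 := h6.symm.trans (h5.trans rfl)
    exact one_ne_zero h7

theorem IsAdapted.isLocalEquation {i : Y → X} {f : X → ℂ}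
    {e : OpenPartialHomeomorph X (Fin (n + 1) → ℂ)} {e' : OpenPartialHomeomorph Y (Fin n → ℂ)}
    (h : IsAdapted i f e e') :
    IsLocalEquation (n := n + 1) (Set.range i) e.source (fun x => e x 0) :=
  isLocalEquation_coord h.mem fun x hx => by rw [h.mem_range_iff x hx, h.coord x hx]

variable [IsManifold 𝓘(ℂ, Fin (n + 1) → ℂ) ω X]

variable {i : Y → X}

/-- Near each point, a holomorphic embedding of codimension one admits adapted charts. -/
theorem exists_isAdapted
    (hi : Manifold.IsSmoothEmbedding 𝓘(ℂ, Fin n → ℂ) 𝓘(ℂ, Fin (n + 1) → ℂ) ω i) (y₀ : Y) :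
    ∃ (e : OpenPartialHomeomorph X (Fin (n + 1) → ℂ)) (e' : OpenPartialHomeomorph Y (Fin n → ℂ)),
      i y₀ ∈ e.source ∧ IsAdapted i (fun x => e x 0) e e' := by
  have h : Manifold.IsImmersionAt 𝓘(ℂ, Fin n → ℂ) 𝓘(ℂ, Fin (n + 1) → ℂ) ω i y₀ :=
    hi.isImmersion.isImmersionAt y₀
  let T := h.equiv
  have hfin : FiniteDimensional ℂ h.complement :=
    FiniteDimensional.of_injective (T.toLinearEquiv.toLinearMap ∘ₗ LinearMap.inr ℂ _ _)
      (T.injective.comp (LinearMap.inr_injective))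
  have hrank : Module.finrank ℂ h.complement = Module.finrank ℂ ℂ := by
    have := T.toLinearEquiv.finrank_eq
    rw [Module.finrank_prod] at this
    simp only [Module.finrank_fin_fun] at this
    rw [Module.finrank_self]
    omega
  -- The normal form of an immersion, with the complement identified with the first coordinate axis.
  let φ : h.complement ≃L[ℂ] ℂ := ContinuousLinearEquiv.ofFinrankEq hrank
  let L : (Fin (n + 1) → ℂ) ≃L[ℂ] (Fin (n + 1) → ℂ) :=
    (T.symm.trans ((ContinuousLinearEquiv.refl ℂ (Fin n → ℂ)).prodCongr φ)).trans (consEquiv n)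
  let e₁ : OpenPartialHomeomorph X (Fin (n + 1) → ℂ) :=
    h.codChart ≫ₕ L.toHomeomorph.toOpenPartialHomeomorph
  have he₁ : e₁ ∈ holoAtlas (n + 1) X :=
    trans_mem_holoAtlas h.codChart_mem_maximalAtlas L.contDiff.contDiffOn
      L.symm.contDiff.contDiffOn
  have hsrc : e₁.source = h.codChart.source := by simp [e₁]
  have hincl : ∀ y ∈ h.domChart.source, e₁ (i y) = Fin.cons 0 (h.domChart y) := by
    intro y hy
    have h0 : h.domChart y ∈ (h.domChart.extend 𝓘(ℂ, Fin n → ℂ)).target := by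
      simpa using h.domChart.map_source hy
    have h1 := h.writtenInCharts h0
    simp only [mfld_simps, h.domChart.left_inv hy] at h1
    have h2 : e₁ (i y) = L (h.codChart (i y)) := rfl
    rw [h2, h1]
    simp [L, T]
  -- Shrink the chart of `X`: no other part of the image of `i` may enter, and the foot of the
  -- perpendicular on the hyperplane must stay in the chart of `Y`.
  obtain ⟨O, hO, hOs⟩ := hi.isEmbedding.isInducing.isOpen_iff.mp h.domChart.open_source
  set V : Set X := O ∩ (e₁.source ∩ e₁ ⁻¹' (Fin.tail ⁻¹' h.domChart.target)) with hV
  have htail : Continuous (Fin.tail : (Fin (n + 1) → ℂ) → (Fin n → ℂ)) := by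
    unfold Fin.tail; fun_prop
  have hVo : IsOpen V :=
    hO.inter (e₁.isOpen_inter_preimage (h.domChart.open_target.preimage htail))
  have hmem : ∀ y, y ∈ h.domChart.source ↔ i y ∈ (e₁.restr V).source := by
    intro y
    rw [OpenPartialHomeomorph.restr_source, hVo.interior_eq]
    constructor
    · intro hy
      have h1 : i y ∈ e₁.source := by
        rw [hsrc]; exact h.source_subset_preimage_source hy
      refine ⟨h1, ?_, h1, ?_⟩
      · have : y ∈ i ⁻¹' O := by rw [hOs]; exact hy
        exact this
      · rw [Set.mem_preimage, Set.mem_preimage, hincl y hy, Fin.tail_cons]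
        exact h.domChart.map_source hy
    · intro hy
      have : y ∈ i ⁻¹' O := hy.2.1
      rwa [hOs] at this
  refine ⟨e₁.restr V, h.domChart, (hmem y₀).mp h.mem_domChart_source,
    restr_mem_holoAtlas he₁ hVo, h.domChart_mem_maximalAtlas, fun x _ => rfl, hincl, hmem, ?_⟩
  intro x hx
  rw [OpenPartialHomeomorph.restr_source, hVo.interior_eq] at hx
  have hre : (e₁.restr V) x = e₁ x := rfl
  constructor
  · rintro ⟨y, rfl⟩
    have hy : y ∈ h.domChart.source := by
      have : y ∈ i ⁻¹' O := hx.2.1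
      rwa [hOs] at this
    rw [hre, hincl y hy, Fin.cons_zero]
  · intro h0
    rw [hre] at h0
    have hw : Fin.tail (e₁ x) ∈ h.domChart.target := hx.2.2.2
    have hys := h.domChart.map_target hw
    refine ⟨h.domChart.symm (Fin.tail (e₁ x)), ?_⟩
    refine e₁.injOn (by rw [hsrc]; exact h.source_subset_preimage_source hys) hx.1 ?_
    rw [hincl _ hys, h.domChart.right_inv hw]
    conv_rhs => rw [← Fin.cons_self_tail (e₁ x), h0]

/-- Every local equation is the first coordinate of adapted charts near each point. -/
theorem IsLocalEquation.exists_isAdapted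
    (hi : Manifold.IsSmoothEmbedding 𝓘(ℂ, Fin n → ℂ) 𝓘(ℂ, Fin (n + 1) → ℂ) ω i)
    {U : Set X} {f : X → ℂ} (hf : IsLocalEquation (n := n + 1) (Set.range i) U f) {y₀ : Y}
    (hy₀ : i y₀ ∈ U) :
    ∃ (e : OpenPartialHomeomorph X (Fin (n + 1) → ℂ)) (e' : OpenPartialHomeomorph Y (Fin n → ℂ)),
      i y₀ ∈ e.source ∧ e.source ⊆ U ∧ IsAdapted i f e e' := by
  obtain ⟨e₁, e₁', hye, had⟩ := HadamardResidue.exists_isAdapted hi y₀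
  set F := f ∘ e₁.symm with hFdef
  have hV : IsOpen (e₁.target ∩ e₁.symm ⁻¹' U) := e₁.isOpen_inter_preimage_symm hf.isOpen
  have hF : ContDiffOn ℂ ω F (e₁.target ∩ e₁.symm ⁻¹' U) :=
    contDiffOn_comp_chart_symm had.mem hf.isOpen hf.holomorphic
  have hy₀' : y₀ ∈ e₁'.source := (had.source_iff y₀).mpr hye
  set p := e₁ (i y₀) with hp
  have hpV : p ∈ e₁.target ∩ e₁.symm ⁻¹' U :=
    ⟨e₁.map_source hye, by rw [Set.mem_preimage, hp, e₁.left_inv hye]; exact hy₀⟩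
  have hFdiff : ∀ z ∈ e₁.target ∩ e₁.symm ⁻¹' U, DifferentiableAt ℂ F z := fun z hz =>
    (hF.contDiffAt (hV.mem_nhds hz)).differentiableAt (by simp)
  -- The derivative of `F` vanishes on the hyperplane, hence not on the first basis vector.
  have hder : fderiv ℂ F p (Pi.single 0 1) ≠ 0 := by
    intro h0
    refine hf.fderiv_ne_zero had.mem hye ⟨hy₀, ⟨y₀, rfl⟩⟩ ?_
    have hzero : (F ∘ fun w => hyperplaneInclusion n w) =ᶠ[𝓝 (e₁' y₀)] fun _ => 0 := by
      have hc : ContinuousAt e₁'.symm (e₁' y₀) :=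
        e₁'.symm.continuousAt (e₁'.map_source hy₀')
      have hcU : i ⁻¹' (U ∩ e₁.source) ∈ 𝓝 (e₁'.symm (e₁' y₀)) := by
        rw [e₁'.left_inv hy₀']
        exact hi.isEmbedding.continuous.continuousAt.preimage_mem_nhds
          ((hf.isOpen.inter e₁.open_source).mem_nhds ⟨hy₀, hye⟩)
      filter_upwards [hc hcU, e₁'.open_target.mem_nhds (e₁'.map_source hy₀')] with w hw hwt
      have hws := e₁'.map_target hwt
      have h1 := had.incl _ hws
      rw [e₁'.right_inv hwt] at h1
      have h2 : F (hyperplaneInclusion n w) = f (i (e₁'.symm w)) := by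
        rw [hFdef, Function.comp_apply, hyperplaneInclusion_apply, ← h1, e₁.left_inv hw.2]
      rw [Function.comp_apply, h2]
      exact (hf.zero_iff _ hw.1).mpr ⟨_, rfl⟩
    have hpc : hyperplaneInclusion n (e₁' y₀) = p := (had.incl y₀ hy₀').symm
    have hz2 : (fderiv ℂ F p).comp (hyperplaneInclusion n) = 0 := by
      have h1 : HasFDerivAt (F ∘ fun w => hyperplaneInclusion n w)
          ((fderiv ℂ F p).comp (hyperplaneInclusion n)) (e₁' y₀) := by
        refine HasFDerivAt.comp (e₁' y₀) ?_ (hyperplaneInclusion n).hasFDerivAt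
        rw [hpc]
        exact (hFdiff p hpV).hasFDerivAt
      rw [← h1.fderiv, hzero.fderiv_eq]
      simp
    ext v
    have hv : v = v 0 • (Pi.single 0 1 : Fin (n + 1) → ℂ) +
        hyperplaneInclusion n (Fin.tail v) := by
      funext j
      refine Fin.cases ?_ (fun j => ?_) j
      · simp
      · simp [Fin.tail]
    have h3 := DFunLike.congr_fun hz2 (Fin.tail v)
    change fderiv ℂ F p v = 0
    rw [hv, map_add, map_smul, h0, smul_zero, zero_add]
    exact h3
  -- Replacing the first coordinate by `F` is a local biholomorphism.
  set G : (Fin (n + 1) → ℂ) → (Fin (n + 1) → ℂ) := fun z => consEquiv n (Fin.tail z, F z) with hG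
  let tailL : (Fin (n + 1) → ℂ) →L[ℂ] (Fin n → ℂ) :=
    (ContinuousLinearMap.fst ℂ (Fin n → ℂ) ℂ).comp
      ((consEquiv n).symm : (Fin (n + 1) → ℂ) →L[ℂ] (Fin n → ℂ) × ℂ)
  have htailL : ∀ z, tailL z = Fin.tail z := fun z => rfl
  set Ω : Set (Fin (n + 1) → ℂ) := (e₁.target ∩ e₁.symm ⁻¹' U) ∩
    {z | fderiv ℂ F z (Pi.single 0 1) ≠ 0} with hΩ
  have hΩo : IsOpen Ω := by
    have hc : ContinuousOn (fun z => fderiv ℂ F z (Pi.single 0 1))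
        (e₁.target ∩ e₁.symm ⁻¹' U) :=
      (((hF.fderiv_of_isOpen (m := 0) hV (by simp)).clm_apply contDiffOn_const).continuousOn)
    exact hc.isOpen_inter_preimage hV isOpen_ne
  have hGd : ∀ z ∈ Ω, HasFDerivAt G
      (((consEquiv n).toContinuousLinearMap).comp (tailL.prod (fderiv ℂ F z))) z := by
    intro z hz
    exact (consEquiv n).toContinuousLinearMap.hasFDerivAt.comp z
      (HasFDerivAt.prodMk tailL.hasFDerivAt (hFdiff z hz.1).hasFDerivAt)
  have hGe : ∀ z ∈ Ω, ∃ A : (Fin (n + 1) → ℂ) ≃L[ℂ] (Fin (n + 1) → ℂ),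
      HasFDerivAt G (A : (Fin (n + 1) → ℂ) →L[ℂ] (Fin (n + 1) → ℂ)) z := by
    intro z hz
    set B := ((consEquiv n).toContinuousLinearMap).comp (tailL.prod (fderiv ℂ F z)) with hB
    have hinj : Function.Injective B.toLinearMap := by
      rw [← LinearMap.ker_eq_bot, LinearMap.ker_eq_bot']
      intro v hv
      have h1 : (tailL v, fderiv ℂ F z v) = 0 := (consEquiv n).injective (by
        rw [map_zero]; exact hv)
      have h2 : Fin.tail v = 0 := (Prod.ext_iff.mp h1).1
      have h3 : fderiv ℂ F z v = 0 := (Prod.ext_iff.mp h1).2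
      have hv' : v = v 0 • (Pi.single 0 1 : Fin (n + 1) → ℂ) := by
        funext j
        refine Fin.cases ?_ (fun j => ?_) j
        · simp
        · simpa [Fin.tail] using congrFun h2 j
      rw [hv', map_smul, smul_eq_mul] at h3
      have h4 : v 0 = 0 := (mul_eq_zero.mp h3).resolve_right hz.2
      rw [hv', h4, zero_smul]
    refine ⟨(LinearEquiv.ofInjectiveEndo B.toLinearMap hinj).toContinuousLinearEquiv, ?_⟩
    convert hGd z hz
    rfl
  have hGc : ∀ z ∈ Ω, ContDiffAt ℂ ω G z := by
    intro z hz
    exact (consEquiv n).contDiff.contDiffAt.comp z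
      (tailL.contDiff.contDiffAt.prodMk (hF.contDiffAt (hV.mem_nhds hz.1)))
  have hpΩ : p ∈ Ω := ⟨hpV, hder⟩
  obtain ⟨A, hA⟩ := hGe p hpΩ
  let g₀ := (hGc p hpΩ).toOpenPartialHomeomorph G hA (by simp)
  let g := g₀.restr Ω
  have hgs : g.source = g₀.source ∩ Ω := by
    rw [OpenPartialHomeomorph.restr_source, hΩo.interior_eq]
  have hgG : ∀ z, g z = G z := fun z => rfl
  have hpg : p ∈ g.source := by
    rw [hgs]
    exact ⟨(hGc p hpΩ).mem_toOpenPartialHomeomorph_source hA (by simp), hpΩ⟩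
  have hg1 : ContDiffOn ℂ ω g g.source := fun z hz =>
    (hGc z (by rw [hgs] at hz; exact hz.2)).contDiffWithinAt
  have hg2 : ContDiffOn ℂ ω g.symm g.target := by
    intro a ha
    have hz : g.symm a ∈ Ω := by
      have := g.map_target ha
      rw [hgs] at this
      exact this.2
    obtain ⟨A', hA'⟩ := hGe _ hz
    exact (g.contDiffAt_symm ha hA' (hGc _ hz)).contDiffWithinAt
  let e := e₁ ≫ₕ g
  have hes : ∀ x, x ∈ e.source ↔ x ∈ e₁.source ∧ e₁ x ∈ g.source := fun x => by
    rw [OpenPartialHomeomorph.trans_source]; rfl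
  have hesU : ∀ x ∈ e.source, x ∈ U := by
    intro x hx
    have h1 := (hes x).mp hx
    have h2 := h1.2
    rw [hgs] at h2
    have h3 := h2.2.1.2
    rwa [Set.mem_preimage, e₁.left_inv h1.1] at h3
  have he0 : ∀ x ∈ e.source, e x = Fin.cons (f x) (Fin.tail (e₁ x)) := by
    intro x hx
    change G (e₁ x) = _
    rw [hG]
    simp only [consEquiv_apply, hFdef, Function.comp_apply, e₁.left_inv ((hes x).mp hx).1]
  have hope : IsOpen (i ⁻¹' e.source) := e.open_source.preimage hi.isEmbedding.continuous
  refine ⟨e, e₁'.restr (i ⁻¹' e.source), (hes _).mpr ⟨hye, hpg⟩, hesU,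
    trans_mem_holoAtlas had.mem hg1 hg2, restr_mem_holoAtlas had.mem' hope, ?_, ?_, ?_, ?_⟩
  · intro x hx
    rw [he0 x hx, Fin.cons_zero]
  · intro y hy
    rw [OpenPartialHomeomorph.restr_source, hope.interior_eq] at hy
    rw [he0 _ hy.2, had.incl y hy.1, Fin.tail_cons,
      (hf.zero_iff _ (hesU _ hy.2)).mpr ⟨y, rfl⟩]
    rfl
  · intro y
    rw [OpenPartialHomeomorph.restr_source, hope.interior_eq]
    exact ⟨fun h => h.2, fun h => ⟨(had.source_iff y).mpr ((hes _).mp h).1, h⟩⟩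
  · intro x hx
    exact (hf.zero_iff x (hesU x hx)).symm

/-- The complement of a smooth hypersurface is dense. -/
theorem dense_compl_range
    (hi : Manifold.IsSmoothEmbedding 𝓘(ℂ, Fin n → ℂ) 𝓘(ℂ, Fin (n + 1) → ℂ) ω i) :
    Dense (Set.range i)ᶜ := by
  intro x
  by_cases hx : x ∈ Set.range i
  swap
  · exact subset_closure hx
  obtain ⟨y, rfl⟩ := hx
  obtain ⟨e, e', hye, had⟩ := exists_isAdapted hi y
  have h0 : e (i y) 0 = 0 := (had.mem_range_iff _ hye).mp ⟨y, rfl⟩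
  let c : ℂ → (Fin (n + 1) → ℂ) := fun t => e (i y) + t • (Pi.single 0 1 : Fin (n + 1) → ℂ)
  have hc : Continuous c := by fun_prop
  have hc0 : c 0 = e (i y) := by simp [c]
  have hct : c ⁻¹' e.target ∈ 𝓝 (0 : ℂ) :=
    hc.continuousAt.preimage_mem_nhds (by rw [hc0]; exact e.open_target.mem_nhds (e.map_source hye))
  have hlim : Filter.Tendsto (fun t => e.symm (c t)) (𝓝[≠] 0) (𝓝 (i y)) := by
    have h1 : ContinuousAt e.symm (c 0) := by
      rw [hc0]; exact e.symm.continuousAt (e.map_source hye)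
    have h2 : ContinuousAt (fun t => e.symm (c t)) 0 := h1.comp hc.continuousAt
    have h3 := h2.tendsto
    rw [hc0, e.left_inv hye] at h3
    exact h3.mono_left nhdsWithin_le_nhds
  refine mem_closure_of_tendsto hlim ?_
  filter_upwards [nhdsWithin_le_nhds hct, self_mem_nhdsWithin] with t ht ht0 hmem
  have h1 := (had.mem_range_iff _ (e.map_target ht)).mp hmem
  rw [e.right_inv ht] at h1
  simp only [c, Pi.add_apply, Pi.smul_apply, Pi.single_eq_same, h0, zero_add, smul_eq_mul,
    mul_one] at h1
  exact ht0 h1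

end Adapted

/-! ### Division of forms and the local decomposition -/

section Decomposition

variable {n : ℕ} {X : Type*} [TopologicalSpace X] [ChartedSpace (Fin n → ℂ) X]
  {D U : Set X} {f : X → ℂ} {e : OpenPartialHomeomorph X (Fin n → ℂ)} {x : X}

theorem inChart_mul (e : OpenPartialHomeomorph X (Fin n → ℂ)) (η η' : Form n X) (y : Fin n → ℂ) :
    inChart e (fun x => η x * η' x) y = inChart e η y * inChart e η' y := map_mul _ _ _

theorem inChart_smul (e : OpenPartialHomeomorph X (Fin n → ℂ)) (c : X → ℂ) (η : Form n X)
    (y : Fin n → ℂ) :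
    inChart e (fun x => c x • η x) y = c (e.symm y) • inChart e η y := map_smul _ _ _

theorem inChart_congr_point (e : OpenPartialHomeomorph X (Fin n → ℂ)) {η η' : Form n X}
    {y : Fin n → ℂ} (h : η (e.symm y) = η' (e.symm y)) : inChart e η y = inChart e η' y := by
  have : η.val (e.symm y) = η'.val (e.symm y) := h
  rw [inChart_eq, inChart_eq, this]

theorem d_mul_apply {a b : X → ℂ}
    (ha : MDifferentiableAt 𝓘(ℝ, Fin n → ℂ) 𝓘(ℝ, ℂ) a x)
    (hb : MDifferentiableAt 𝓘(ℝ, Fin n → ℂ) 𝓘(ℝ, ℂ) b x) :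
    (d (fun z => a z * b z) : Form n X) x =
      a x • (d b : Form n X) x + b x • (d a : Form n X) x := by
  have h : realDeriv (fun z => a z * b z) x =
      a x • realDeriv (n := n) b x + b x • realDeriv (n := n) a x :=
    (ha.hasMFDerivAt.mul hb.hasMFDerivAt).mfderiv
  have h' : (d (fun z => a z * b z) : Form n X).val x =
      a x • (d b : Form n X).val x + b x • (d a : Form n X).val x := by
    rw [d_val, d_val, d_val, h, map_add, map_smul, map_smul]
  exact h'

theorem d_mul_self (a : X → ℂ) : (d a : Form n X) x * (d a : Form n X) x = 0 :=
  ExteriorAlgebra.ι_sq_zero _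

theorem d_mul_d (a b : X → ℂ) :
    (d b : Form n X) x * (d a : Form n X) x = -((d a : Form n X) x * (d b : Form n X) x) :=
  eq_neg_of_add_eq_zero_left (ExteriorAlgebra.ι_add_mul_swap _ _)

variable [IsManifold 𝓘(ℂ, Fin n → ℂ) ω X]

/-- A form `θ` extends smoothly across the hypersurface `f = 0` as soon as `f θ` and `f̄ θ` do. -/
theorem IsLocalEquation.extendsSmoothly_of_mul (hf : IsLocalEquation (n := n) D U f)
    (hD : Dense Dᶜ) {θ α β : Form n X} (hα : ∀ x ∈ U, SmoothAt α x) (hβ : ∀ x ∈ U, SmoothAt β x)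
    (hα' : ∀ x ∈ U \ D, α x = f x • θ x)
    (hβ' : ∀ x ∈ U \ D, β x = starRingEnd ℂ (f x) • θ x) : ExtendsSmoothly D θ U := by
  refine extendsSmoothly_of_local hD hf.isOpen fun x hx => ?_
  by_cases hxD : x ∈ D
  swap
  · have hne : IsOpen (U ∩ f ⁻¹' {0}ᶜ) :=
      hf.contMDiffOn_real.continuousOn.isOpen_inter_preimage hf.isOpen isOpen_compl_singleton
    have hfx : f x ≠ 0 := fun h => hxD ((hf.zero_iff x hx).mp h)
    refine ⟨U ∩ f ⁻¹' {0}ᶜ, fun z => (f z)⁻¹ • α z, hne, ⟨hx, hfx⟩, fun z hz => ?_, fun z hz => ?_⟩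
    · refine SmoothAt.smul ?_ (hα z hz.1)
      have h1 : ContDiffAt ℝ ∞ (fun w : ℂ => w⁻¹) (f z) := contDiffAt_inv ℝ hz.2
      exact ContMDiffAt.comp z h1.contMDiffAt
        (hf.contMDiffOn_real.contMDiffAt (hf.isOpen.mem_nhds hz.1))
    · simp only
      rw [hα' z ⟨hz.1.1, hz.2⟩, smul_smul, inv_mul_cancel₀ hz.1.2, one_smul]
  set e := chartAt (Fin n → ℂ) x with he
  have hem : e ∈ holoAtlas n X := IsManifold.chart_mem_maximalAtlas x
  have hxe : x ∈ e.source := mem_chart_source _ x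
  set F := f ∘ e.symm with hFdef
  set V := e.target ∩ e.symm ⁻¹' U with hVdef
  have hV : IsOpen V := e.isOpen_inter_preimage_symm hf.isOpen
  have hF : ContDiffOn ℂ ω F V := contDiffOn_comp_chart_symm hem hf.isOpen hf.holomorphic
  obtain ⟨e₀, he₀⟩ : ∃ e₀, fderiv ℂ F (e x) e₀ ≠ 0 := by
    by_contra! h
    exact hf.fderiv_ne_zero hem hxe ⟨hx, hxD⟩ (ContinuousLinearMap.ext h)
  set W := V ∩ {y | fderiv ℂ F y e₀ ≠ 0} with hWdef
  have hW : IsOpen W :=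
    ((hF.fderiv_of_isOpen (m := 0) hV (by simp)).clm_apply contDiffOn_const).continuousOn
      |>.isOpen_inter_preimage hV isOpen_ne
  have hsm : ∀ {γ : Form n X}, (∀ x ∈ U, SmoothAt γ x) →
      ∀ y ∈ V, CoeffSmoothAt (inChart e γ) y := by
    intro γ hγ y hy
    have := (smoothAt_iff hem (e.map_target hy.1)).mp (hγ _ hy.2)
    rwa [e.right_inv hy.1] at this
  have hrel : ∀ y ∈ V, starRingEnd ℂ (F y) • inChart e α y = F y • inChart e β y := by
    intro y hy
    by_cases hyD : e.symm y ∈ D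
    · have : F y = 0 := (hf.zero_iff _ hy.2).mpr hyD
      simp [this]
    · have h1 : inChart e α y = F y • inChart e θ y := by
        rw [inChart_congr_point e (η' := fun x => f x • θ x) (hα' _ ⟨hy.2, hyD⟩), inChart_smul]
        rfl
      have h2 : inChart e β y = starRingEnd ℂ (F y) • inChart e θ y := by
        rw [inChart_congr_point e (η' := fun x => starRingEnd ℂ (f x) • θ x) (hβ' _ ⟨hy.2, hyD⟩),
          inChart_smul e (fun x => starRingEnd ℂ (f x))]
        rfl
      rw [h1, h2, smul_comm]
  -- The coefficients of `α` are divided by `F` one by one.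
  let b := Module.finBasis ℂ (CovectorAlgebra n)
  have hdiv : ∀ k, ∃ v : (Fin n → ℂ) → ℂ, ContDiffOn ℝ ∞ v W ∧
      ∀ y ∈ W, F y ≠ 0 → v y = b.coord k (inChart e α y) / F y := by
    intro k
    refine exists_contDiffOn_div_of_holomorphic hW (hF.mono Set.inter_subset_left) e₀
      (fun y hy => hy.2) (a := fun y => b.coord k (inChart e α y))
      (b := fun y => b.coord k (inChart e β y))
      (fun y hy => (hsm hα y hy.1 _).contDiffWithinAt)
      (fun y hy => (hsm hβ y hy.1 _).contDiffWithinAt) fun y hy => ?_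
    have := congrArg (b.coord k) (hrel y hy.1)
    simpa only [map_smul, smul_eq_mul] using this
  choose v hv hvF using hdiv
  have hWe : IsOpen (e.source ∩ e ⁻¹' W) := e.isOpen_inter_preimage hW
  refine ⟨e.source ∩ e ⁻¹' W, ofChart e fun y => ∑ k, v k y • b k, hWe, ⟨hxe, ⟨e.map_source hxe, by
    rw [Set.mem_preimage, e.left_inv hxe]; exact hx⟩, he₀⟩, fun z hz => ?_, fun z hz => ?_⟩
  · rw [smoothAt_iff hem hz.1]
    have h1 : CoeffSmoothAt (fun y => ∑ k, v k y • b k) (e z) :=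
      CoeffSmoothAt.sum fun k _ => CoeffSmoothAt.smul ((hv k).contDiffAt (hW.mem_nhds hz.2))
        (CoeffSmoothAt.const _)
    refine h1.congr ?_
    filter_upwards [hW.mem_nhds hz.2] with y hy
    exact inChart_ofChart hem _ hy.1.1
  · obtain ⟨⟨hze, hzW⟩, hzD⟩ := hz
    have hzU : z ∈ U := by
      have := hzW.1.2
      rwa [Set.mem_preimage, e.left_inv hze] at this
    have hFz : F (e z) = f z := by rw [hFdef, Function.comp_apply, e.left_inv hze]
    have hfz : f z ≠ 0 := fun h => hzD ((hf.zero_iff z hzU).mp h)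
    refine eq_of_inChart_eq hem hze ?_
    rw [inChart_ofChart hem _ (e.map_source hze)]
    have h1 : inChart e α (e z) = F (e z) • inChart e θ (e z) := by
      rw [inChart_congr_point e (η' := fun x => f x • θ x) (by
        rw [e.left_inv hze]; exact hα' z ⟨hzU, hzD⟩), inChart_smul]
      rfl
    conv_rhs => rw [← b.sum_repr (inChart e θ (e z))]
    refine Finset.sum_congr rfl fun k _ => ?_
    rw [hvF k _ hzW (by rwa [hFz]), h1, map_smul, smul_eq_mul, hFz, mul_div_cancel_left₀ _ hfz]
    rfl

end Decomposition

/-! ### Algebra of bilogarithmic expressions -/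

section Algebra

/-- Splitting off two covectors `p`, `q` with the help of dual vectors `v`, `w`. -/
theorem sq_smul_eq_decomposition {M : Type*} [AddCommGroup M] [Module ℂ M] {p q : M}
    {v w : Module.Dual ℂ M} {g : ℂ} (hvp : v p = g) (hvq : v q = 0) (hwp : w p = 0) (hwq : w q = g)
    (a : ExteriorAlgebra ℂ M) :
    g ^ 2 • a =
      -(ExteriorAlgebra.ι ℂ p * ExteriorAlgebra.ι ℂ q * interior v (interior w a))
      + ExteriorAlgebra.ι ℂ p * interior v (interior w (ExteriorAlgebra.ι ℂ q * a))
      - ExteriorAlgebra.ι ℂ q * interior v (interior w (ExteriorAlgebra.ι ℂ p * a))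
      - interior v (interior w (ExteriorAlgebra.ι ℂ p * (ExteriorAlgebra.ι ℂ q * a))) := by
  have hpq : ∀ c : ExteriorAlgebra ℂ M, ExteriorAlgebra.ι ℂ p * (ExteriorAlgebra.ι ℂ q * c) =
      -(ExteriorAlgebra.ι ℂ q * (ExteriorAlgebra.ι ℂ p * c)) := by
    intro c
    rw [← mul_assoc, ← mul_assoc,
      eq_neg_of_add_eq_zero_left (ExteriorAlgebra.ι_add_mul_swap (R := ℂ) p q), neg_mul]
  simp only [interior_ι_mul, hvp, hvq, hwp, hwq, map_sub, map_smul, zero_smul, zero_sub, map_neg,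
    mul_sub, mul_add, mul_neg, mul_smul_comm, smul_sub, smul_smul, mul_assoc, pow_two,
    sub_neg_eq_add, neg_sub]
  rw [hpq (interior v (interior w a))]
  abel

variable {A : Type*} [Ring A] [Algebra ℂ A] {p q : A} {z z' : ℂ}

/-- The wedge product of `f̄ df + f df̄` with a bilogarithmic expression has no poles. -/
theorem bilog_mul (hp : p * p = 0) (hq : q * q = 0) (hpq : q * p = -(p * q)) (hz : z ≠ 0)
    (hz' : z' ≠ 0) (a b c r : A) :
    (z' • p + z • q) * ((z⁻¹ • p) * (z'⁻¹ • q) * a + (z⁻¹ • p) * b + (z'⁻¹ • q) * c + r) =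
      p * q * c + q * p * b + (z' • p + z • q) * r := by
  have h1 : ∀ t : A, p * (p * t) = 0 := fun t => by rw [← mul_assoc, hp, zero_mul]
  have h2 : ∀ t : A, q * (q * t) = 0 := fun t => by rw [← mul_assoc, hq, zero_mul]
  have h3 : ∀ t : A, q * (p * t) = -(p * (q * t)) := fun t => by
    rw [← mul_assoc, hpq, neg_mul, mul_assoc]
  simp only [add_mul, mul_add, smul_mul_assoc, mul_smul_comm, mul_assoc, h1, h2, h3, smul_zero,
    mul_zero, smul_neg]
  match_scalars <;> field_simp

/-- The product of `f f̄` with a bilogarithmic expression has no poles. -/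
theorem bilog_smul (hz : z ≠ 0) (hz' : z' ≠ 0) (a b c r : A) :
    (z * z') • ((z⁻¹ • p) * (z'⁻¹ • q) * a + (z⁻¹ • p) * b + (z'⁻¹ • q) * c + r) =
      p * q * a + z' • (p * b) + z • (q * c) + (z * z') • r := by
  simp only [smul_add, smul_mul_assoc, mul_smul_comm, smul_smul]
  congr 1
  congr 1
  · congr 1
    · rw [show z * z' * (z'⁻¹ * z⁻¹) = 1 by field_simp, one_smul]
    · rw [show z * z' * z⁻¹ = z' by field_simp]
  · rw [show z * z' * z'⁻¹ = z by field_simp]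

end Algebra


/-! ### Bilogarithmic expressions of tame forms -/

section Contraction

variable {n : ℕ} {X : Type*} [TopologicalSpace X] [ChartedSpace (Fin n → ℂ) X]
  {D U : Set X} {f : X → ℂ} {e : OpenPartialHomeomorph X (Fin n → ℂ)}

/-- The Wirtinger vector `½ ∑ⱼ cⱼ (∂/∂xⱼ - i ε ∂/∂yⱼ)`, as a linear form on covectors: of type
`(1, 0)` for `ε = 1` and of type `(0, 1)` for `ε = -1`. -/
def wirtinger (n : ℕ) (ε : ℂ) (c : Fin n → ℂ) : Module.Dual ℂ ((Fin n → ℂ) →L[ℝ] ℂ) where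
  toFun θ := ∑ j, c j * ((1 / 2 : ℂ) *
    (θ (Pi.single j 1) - ε * Complex.I * θ (Pi.single j Complex.I)))
  map_add' θ θ' := by
    rw [← Finset.sum_add_distrib]
    refine Finset.sum_congr rfl fun j _ => ?_
    simp only [add_apply]
    ring
  map_smul' a θ := by
    rw [RingHom.id_apply, smul_eq_mul, Finset.mul_sum]
    refine Finset.sum_congr rfl fun j _ => ?_
    simp only [smul_apply, smul_eq_mul]
    ring

theorem wirtinger_apply (ε : ℂ) (c : Fin n → ℂ) (θ : (Fin n → ℂ) →L[ℝ] ℂ) :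
    wirtinger n ε c θ = ∑ j, c j * ((1 / 2 : ℂ) *
      (θ (Pi.single j 1) - ε * Complex.I * θ (Pi.single j Complex.I))) := rfl

theorem single_I (j : Fin n) :
    (Pi.single j Complex.I : Fin n → ℂ) = Complex.I • (Pi.single j 1 : Fin n → ℂ) := by
  rw [← Pi.single_smul, smul_eq_mul, mul_one]

theorem wirtinger_holomorphic (ε : ℂ) (c : Fin n → ℂ) (L : (Fin n → ℂ) →L[ℂ] ℂ) :
    wirtinger n ε c (L.restrictScalars ℝ) =
      (1 + ε) / 2 * ∑ j, c j * L (Pi.single j 1) := by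
  rw [wirtinger_apply, Finset.mul_sum]
  refine Finset.sum_congr rfl fun j _ => ?_
  simp only [ContinuousLinearMap.coe_restrictScalars', single_I, map_smul, smul_eq_mul]
  linear_combination (-(1 / 2 : ℂ) * c j * ε * L (Pi.single j 1)) * Complex.I_mul_I

theorem wirtinger_antiholomorphic (ε : ℂ) (c : Fin n → ℂ) (L : (Fin n → ℂ) →L[ℂ] ℂ) :
    wirtinger n ε c ((Complex.conjCLE : ℂ →L[ℝ] ℂ).comp (L.restrictScalars ℝ)) =
      (1 - ε) / 2 * ∑ j, c j * starRingEnd ℂ (L (Pi.single j 1)) := by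
  rw [wirtinger_apply, Finset.mul_sum]
  refine Finset.sum_congr rfl fun j _ => ?_
  simp only [ContinuousLinearMap.comp_apply, ContinuousLinearMap.coe_restrictScalars', single_I,
    map_smul, smul_eq_mul, ContinuousLinearEquiv.coe_coe, Complex.conjCLE_apply, map_mul,
    Complex.conj_I]
  linear_combination ((1 / 2 : ℂ) * c j * ε * starRingEnd ℂ (L (Pi.single j 1))) * Complex.I_mul_I

theorem coeffSmoothAt_wirtinger {ε : ℂ} {c : (Fin n → ℂ) → Fin n → ℂ} {y : Fin n → ℂ}
    (hc : ∀ j, ContDiffAt ℝ ∞ (fun z => c z j) y) :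
    CoeffSmoothAt (fun z => wirtinger n ε (c z)) y := by
  have h : (fun z => wirtinger n ε (c z)) =
      fun z => ∑ j, c z j • wirtinger n ε (Pi.single j 1) := by
    funext z
    ext θ
    simp [wirtinger_apply, LinearMap.sum_apply, Pi.single_apply]
  rw [h]
  exact CoeffSmoothAt.sum fun j _ => CoeffSmoothAt.smul (hc j) (CoeffSmoothAt.const _)

variable [IsManifold 𝓘(ℂ, Fin n → ℂ) ω X]

/-- Contraction with the gradients of `f` and `f̄` in a chart splits off `df` and `df̄`. The
function `g` is the squared length of the gradient of `f`. -/
theorem IsLocalEquation.exists_contraction (hf : IsLocalEquation (n := n) D U f)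
    (he : e ∈ holoAtlas n X) (hU : U ⊆ e.source) :
    ∃ (g : X → ℝ)
      (k : ∀ x : X, ExteriorAlgebra ℂ (Cotangent n x) →ₗ[ℂ] ExteriorAlgebra ℂ (Cotangent n x)),
      ContMDiffOn 𝓘(ℝ, Fin n → ℂ) 𝓘(ℝ, ℂ) ∞ (fun x => (g x : ℂ)) U ∧ (∀ x, 0 ≤ g x) ∧
      (∀ x ∈ U ∩ D, 0 < g x) ∧
      (∀ θ : Form n X, ∀ x ∈ U, SmoothAt θ x → SmoothAt (fun z => k z (θ z)) x) ∧
      ∀ x ∈ U, ∀ a : ExteriorAlgebra ℂ (Cotangent n x),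
        (g x : ℂ) ^ 2 • a =
          -((d f : Form n X) x * (d (fun z => starRingEnd ℂ (f z)) : Form n X) x * k x a)
          + (d f : Form n X) x * k x ((d (fun z => starRingEnd ℂ (f z)) : Form n X) x * a)
          - (d (fun z => starRingEnd ℂ (f z)) : Form n X) x * k x ((d f : Form n X) x * a)
          - k x ((d f : Form n X) x * ((d (fun z => starRingEnd ℂ (f z)) : Form n X) x * a)) := by
  set F := f ∘ e.symm with hFdef
  set V := e.target ∩ e.symm ⁻¹' U with hVdef
  have hV : IsOpen V := e.isOpen_inter_preimage_symm hf.isOpen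
  have hF : ContDiffOn ℂ ω F V := contDiffOn_comp_chart_symm he hf.isOpen hf.holomorphic
  have heV : ∀ x ∈ U, e x ∈ V := fun x hx =>
    ⟨e.map_source (hU hx), by rw [Set.mem_preimage, e.left_inv (hU hx)]; exact hx⟩
  let δ : (Fin n → ℂ) → Fin n → ℂ := fun y j => fderiv ℂ F y (Pi.single j 1)
  have hδ : ∀ y ∈ V, ∀ j, ContDiffAt ℝ ∞ (fun z => δ z j) y := by
    intro y hy j
    have h1 : ContDiffOn ℂ ∞ (fderiv ℂ F) V := hF.fderiv_of_isOpen (m := ∞) hV (by simp)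
    have h2 : ContDiffOn ℂ ∞ (fun z => δ z j) V := h1.clm_apply contDiffOn_const
    exact (h2.contDiffAt (hV.mem_nhds hy)).restrict_scalars ℝ
  let δ' : (Fin n → ℂ) → Fin n → ℂ := fun y j => starRingEnd ℂ (δ y j)
  have hδ' : ∀ y ∈ V, ∀ j, ContDiffAt ℝ ∞ (fun z => δ' z j) y := fun y hy j =>
    Complex.conjCLE.contDiff.contDiffAt.comp y (hδ y hy j)
  let G : (Fin n → ℂ) → ℝ := fun y => ∑ j, ‖δ y j‖ ^ 2
  have hG : ∀ y, (G y : ℂ) = ∑ j, δ' y j * δ y j := by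
    intro y
    simp only [G]
    push_cast
    refine Finset.sum_congr rfl fun j _ => ?_
    exact (RCLike.conj_mul (δ y j)).symm
  let κ : (Fin n → ℂ) → CovectorAlgebra n →ₗ[ℂ] CovectorAlgebra n := fun y =>
    (interior (wirtinger n 1 (δ' y))).comp (interior (wirtinger n (-1) (δ y)))
  let k : ∀ x : X, CovectorAlgebra n →ₗ[ℂ] CovectorAlgebra n := fun x =>
    (ExteriorAlgebra.map (transpose (tderiv (m := n) e x))).toLinearMap.comp ((κ (e x)).comp
      (ExteriorAlgebra.map (transpose (tderiv (n := n) e.symm (e x)))).toLinearMap)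
  refine ⟨fun x => G (e x), k, ?_, fun x => by positivity, ?_, ?_, ?_⟩
  · intro x hx
    refine ContMDiffAt.contMDiffWithinAt ?_
    have h1 : ContDiffAt ℝ ∞ (fun y => (G y : ℂ)) (e x) := by
      simp only [hG]
      exact ContDiffAt.sum fun j _ => (hδ' _ (heV x hx) j).mul (hδ _ (heV x hx) j)
    exact h1.contMDiffAt.comp x (contMDiffAt_chart he (hU hx))
  · intro x hx
    have h1 := hf.fderiv_ne_zero he (hU hx.1) hx
    obtain ⟨j, hj⟩ : ∃ j, δ (e x) j ≠ 0 := by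
      by_contra! h0
      refine h1 (ContinuousLinearMap.coe_injective ?_)
      refine LinearMap.pi_ext' fun j => LinearMap.ext_ring ?_
      exact h0 j
    refine Finset.sum_pos' (fun j _ => by positivity) ⟨j, Finset.mem_univ j, by positivity⟩
  · intro θ x hx hθ
    rw [smoothAt_iff he (hU hx)] at hθ ⊢
    have h1 : CoeffSmoothAt (fun y => κ y (inChart e θ y)) (e x) := by
      refine CoeffSmoothAt.interior (coeffSmoothAt_wirtinger (hδ' _ (heV x hx))) ?_
      exact CoeffSmoothAt.interior (coeffSmoothAt_wirtinger (hδ _ (heV x hx))) hθ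
    refine h1.congr ?_
    filter_upwards [e.open_target.mem_nhds (e.map_source (hU hx))] with y hy
    rw [← inChart_ofChart he (fun y => κ y (inChart e θ y)) hy]
    refine inChart_congr_point e ?_
    change _ = ExteriorAlgebra.map _ (κ (e (e.symm y)) (inChart e θ (e (e.symm y))))
    rw [inChart_eq, e.left_inv (e.map_target hy)]
    rfl
  · intro x hx a
    have hex := heV x hx
    have hfd : fderiv ℝ F (e x) = (fderiv ℂ F (e x)).restrictScalars ℝ :=
      ((hF.contDiffAt (hV.mem_nhds hex)).differentiableAt (by simp)).fderiv_restrictScalars ℝ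
    have hfr : DifferentiableAt ℝ F (e x) :=
      ((hF.contDiffAt (hV.mem_nhds hex)).differentiableAt (by simp)).restrictScalars ℝ
    set P : (Fin n → ℂ) →L[ℝ] ℂ := (fderiv ℂ F (e x)).restrictScalars ℝ with hP
    set Q : (Fin n → ℂ) →L[ℝ] ℂ := (Complex.conjCLE : ℂ →L[ℝ] ℂ).comp P with hQ
    have hfbar : fderiv ℝ ((fun z => starRingEnd ℂ (f z)) ∘ e.symm) (e x) = Q := by
      rw [hQ, ← hfd]
      exact (Complex.conjCLE.hasFDerivAt.comp (e x) hfr.hasFDerivAt).fderiv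
    have hdf : (d f : Form n X).val x =
        ExteriorAlgebra.map (transpose (tderiv (m := n) e x)) (ExteriorAlgebra.ι ℂ P) := by
      rw [val_eq_map_inChart he _ (hU hx), inChart_d he (e.map_source (hU hx)) ?_, ← hFdef, hfd]
      rw [e.left_inv (hU hx)]
      exact (hf.contMDiffOn_real.contMDiffAt (hf.isOpen.mem_nhds hx)).mdifferentiableAt (by simp)
    have hdfbar : (d (fun z => starRingEnd ℂ (f z)) : Form n X).val x =
        ExteriorAlgebra.map (transpose (tderiv (m := n) e x)) (ExteriorAlgebra.ι ℂ Q) := by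
      rw [val_eq_map_inChart he _ (hU hx), inChart_d he (e.map_source (hU hx)) ?_, hfbar]
      rw [e.left_inv (hU hx)]
      exact (hf.contMDiffOn_conj.contMDiffAt (hf.isOpen.mem_nhds hx)).mdifferentiableAt (by simp)
    have hinv : ∀ b : CovectorAlgebra n,
        ExteriorAlgebra.map (transpose (tderiv (n := n) e.symm (e x)))
          (ExteriorAlgebra.map (transpose (tderiv (m := n) e x)) b) = b := by
      intro b
      have h1 := inChart_ofChart he (fun _ => b) (e.map_source (hU hx))
      rw [inChart_eq, e.left_inv (hU hx)] at h1
      exact h1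
    obtain ⟨b, rfl⟩ : ∃ b : CovectorAlgebra n,
        ExteriorAlgebra.map (transpose (tderiv (m := n) e x)) b = (a : CovectorAlgebra n) := by
      refine ⟨inChart e (fun z => (a : CovectorAlgebra n)) (e x), ?_⟩
      exact (val_eq_map_inChart he (fun z => (a : CovectorAlgebra n)) (hU hx)).symm
    have hgP : wirtinger n 1 (δ' (e x)) P = G (e x) := by
      rw [hP, wirtinger_holomorphic, hG]; norm_num; rfl
    have hgQ : wirtinger n 1 (δ' (e x)) Q = 0 := by
      rw [hQ, hP, wirtinger_antiholomorphic]; norm_num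
    have hwP : wirtinger n (-1) (δ (e x)) P = 0 := by
      rw [hP, wirtinger_holomorphic]; norm_num
    have hwQ : wirtinger n (-1) (δ (e x)) Q = G (e x) := by
      rw [hQ, hP, wirtinger_antiholomorphic, hG]; norm_num
      exact Finset.sum_congr rfl fun j _ => mul_comm _ _
    have hk : ∀ c : CovectorAlgebra n, ExteriorAlgebra.map (transpose (tderiv (m := n) e x))
        (interior (wirtinger n 1 (δ' (e x))) (interior (wirtinger n (-1) (δ (e x))) c)) =
        k x (ExteriorAlgebra.map (transpose (tderiv (m := n) e x)) c) := by
      intro c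
      change _ = ExteriorAlgebra.map _ (κ (e x) (ExteriorAlgebra.map _ (ExteriorAlgebra.map _ c)))
      rw [hinv]
      rfl
    have key := congrArg (ExteriorAlgebra.map (transpose (tderiv (m := n) e x)))
      (sq_smul_eq_decomposition hgP hgQ hwP hwQ b)
    simp only [map_sub, map_add, map_neg, map_mul, map_smul, hk, ← hdf, ← hdfbar] at key
    exact key

end Contraction


section Patching

variable {n : ℕ} {X : Type*} [TopologicalSpace X] [ChartedSpace (Fin n → ℂ) X]
  [IsManifold 𝓘(ℂ, Fin n → ℂ) ω X] [T2Space X] [SigmaCompactSpace X] {D U : Set X} {f : X → ℂ}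

theorem contMDiff_chartPartition (c : X) :
    ContMDiff 𝓘(ℝ, Fin n → ℂ) 𝓘(ℝ, ℂ) ∞ (fun x => (chartPartition n X c x : ℂ)) :=
  Complex.ofRealCLM.contDiff.contMDiff.comp (chartPartition n X c).contMDiff

/-- The form `∑_c ρ_c θ_c` glued from forms `θ_c` on the domains of the preferred charts. -/
def patch (θ : X → Form n X) : Form n X := fun x =>
  ∑ c ∈ (chartPartition n X).fintsupport x, (chartPartition n X c x : ℂ) • θ c x

theorem patch_eq_sum (θ : X → Form n X) {x : X} {S : Finset X}
    (hS : (chartPartition n X).fintsupport x ⊆ S) :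
    patch θ x = ∑ c ∈ S, (chartPartition n X c x : ℂ) • θ c x := by
  refine Finset.sum_subset hS fun c _ hc => ?_
  have : chartPartition n X c x = 0 := by
    by_contra h0
    exact hc ((chartPartition n X).finsupport_subset_fintsupport x
      (((chartPartition n X).mem_finsupport x).mpr h0))
  rw [this, Complex.ofReal_zero, zero_smul]

theorem smoothAt_patch {θ : X → Form n X} {x : X}
    (h : ∀ c, x ∈ (chartAt (Fin n → ℂ) c).source → SmoothAt (θ c) x) : SmoothAt (patch θ) x := by
  have h1 : SmoothAt (fun z => ∑ c ∈ (chartPartition n X).fintsupport x,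
      (chartPartition n X c z : ℂ) • θ c z) x := by
    refine SmoothAt.sum fun c hc => SmoothAt.smul (contMDiff_chartPartition c).contMDiffAt (h c ?_)
    exact chartPartition_isSubordinate c (((chartPartition n X).mem_fintsupport_iff x c).mp hc)
  refine h1.congr ?_
  filter_upwards [(chartPartition n X).eventually_fintsupport_subset x] with z hz
  exact patch_eq_sum θ hz

theorem mul_patch (a : Form n X) (θ : X → Form n X) (x : X) :
    a x * patch θ x = patch (fun c x => a x * θ c x) x := by
  rw [patch, patch, Finset.mul_sum]
  exact Finset.sum_congr rfl fun c _ => mul_smul_comm _ _ _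

theorem patch_add (θ θ' : X → Form n X) (x : X) :
    patch θ x + patch θ' x = patch (fun c x => θ c x + θ' c x) x := by
  rw [patch, patch, patch, ← Finset.sum_add_distrib]
  exact Finset.sum_congr rfl fun c _ => (smul_add _ _ _).symm

theorem patch_eq_of_forall {θ : X → Form n X} {η : Form n X} {x : X}
    (h : ∀ c, x ∈ (chartAt (Fin n → ℂ) c).source → θ c x = η x) : patch θ x = η x := by
  have h1 : ∑ c ∈ (chartPartition n X).fintsupport x, (chartPartition n X c x : ℂ) = 1 := by
    rw [← Complex.ofReal_sum, (chartPartition n X).sum_finsupport' x (Set.mem_univ x)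
      ((chartPartition n X).finsupport_subset_fintsupport x), Complex.ofReal_one]
  rw [patch, ← one_smul ℂ (η x), ← h1, Finset.sum_smul]
  refine Finset.sum_congr rfl fun c hc => ?_
  rw [h c (chartPartition_isSubordinate c (((chartPartition n X).mem_fintsupport_iff x c).mp hc))]

end Patching

section Tame

/-- Rearranging the decomposition `h` of `g² a` as a bilogarithmic expression of `a`. Since `g` may
vanish, the division is by `(g + z z')²`, the remainder being a multiple of `z z' a`. -/
theorem bilog_decomposition {A : Type*} [Ring A] [Algebra ℂ A] {z z' g : ℂ} (hz : z ≠ 0)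
    (hz' : z' ≠ 0) (hN : g + z * z' ≠ 0) (p q a k kp kq kpq : A)
    (h : g ^ 2 • a = -(p * q * k) + p * kq - q * kp - kpq) :
    a = (z⁻¹ • p) * (z'⁻¹ • q) * (((g + z * z')⁻¹ ^ 2) • -((z * z') • k))
      + (z⁻¹ • p) * (((g + z * z')⁻¹ ^ 2) • (z • kq))
      + (z'⁻¹ • q) * (((g + z * z')⁻¹ ^ 2) • (z • kq - (z' • kp + z • kq)))
      + ((g + z * z')⁻¹ ^ 2) • (-kpq + (2 * g + z * z') • ((z * z') • a)) := by
  have h1 : a = ((g + z * z')⁻¹ ^ 2) •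
      (g ^ 2 • a + (2 * g + z * z') • ((z * z') • a)) := by
    match_scalars
    field_simp
    ring
  conv_lhs => rw [h1, h]
  simp only [mul_add, mul_sub, mul_neg, smul_mul_assoc, mul_smul_comm, mul_assoc, smul_neg]
  match_scalars <;> field_simp
  ring

variable {n : ℕ} {X : Type*} [TopologicalSpace X] [ChartedSpace (Fin n → ℂ) X] {D U : Set X}
  {f : X → ℂ}

theorem contMDiffAt_mul {a b : X → ℂ} {x : X} (ha : ContMDiffAt 𝓘(ℝ, Fin n → ℂ) 𝓘(ℝ, ℂ) ∞ a x)
    (hb : ContMDiffAt 𝓘(ℝ, Fin n → ℂ) 𝓘(ℝ, ℂ) ∞ b x) :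
    ContMDiffAt 𝓘(ℝ, Fin n → ℂ) 𝓘(ℝ, ℂ) ∞ (fun y => a y * b y) x :=
  (contDiff_mul (𝕜 := ℝ) (𝔸 := ℂ)).contMDiff.contMDiffAt.comp x (ha.prodMk_space hb)

theorem d_congr {a b : X → ℂ} {x : X} (h : a =ᶠ[𝓝 x] b) : (d a : Form n X) x = (d b : Form n X) x :=
  congrArg (ExteriorAlgebra.ι ℂ) h.mfderiv_eq

/-- The differential of `μ = h f f̄`. -/
theorem d_conformal {μ h : X → ℝ} {x : X} (hU : IsOpen U) (hx : x ∈ U)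
    (hh : ContMDiffOn 𝓘(ℝ, Fin n → ℂ) 𝓘(ℝ, ℝ) ∞ h U)
    (hf : ContMDiffOn 𝓘(ℝ, Fin n → ℂ) 𝓘(ℝ, ℂ) ∞ f U)
    (hμ : ∀ x ∈ U, μ x = h x * ‖f x‖ ^ 2) :
    (d (fun y => (μ y : ℂ)) : Form n X) x =
      (h x : ℂ) • (starRingEnd ℂ (f x) • (d f : Form n X) x
          + f x • (d (fun y => starRingEnd ℂ (f y)) : Form n X) x)
        + (f x * starRingEnd ℂ (f x)) • (d (fun y => (h y : ℂ)) : Form n X) x := by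
  have h1 : (fun y => (μ y : ℂ)) =ᶠ[𝓝 x]
      fun y => (h y : ℂ) * (f y * starRingEnd ℂ (f y)) := by
    filter_upwards [hU.mem_nhds hx] with y hy
    rw [hμ y hy, RCLike.mul_conj]
    push_cast
    rfl
  have hfx : ContMDiffAt 𝓘(ℝ, Fin n → ℂ) 𝓘(ℝ, ℂ) ∞ f x := hf.contMDiffAt (hU.mem_nhds hx)
  have hfbar : ContMDiffAt 𝓘(ℝ, Fin n → ℂ) 𝓘(ℝ, ℂ) ∞ (fun y => starRingEnd ℂ (f y)) x :=
    Complex.conjCLE.contDiff.contMDiff.contMDiffAt.comp x hfx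
  have hhx : ContMDiffAt 𝓘(ℝ, Fin n → ℂ) 𝓘(ℝ, ℂ) ∞ (fun y => (h y : ℂ)) x :=
    Complex.ofRealCLM.contDiff.contMDiff.contMDiffAt.comp x (hh.contMDiffAt (hU.mem_nhds hx))
  have hd := hfx.mdifferentiableAt (by simp)
  have hd' := hfbar.mdifferentiableAt (by simp)
  have hdd := (contMDiffAt_mul hfx hfbar).mdifferentiableAt (by simp)
  rw [d_congr h1, d_mul_apply (hhx.mdifferentiableAt (by simp)) hdd, d_mul_apply hd hd',
    add_comm (f x • _)]

variable [IsManifold 𝓘(ℂ, Fin n → ℂ) ω X]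

/-- A form with finite pole along the closed set `D` is smooth off `D`. -/
theorem HasFinitePole.smoothAt {μ : X → ℝ} {η : Form n X} (hη : HasFinitePole D μ η)
    (hμ : IsCanonicalMorseBott (n := n) D μ) (hD : IsClosed D) {x : X} (hx : x ∉ D) :
    SmoothAt η x := by
  obtain ⟨W, hW, hxW, N, θ, hθ, heq⟩ := hη x
  have hμx : ContMDiffAt 𝓘(ℝ, Fin n → ℂ) 𝓘(ℝ, ℂ) ∞ (fun y => (((μ y : ℂ)) ^ N)⁻¹) x := by
    have h1 : ContDiffAt ℝ ∞ (fun t : ℝ => ((t : ℂ) ^ N)⁻¹) (μ x) := by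
      refine ContDiffAt.inv (Complex.ofRealCLM.contDiff.contDiffAt.pow N) ?_
      exact pow_ne_zero N (Complex.ofReal_ne_zero.mpr fun h => hx ((hμ.zero_iff x).mp h))
    exact h1.contMDiffAt.comp x hμ.smooth.contMDiffAt
  refine (SmoothAt.smul hμx ((isSmoothOn_iff hW).mp hθ x hxW)).congr ?_
  filter_upwards [hW.mem_nhds hxW, hD.isOpen_compl.mem_nhds hx] with z hz hzD
  have h0 : ((μ z : ℂ)) ^ N ≠ 0 :=
    pow_ne_zero N (Complex.ofReal_ne_zero.mpr fun h => hzD ((hμ.zero_iff z).mp h))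
  rw [heq z ⟨hz, hzD⟩, smul_smul, inv_mul_cancel₀ h0, one_smul]

/-- In a chart domain, a form `η` such that `|f|² η` and `d|f|² ∧ η` extend smoothly is
bilogarithmic. Contracting `df` and `df̄` out of `η` gives the coefficients; they extend by the
division principle. -/
theorem IsLocalEquation.exists_isBilogarithmic_of_chart (hf : IsLocalEquation (n := n) D U f)
    (hD : Dense Dᶜ) {e : OpenPartialHomeomorph X (Fin n → ℂ)} (he : e ∈ holoAtlas n X)
    (hU : U ⊆ e.source) {η α β : Form n X}
    (hα : ∀ x ∈ U, SmoothAt α x) (hβ : ∀ x ∈ U, SmoothAt β x)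
    (hα' : ∀ x ∈ U \ D, α x = (f x * starRingEnd ℂ (f x)) • η x)
    (hβ' : ∀ x ∈ U \ D, β x = starRingEnd ℂ (f x) • ((d f : Form n X) x * η x) +
      f x • ((d (fun y => starRingEnd ℂ (f y)) : Form n X) x * η x)) :
    ∃ η₁₁ η₁₀ η₀₁ η₀₀ : Form n X, IsBilogarithmic D U f η η₁₁ η₁₀ η₀₁ η₀₀ := by
  obtain ⟨g, k, hg, hg0, hgD, hk, hdec⟩ := hf.exists_contraction he hU
  set p : Form n X := d f with hp
  set q : Form n X := d (fun y => starRingEnd ℂ (f y)) with hq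
  have hps : ∀ x ∈ U, SmoothAt p x := fun x hx => smoothAt_d hf.isOpen hf.contMDiffOn_real hx
  have hqs : ∀ x ∈ U, SmoothAt q x := fun x hx => smoothAt_d hf.isOpen hf.contMDiffOn_conj hx
  have hfs : ∀ x ∈ U, ContMDiffAt 𝓘(ℝ, Fin n → ℂ) 𝓘(ℝ, ℂ) ∞ f x := fun x hx =>
    hf.contMDiffOn_real.contMDiffAt (hf.isOpen.mem_nhds hx)
  have hfs' : ∀ x ∈ U, ContMDiffAt 𝓘(ℝ, Fin n → ℂ) 𝓘(ℝ, ℂ) ∞ (fun y => starRingEnd ℂ (f y)) x :=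
    fun x hx => hf.contMDiffOn_conj.contMDiffAt (hf.isOpen.mem_nhds hx)
  have hgs : ∀ x ∈ U, ContMDiffAt 𝓘(ℝ, Fin n → ℂ) 𝓘(ℝ, ℂ) ∞ (fun y => (g y : ℂ)) x :=
    fun x hx => hg.contMDiffAt (hf.isOpen.mem_nhds hx)
  have hpp : ∀ x, p x * p x = 0 := fun x => d_mul_self f
  have hqq : ∀ x, q x * q x = 0 := fun x => d_mul_self _
  have hqp : ∀ x, q x * p x = -(p x * q x) := fun x => d_mul_d f _
  -- Smooth extensions of `f k(df̄ η)` and of `-k(df df̄ η)`.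
  obtain ⟨T₁₀, hT₁₀, hT₁₀'⟩ := hf.extendsSmoothly_of_mul hD
    (θ := fun x => f x • k x (q x * η x))
    (α := fun x => f x • k x (β x) - k x (p x * α x)) (β := fun x => k x (q x * α x))
    (fun x hx => ((hk β x hx (hβ x hx)).smul (hfs x hx)).sub
      (hk (fun x => p x * α x) x hx ((hps x hx).mul (hα x hx))))
    (fun x hx => hk (fun x => q x * α x) x hx ((hqs x hx).mul (hα x hx)))
    (fun x hx => by
      simp only [hα' x hx, hβ' x hx, map_add, map_smul, mul_smul_comm]
      module)
    (fun x hx => by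
      simp only [hα' x hx, map_smul, mul_smul_comm]
      module)
  obtain ⟨T₀₀, hT₀₀, hT₀₀'⟩ := hf.extendsSmoothly_of_mul hD
    (θ := fun x => -k x (p x * (q x * η x)))
    (α := fun x => (-1 : ℂ) • k x (p x * β x)) (β := fun x => k x (q x * β x))
    (fun x hx => (hk (fun x => p x * β x) x hx ((hps x hx).mul (hβ x hx))).smul contMDiffAt_const)
    (fun x hx => hk (fun x => q x * β x) x hx ((hqs x hx).mul (hβ x hx)))
    (fun x hx => by
      simp only [hβ' x hx, mul_add, mul_smul_comm, map_add, map_smul, ← mul_assoc, hpp x, zero_mul,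
        smul_zero, map_zero]
      module)
    (fun x hx => by
      simp only [hβ' x hx, mul_add, mul_smul_comm, map_add, map_smul, ← mul_assoc, hqq x, hqp x,
        neg_mul, map_neg, zero_mul, smul_zero, map_zero]
      module)
  rw [isSmoothOn_iff hf.isOpen] at hT₁₀ hT₀₀
  have hN : ∀ x ∈ U, (g x : ℂ) + f x * starRingEnd ℂ (f x) ≠ 0 := by
    intro x hx
    have h1 : (g x : ℂ) + f x * starRingEnd ℂ (f x) = ((g x + ‖f x‖ ^ 2 : ℝ) : ℂ) := by
      rw [RCLike.mul_conj]; push_cast; rfl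
    rw [h1, Complex.ofReal_ne_zero]
    by_cases h0 : f x = 0
    · have := hgD x ⟨hx, (hf.zero_iff x hx).mp h0⟩
      positivity
    · have := hg0 x
      positivity
  have hff : ∀ x ∈ U, ContMDiffAt 𝓘(ℝ, Fin n → ℂ) 𝓘(ℝ, ℂ) ∞
      (fun y => f y * starRingEnd ℂ (f y)) x := fun x hx => contMDiffAt_mul (hfs x hx) (hfs' x hx)
  have hc : ∀ x ∈ U, ContMDiffAt 𝓘(ℝ, Fin n → ℂ) 𝓘(ℝ, ℂ) ∞
      (fun y => ((g y : ℂ) + f y * starRingEnd ℂ (f y))⁻¹ ^ 2) x := by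
    intro x hx
    have h1 : ContDiffAt ℝ ∞ (fun w : ℂ => w⁻¹ ^ 2) ((g x : ℂ) + f x * starRingEnd ℂ (f x)) :=
      (contDiffAt_inv ℝ (hN x hx)).pow 2
    exact h1.contMDiffAt.comp x ((hgs x hx).add (hff x hx))
  refine ⟨fun x => ((g x : ℂ) + f x * starRingEnd ℂ (f x))⁻¹ ^ 2 • ((-1 : ℂ) • k x (α x)),
    fun x => ((g x : ℂ) + f x * starRingEnd ℂ (f x))⁻¹ ^ 2 • T₁₀ x,
    fun x => ((g x : ℂ) + f x * starRingEnd ℂ (f x))⁻¹ ^ 2 • (T₁₀ x - k x (β x)),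
    fun x => ((g x : ℂ) + f x * starRingEnd ℂ (f x))⁻¹ ^ 2 •
      (T₀₀ x + (2 * (g x : ℂ) + f x * starRingEnd ℂ (f x)) • α x), ?_, ?_, ?_, ?_, ?_⟩
  · rw [isSmoothOn_iff hf.isOpen]
    exact fun x hx => ((hk α x hx (hα x hx)).smul contMDiffAt_const).smul (hc x hx)
  · rw [isSmoothOn_iff hf.isOpen]
    exact fun x hx => (hT₁₀ x hx).smul (hc x hx)
  · rw [isSmoothOn_iff hf.isOpen]
    exact fun x hx => ((hT₁₀ x hx).sub (hk β x hx (hβ x hx))).smul (hc x hx)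
  · rw [isSmoothOn_iff hf.isOpen]
    refine fun x hx => ((hT₀₀ x hx).add ((hα x hx).smul ?_)).smul (hc x hx)
    exact (contMDiffAt_mul contMDiffAt_const (hgs x hx)).add (hff x hx)
  · intro x hx
    have hfx : f x ≠ 0 := fun h => hx.2 ((hf.zero_iff x hx.1).mp h)
    have hfx' : starRingEnd ℂ (f x) ≠ 0 := by simpa using hfx
    have h1 := bilog_decomposition hfx hfx' (hN x hx.1) _ _ _ _ _ _ _ (hdec x hx.1 (η x))
    simp only [hT₁₀' x hx, hT₀₀' x hx, hα' x hx, hβ' x hx, map_add, map_smul, neg_smul, one_smul]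
    exact h1

/-- Locally bilogarithmic forms are tame. -/
theorem isTame_of_isBilogarithmic {μ : X → ℝ} {η : Form n X}
    (hμ : IsCanonicalMorseBott (n := n) D μ) (hη : HasFinitePole D μ η) (hclosed : IsClosed D)
    (hD : Dense Dᶜ)
    (hbil : ∀ x ∈ D, ∃ (U : Set X) (f : X → ℂ), x ∈ U ∧ IsLocalEquation (n := n) D U f ∧
      ∃ η₁₁ η₁₀ η₀₁ η₀₀ : Form n X, IsBilogarithmic D U f η η₁₁ η₁₀ η₀₁ η₀₀) :
    IsTame D 1 μ η := by
  have hμs : ContMDiff 𝓘(ℝ, Fin n → ℂ) 𝓘(ℝ, ℂ) ∞ (fun y => (μ y : ℂ)) :=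
    Complex.ofRealCLM.contDiff.contMDiff.comp hμ.smooth
  refine ⟨hη, extendsSmoothly_of_local hD isOpen_univ fun x _ => ?_,
    extendsSmoothly_of_local hD isOpen_univ fun x _ => ?_⟩
  -- Off `D` there is nothing to extend.
  all_goals by_cases hx : x ∈ D
  rotate_left
  · refine ⟨Dᶜ, _, hclosed.isOpen_compl, hx, fun z hz => ?_, fun z hz => rfl⟩
    exact (hη.smoothAt hμ hclosed hz).smul (by simpa using hμs.contMDiffAt)
  rotate_left
  · refine ⟨Dᶜ, _, hclosed.isOpen_compl, hx, fun z hz => ?_, fun z hz => rfl⟩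
    exact ((smoothAt_d isOpen_univ hμs.contMDiffOn (Set.mem_univ z)).mul
      (hη.smoothAt hμ hclosed hz)).smul (by simpa using contMDiffAt_const)
  all_goals
    obtain ⟨U, f, hxU, hf, η₁₁, η₁₀, η₀₁, η₀₀, h₁₁, h₁₀, h₀₁, h₀₀, heq⟩ := hbil x hx
    obtain ⟨h, hh, hhμ⟩ := hμ.conformal U f hf
    rw [isSmoothOn_iff hf.isOpen] at h₁₁ h₁₀ h₀₁ h₀₀
    have hhs : ContMDiffOn 𝓘(ℝ, Fin n → ℂ) 𝓘(ℝ, ℂ) ∞ (fun x => (h x : ℂ)) U :=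
      Complex.ofRealCLM.contDiff.contMDiff.comp_contMDiffOn hh
    have hps : ∀ x ∈ U, SmoothAt (d f : Form n X) x := fun x hx =>
      smoothAt_d hf.isOpen hf.contMDiffOn_real hx
    have hqs : ∀ x ∈ U, SmoothAt (d (fun y => starRingEnd ℂ (f y)) : Form n X) x := fun x hx =>
      smoothAt_d hf.isOpen hf.contMDiffOn_conj hx
    have hfs : ∀ x ∈ U, ContMDiffAt 𝓘(ℝ, Fin n → ℂ) 𝓘(ℝ, ℂ) ∞ f x := fun x hx =>
      hf.contMDiffOn_real.contMDiffAt (hf.isOpen.mem_nhds hx)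
    have hfs' : ∀ x ∈ U, ContMDiffAt 𝓘(ℝ, Fin n → ℂ) 𝓘(ℝ, ℂ) ∞
        (fun y => starRingEnd ℂ (f y)) x := fun x hx =>
      hf.contMDiffOn_conj.contMDiffAt (hf.isOpen.mem_nhds hx)
    have hhx : ∀ x ∈ U, ContMDiffAt 𝓘(ℝ, Fin n → ℂ) 𝓘(ℝ, ℂ) ∞ (fun x => (h x : ℂ)) x :=
      fun x hx => hhs.contMDiffAt (hf.isOpen.mem_nhds hx)
    have hE : ∀ x ∈ U \ D, (f x * starRingEnd ℂ (f x)) • η x =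
        (d f : Form n X) x * (d (fun y => starRingEnd ℂ (f y)) : Form n X) x * η₁₁ x
          + starRingEnd ℂ (f x) • ((d f : Form n X) x * η₁₀ x)
          + f x • ((d (fun y => starRingEnd ℂ (f y)) : Form n X) x * η₀₁ x)
          + (f x * starRingEnd ℂ (f x)) • η₀₀ x := by
      intro x hx
      have hfx : f x ≠ 0 := fun h => hx.2 ((hf.zero_iff x hx.1).mp h)
      rw [heq x hx, bilog_smul hfx (by simpa using hfx)]
    have hEs : ∀ x ∈ U, SmoothAt (fun x =>
        (d f : Form n X) x * (d (fun y => starRingEnd ℂ (f y)) : Form n X) x * η₁₁ x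
          + starRingEnd ℂ (f x) • ((d f : Form n X) x * η₁₀ x)
          + f x • ((d (fun y => starRingEnd ℂ (f y)) : Form n X) x * η₀₁ x)
          + (f x * starRingEnd ℂ (f x)) • η₀₀ x) x := fun x hx =>
      ((((hps x hx).mul (hqs x hx)).mul (h₁₁ x hx)).add
        (((hps x hx).mul (h₁₀ x hx)).smul (hfs' x hx))).add
        (((hqs x hx).mul (h₀₁ x hx)).smul (hfs x hx)) |>.add
        ((h₀₀ x hx).smul (contMDiffAt_mul (hfs x hx) (hfs' x hx)))
  · refine ⟨U, _, hf.isOpen, hxU, fun z hz => (hEs z hz).smul (hhx z hz), fun z hz => ?_⟩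
    simp only [pow_one]
    rw [← hE z hz, (hhμ z hz.1).2, RCLike.mul_conj, smul_smul]
    push_cast
    rfl
  · refine ⟨U, _, hf.isOpen, hxU, fun z hz => ((((((hps z hz).mul (hqs z hz)).mul (h₀₁ z hz)).add
      (((hqs z hz).mul (hps z hz)).mul (h₁₀ z hz))).add
      ((((hps z hz).smul (hfs' z hz)).add ((hqs z hz).smul (hfs z hz))).mul (h₀₀ z hz))).smul
        (hhx z hz)).add
      ((smoothAt_d hf.isOpen hhs hz).mul (hEs z hz)), fun z hz => ?_⟩
    have hfz : f z ≠ 0 := fun h => hz.2 ((hf.zero_iff z hz.1).mp h)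
    simp only [Nat.sub_self, pow_zero, one_smul]
    rw [d_conformal hf.isOpen hz.1 hh hf.contMDiffOn_real fun x hx => (hhμ x hx).2, ← hE z hz,
      add_mul _ _ (η z), smul_mul_assoc, smul_mul_assoc, mul_smul_comm]
    have h1 := bilog_mul (d_mul_self (n := n) (x := z) f)
      (d_mul_self (fun y => starRingEnd ℂ (f y))) (d_mul_d _ _) hfz
      (by simpa using hfz : starRingEnd ℂ (f z) ≠ 0) (η₁₁ z) (η₁₀ z) (η₀₁ z) (η₀₀ z)
    rw [← heq z hz] at h1
    rw [h1]

variable [T2Space X] [SigmaCompactSpace X]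

/-- Bilogarithmic expressions in charts are glued by a partition of unity, `f` being fixed. -/
theorem IsLocalEquation.exists_isBilogarithmic (hf : IsLocalEquation (n := n) D U f)
    (hD : Dense Dᶜ) {η α β : Form n X}
    (hα : ∀ x ∈ U, SmoothAt α x) (hβ : ∀ x ∈ U, SmoothAt β x)
    (hα' : ∀ x ∈ U \ D, α x = (f x * starRingEnd ℂ (f x)) • η x)
    (hβ' : ∀ x ∈ U \ D, β x = starRingEnd ℂ (f x) • ((d f : Form n X) x * η x) +
      f x • ((d (fun y => starRingEnd ℂ (f y)) : Form n X) x * η x)) :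
    ∃ η₁₁ η₁₀ η₀₁ η₀₀ : Form n X, IsBilogarithmic D U f η η₁₁ η₁₀ η₀₁ η₀₀ := by
  have hloc : ∀ c : X, ∃ η₁₁ η₁₀ η₀₁ η₀₀ : Form n X,
      IsBilogarithmic D (U ∩ (chartAt (Fin n → ℂ) c).source) f η η₁₁ η₁₀ η₀₁ η₀₀ := fun c =>
    (hf.mono (hf.isOpen.inter (chartAt (Fin n → ℂ) c).open_source)
      Set.inter_subset_left).exists_isBilogarithmic_of_chart hD
      (IsManifold.chart_mem_maximalAtlas c) Set.inter_subset_right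
      (fun x hx => hα x hx.1) (fun x hx => hβ x hx.1)
      (fun x hx => hα' x ⟨hx.1.1, hx.2⟩) (fun x hx => hβ' x ⟨hx.1.1, hx.2⟩)
  choose η₁₁ η₁₀ η₀₁ η₀₀ h using hloc
  have hsm : ∀ θ : X → Form n X,
      (∀ c, IsSmoothOn (θ c) (U ∩ (chartAt (Fin n → ℂ) c).source)) → IsSmoothOn (patch θ) U := by
    intro θ hθ
    rw [isSmoothOn_iff hf.isOpen]
    refine fun x hx => smoothAt_patch fun c hc => ?_
    exact (isSmoothOn_iff (hf.isOpen.inter (chartAt (Fin n → ℂ) c).open_source)).mp (hθ c) x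
      ⟨hx, hc⟩
  refine ⟨patch η₁₁, patch η₁₀, patch η₀₁, patch η₀₀, hsm _ fun c => (h c).smooth₁₁,
    hsm _ fun c => (h c).smooth₁₀, hsm _ fun c => (h c).smooth₀₁, hsm _ fun c => (h c).smooth₀₀,
    fun x hx => ?_⟩
  rw [mul_patch (fun x => ((f x)⁻¹ • (d f : Form n X) x) *
      ((starRingEnd ℂ (f x))⁻¹ • (d (fun y => starRingEnd ℂ (f y)) : Form n X) x)),
    mul_patch (fun x => (f x)⁻¹ • (d f : Form n X) x),
    mul_patch (fun x => (starRingEnd ℂ (f x))⁻¹ • (d (fun y => starRingEnd ℂ (f y)) : Form n X) x),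
    patch_add, patch_add, patch_add]
  exact (patch_eq_of_forall fun c hc => ((h c).eq x ⟨⟨hx.1, hc⟩, hx.2⟩).symm).symm

/-- Tame forms are bilogarithmic for every local equation. -/
theorem IsTame.exists_isBilogarithmic {μ : X → ℝ} {η : Form n X} (ht : IsTame D 1 μ η)
    (hμ : IsCanonicalMorseBott (n := n) D μ) (hD : Dense Dᶜ)
    (hf : IsLocalEquation (n := n) D U f) :
    ∃ η₁₁ η₁₀ η₀₁ η₀₀ : Form n X, IsBilogarithmic D U f η η₁₁ η₁₀ η₀₁ η₀₀ := by
  obtain ⟨h, hh, hhμ⟩ := hμ.conformal U f hf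
  obtain ⟨A, hA, hA'⟩ := ht.pow_smul
  obtain ⟨B, hB, hB'⟩ := ht.d_mul
  rw [isSmoothOn_iff isOpen_univ] at hA hB
  have hhs : ContMDiffOn 𝓘(ℝ, Fin n → ℂ) 𝓘(ℝ, ℂ) ∞ (fun x => (h x : ℂ)) U :=
    Complex.ofRealCLM.contDiff.contMDiff.comp_contMDiffOn hh
  have hinv : ∀ x ∈ U, ContMDiffAt 𝓘(ℝ, Fin n → ℂ) 𝓘(ℝ, ℂ) ∞ (fun x => (h x : ℂ)⁻¹) x := by
    intro x hx
    have h1 : ContDiffAt ℝ ∞ (fun w : ℂ => w⁻¹) (h x : ℂ) :=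
      contDiffAt_inv ℝ (Complex.ofReal_ne_zero.mpr (hhμ x hx).1.ne')
    exact h1.contMDiffAt.comp x (hhs.contMDiffAt (hf.isOpen.mem_nhds hx))
  have hαs : ∀ x ∈ U, SmoothAt (fun x => (h x : ℂ)⁻¹ • A x) x := fun x hx =>
    (hA x trivial).smul (hinv x hx)
  have hα : ∀ x ∈ U \ D, (h x : ℂ)⁻¹ • A x = (f x * starRingEnd ℂ (f x)) • η x := by
    intro x hx
    have h0 : (h x : ℂ) ≠ 0 := Complex.ofReal_ne_zero.mpr (hhμ x hx.1).1.ne'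
    have h1 : A x = (μ x : ℂ) • η x := by simpa using hA' x ⟨trivial, hx.2⟩
    rw [h1, (hhμ x hx.1).2, smul_smul, RCLike.mul_conj]
    push_cast
    rw [inv_mul_cancel_left₀ h0]
    rfl
  refine hf.exists_isBilogarithmic hD (α := fun x => (h x : ℂ)⁻¹ • A x)
    (β := fun x => (h x : ℂ)⁻¹ • (B x - (d (fun y => (h y : ℂ)) : Form n X) x *
      ((h x : ℂ)⁻¹ • A x))) hαs (fun x hx => ?_) hα fun x hx => ?_
  · exact ((hB x trivial).sub ((smoothAt_d hf.isOpen hhs hx).mul (hαs x hx))).smul (hinv x hx)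
  · have h0 : (h x : ℂ) ≠ 0 := Complex.ofReal_ne_zero.mpr (hhμ x hx.1).1.ne'
    have h1 : B x = (d (fun y => (μ y : ℂ)) : Form n X) x * η x := by
      simpa using hB' x ⟨trivial, hx.2⟩
    rw [hα x hx, h1,
      d_conformal hf.isOpen hx.1 hh hf.contMDiffOn_real fun x hx => (hhμ x hx).2, add_mul,
      mul_smul_comm, ← smul_mul_assoc (f x * _), add_sub_cancel_right, smul_mul_assoc, smul_smul,
      inv_mul_cancel₀ h0, one_smul, add_mul, smul_mul_assoc, smul_mul_assoc]

end Tame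


/-! ### Integration in a chart -/

section Integration

open MeasureTheory

variable {n : ℕ} {X : Type*} [TopologicalSpace X] [ChartedSpace (Fin n → ℂ) X]
  {η : Form n X} {K : Set X} {e e' : OpenPartialHomeomorph X (Fin n → ℂ)}

theorem inChart_eq_zero {y : Fin n → ℂ} (h : η (e.symm y) = 0) : inChart e η y = 0 := by
  have : η.val (e.symm y) = 0 := h
  rw [inChart_eq, this, map_zero]

/-- Transition maps, being holomorphic, transform the top coefficient by a nonnegative factor. -/
theorem topCoeff_inChart_change (he : e ∈ holoAtlas n X) (he' : e' ∈ holoAtlas n X) (η : Form n X)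
    {y : Fin n → ℂ} (hy : y ∈ e.target) (hy' : e.symm y ∈ e'.source) :
    topCoeff n (inChart e η y) = (|(fderiv ℝ (e' ∘ e.symm) y).det| : ℝ) *
      topCoeff n (inChart e' η (e' (e.symm y))) := by
  have h1 : fderiv ℝ (e' ∘ e.symm) y = (fderiv ℂ (e' ∘ e.symm) y).restrictScalars ℝ :=
    ((contDiffAt_transition he he' hy hy').differentiableAt (by simp)).fderiv_restrictScalars ℝ
  rw [inChart_change he he' η hy hy', topCoeff_map_transpose, abs_of_nonneg]
  rw [h1]
  exact det_restrictScalars_nonneg _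

variable [IsManifold 𝓘(ℂ, Fin n → ℂ) ω X] [T2Space X] [SigmaCompactSpace X]

theorem density_eq_zero_of_form {c : X} {y : Fin n → ℂ}
    (h : η ((chartAt (Fin n → ℂ) c).symm y) = 0) : density η c y = 0 := by
  rw [density, inChart_eq_zero h, map_zero, mul_zero]

theorem finite_chartPartition_inter (hK : IsCompact K) :
    {c : X | ∃ x ∈ K, chartPartition n X c x ≠ 0}.Finite := by
  refine ((chartPartition n X).locallyFinite.finite_nonempty_inter_compact hK).subset ?_
  rintro c ⟨x, hx, h⟩
  exact ⟨x, h, hx⟩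

theorem density_eq_zero_of_partition (hη : ∀ x, x ∉ K → η x = 0) {c : X}
    (hc : ¬ ∃ x ∈ K, chartPartition n X c x ≠ 0) (y : Fin n → ℂ) : density η c y = 0 := by
  by_cases h : (chartAt (Fin n → ℂ) c).symm y ∈ K
  · have : chartPartition n X c ((chartAt (Fin n → ℂ) c).symm y) = 0 := by
      by_contra h0
      exact hc ⟨_, h, h0⟩
    rw [density, this, Complex.ofReal_zero, zero_mul]
  · exact density_eq_zero_of_form (hη _ h)

theorem integral_eq_sum (hη : ∀ x, x ∉ K → η x = 0) {S : Finset X}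
    (hS : {c : X | ∃ x ∈ K, chartPartition n X c x ≠ 0} ⊆ S) :
    integral η = ∑ c ∈ S, ∫ y in (chartAt (Fin n → ℂ) c).target, density η c y := by
  refine finsum_eq_sum_of_support_subset _ fun c hc => hS ?_
  by_contra h
  exact hc (by simp only [density_eq_zero_of_partition hη h, integral_zero])

/-- The part of the integral coming from one term of the partition of unity, transported to a
chart whose domain contains the support. -/
theorem density_transport (he : e ∈ holoAtlas n X) (hKe : K ⊆ e.source)
    (hη : ∀ x, x ∉ K → η x = 0)
    (hint : IntegrableOn (fun y => topCoeff n (inChart e η y)) e.target) (c : X) :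
    IntegrableOn (density η c) (chartAt (Fin n → ℂ) c).target ∧
    IntegrableOn (fun y => (chartPartition n X c (e.symm y) : ℂ) * topCoeff n (inChart e η y))
      e.target ∧
    ∫ y in (chartAt (Fin n → ℂ) c).target, density η c y =
      ∫ y in e.target, (chartPartition n X c (e.symm y) : ℂ) * topCoeff n (inChart e η y) := by
  set e' := chartAt (Fin n → ℂ) c with he'def
  have he' : e' ∈ holoAtlas n X := IsManifold.chart_mem_maximalAtlas c
  set A := (e.symm ≫ₕ e').source with hA
  have hAo : IsOpen A := (e.symm ≫ₕ e').open_source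
  have hAe : A ⊆ e.target := fun y hy => hy.1
  have hAmem : ∀ y, y ∈ A ↔ y ∈ e.target ∧ e.symm y ∈ e'.source := fun y => Iff.rfl
  have hder : ∀ y ∈ A, HasFDerivWithinAt (e' ∘ e.symm) (fderiv ℝ (e' ∘ e.symm) y) A y :=
    fun y hy => ((contDiffAt_real_transition he he' hy.1 hy.2).differentiableAt
      (by simp)).hasFDerivAt.hasFDerivWithinAt
  have hinj : Set.InjOn (e' ∘ e.symm) A := (e.symm ≫ₕ e').injOn
  have hBe : (e' ∘ e.symm) '' A ⊆ e'.target := by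
    rintro _ ⟨y, hy, rfl⟩
    exact e'.map_source hy.2
  -- Outside the overlap `A` of the two charts both integrands vanish.
  have hoff : ∀ z ∈ e'.target \ ((e' ∘ e.symm) '' A), density η c z = 0 := by
    intro z hz
    refine density_eq_zero_of_form (hη _ fun hzK => hz.2 ⟨e (e'.symm z), ⟨?_, ?_⟩, ?_⟩)
    · exact e.map_source (hKe hzK)
    · change e.symm (e (e'.symm z)) ∈ e'.source
      rw [e.left_inv (hKe hzK)]
      exact e'.map_target hz.1
    · rw [Function.comp_apply, e.left_inv (hKe hzK), e'.right_inv hz.1]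
  have hoff' : ∀ y ∈ e.target \ A,
      (chartPartition n X c (e.symm y) : ℂ) * topCoeff n (inChart e η y) = 0 := by
    intro y hy
    have : chartPartition n X c (e.symm y) = 0 := by
      by_contra h0
      refine hy.2 ⟨hy.1, chartPartition_isSubordinate c (subset_tsupport _ ?_)⟩
      exact h0
    rw [this, Complex.ofReal_zero, zero_mul]
  have hpull : ∀ y ∈ A, |(fderiv ℝ (e' ∘ e.symm) y).det| • density η c ((e' ∘ e.symm) y) =
      (chartPartition n X c (e.symm y) : ℂ) * topCoeff n (inChart e η y) := by
    intro y hy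
    rw [topCoeff_inChart_change he he' η hy.1 hy.2, density, Function.comp_apply, ← he'def,
      e'.left_inv ((hAmem y).mp hy).2, Complex.real_smul]
    ring
  have hintA : IntegrableOn (fun y => (chartPartition n X c (e.symm y) : ℂ) *
      topCoeff n (inChart e η y)) A := by
    refine Integrable.bdd_mul (c := 1) (hint.mono_set hAe) ?_ (Filter.Eventually.of_forall ?_)
    · refine ContinuousOn.aestronglyMeasurable ?_ hAo.measurableSet
      exact Complex.continuous_ofReal.comp_continuousOn
        ((chartPartition n X c).contMDiff.continuous.comp_continuousOn
          (e.symm.continuousOn.mono hAe))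
    · intro y
      rw [Complex.norm_real, Real.norm_of_nonneg ((chartPartition n X).nonneg c _)]
      exact (chartPartition n X).le_one c _
  refine ⟨?_, hintA.of_forall_sdiff_eq_zero e.open_target.measurableSet hoff', ?_⟩
  · refine IntegrableOn.of_forall_sdiff_eq_zero (s := (e' ∘ e.symm) '' A) ?_
      e'.open_target.measurableSet hoff
    rw [integrableOn_image_iff_integrableOn_abs_det_fderiv_smul volume hAo.measurableSet hder hinj]
    exact hintA.congr_fun (fun y hy => (hpull y hy).symm) hAo.measurableSet
  · rw [setIntegral_eq_of_subset_of_forall_sdiff_eq_zero e'.open_target.measurableSet hBe hoff,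
      integral_image_eq_integral_abs_det_fderiv_smul volume hAo.measurableSet hder hinj,
      setIntegral_eq_of_subset_of_forall_sdiff_eq_zero e.open_target.measurableSet hAe hoff']
    exact setIntegral_congr_fun hAo.measurableSet hpull

/-- The integral of a form supported in the domain of a holomorphic chart may be computed in this
chart. -/
theorem integral_eq_setIntegral_chart (he : e ∈ holoAtlas n X) (hK : IsCompact K)
    (hKe : K ⊆ e.source) (hη : ∀ x, x ∉ K → η x = 0)
    (hint : IntegrableOn (fun y => topCoeff n (inChart e η y)) e.target) :
    IsIntegrable η ∧ integral η = ∫ y in e.target, topCoeff n (inChart e η y) := by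
  refine ⟨fun c => (density_transport he hKe hη hint c).1, ?_⟩
  set S := (finite_chartPartition_inter (n := n) hK).toFinset with hS
  rw [integral_eq_sum hη (S := S) (by rw [hS, Set.Finite.coe_toFinset]),
    Finset.sum_congr rfl fun c _ => (density_transport he hKe hη hint c).2.2,
    ← integral_finsetSum _ fun c _ => (density_transport he hKe hη hint c).2.1]
  refine setIntegral_congr_fun e.open_target.measurableSet fun y hy => ?_
  by_cases hyK : e.symm y ∈ K
  · have h1 : ∑ c ∈ S, (chartPartition n X c (e.symm y) : ℂ) = 1 := by
      rw [← Complex.ofReal_sum, (chartPartition n X).sum_finsupport' _ (Set.mem_univ _),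
        Complex.ofReal_one]
      intro c hc
      rw [hS, Set.Finite.mem_toFinset]
      exact ⟨_, hyK, ((chartPartition n X).mem_finsupport _).mp hc⟩
    rw [← Finset.sum_mul, h1, one_mul]
  · simp only [inChart_eq_zero (hη _ hyK), map_zero, mul_zero, Finset.sum_const_zero]

theorem density_sum {κ : Type*} (s : Finset κ) (θ : κ → Form n X) (c : X) :
    density (fun x => ∑ k ∈ s, θ k x) c = fun y => ∑ k ∈ s, density (θ k) c y := by
  funext y
  have : inChart (chartAt (Fin n → ℂ) c) (fun x => ∑ k ∈ s, θ k x) y =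
    ∑ k ∈ s, inChart (chartAt (Fin n → ℂ) c) (θ k) y := map_sum _ _ _
  simp only [density, this, map_sum, Finset.mul_sum]

theorem integral_sum {κ : Type*} {s : Finset κ} {θ : κ → Form n X}
    (hsupp : ∀ k ∈ s, IsCompactlySupported (θ k)) (hint : ∀ k ∈ s, IsIntegrable (θ k)) :
    IsIntegrable (fun x => ∑ k ∈ s, θ k x) ∧
      integral (fun x => ∑ k ∈ s, θ k x) = ∑ k ∈ s, integral (θ k) := by
  constructor
  · intro c
    rw [density_sum]
    exact integrable_finsetSum _ fun k hk => hint k hk c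
  · simp only [integral, density_sum]
    rw [← finsum_sum_comm]
    · exact finsum_congr fun c => integral_finsetSum _ fun k hk => hint k hk c
    · intro k hk
      obtain ⟨K, hK, hη⟩ := hsupp k hk
      refine (finite_chartPartition_inter (n := n) hK).subset fun c hc => ?_
      by_contra h
      exact hc (by simp only [density_eq_zero_of_partition hη h, integral_zero])

end Integration


/-! ### The zeta integral in a product chart -/

section ZetaIntegral

open MeasureTheory

/-- Integrals of a locally uniformly dominated holomorphic family are holomorphic. -/
theorem differentiableOn_integral_of_dominated {α : Type*} [MeasurableSpace α] {ν : Measure α}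
    {V : Set ℂ} (hV : IsOpen V) {H : ℂ → α → ℂ} (hm : ∀ s ∈ V, AEStronglyMeasurable (H s) ν)
    (hd : ∀ a, DifferentiableOn ℂ (fun s => H s a) V)
    (hb : ∀ s₀ ∈ V, ∃ b : α → ℝ, Integrable b ν ∧ ∀ᶠ s in 𝓝 s₀, ∀ a, ‖H s a‖ ≤ b a) :
    DifferentiableOn ℂ (fun s => ∫ a, H s a ∂ν) V := by
  intro s₀ hs₀
  obtain ⟨b, hbint, hbb⟩ := hb s₀ hs₀
  obtain ⟨ε, hε, hball⟩ := Metric.eventually_nhds_iff_ball.mp (hbb.and (hV.mem_nhds hs₀))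
  have hda : ∀ a, ∀ s ∈ Metric.ball s₀ ε, DifferentiableAt ℂ (fun s => H s a) s := fun a s hs =>
    (hd a).differentiableAt (hV.mem_nhds (hball s hs).2)
  have hderiv := hasDerivAt_integral_of_dominated_loc_of_deriv_le (μ := ν) (F := H)
    (F' := fun s a => deriv (fun s => H s a) s) (x₀ := s₀) (s := Metric.ball s₀ (ε / 2))
    (bound := fun a => b a / (ε / 4)) (Metric.ball_mem_nhds s₀ (by positivity)) ?_ ?_ ?_ ?_ ?_ ?_
  · exact hderiv.2.differentiableAt.differentiableWithinAt
  · filter_upwards [hV.mem_nhds hs₀] with s hs using hm s hs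
  · exact hbint.mono' (hm s₀ hs₀)
      (Filter.Eventually.of_forall (hball s₀ (Metric.mem_ball_self hε)).1)
  · -- The derivative is a limit of difference quotients along a sequence.
    have hlim : Filter.Tendsto (fun k : ℕ => s₀ + ((k : ℂ) + 1)⁻¹) Filter.atTop (𝓝[≠] s₀) := by
      rw [tendsto_nhdsWithin_iff]
      constructor
      · have h1 : Filter.Tendsto (fun k : ℕ => ((k : ℂ) + 1)⁻¹) Filter.atTop (𝓝 0) := by
          have := tendsto_one_div_add_atTop_nhds_zero_nat (𝕜 := ℂ)
          simpa using this
        simpa using h1.const_add s₀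
      · refine Filter.Eventually.of_forall fun k => ?_
        simp only [Set.mem_compl_iff, Set.mem_singleton_iff, add_eq_left, inv_eq_zero]
        exact Nat.cast_add_one_ne_zero k
    have hmem : ∀ᶠ k : ℕ in Filter.atTop, s₀ + ((k : ℂ) + 1)⁻¹ ∈ V :=
      (hlim.mono_right nhdsWithin_le_nhds).eventually (hV.mem_nhds hs₀)
    obtain ⟨k₀, hk₀⟩ := Filter.eventually_atTop.mp hmem
    have hlim' := hlim.comp (Filter.tendsto_add_atTop_nat k₀)
    refine aestronglyMeasurable_of_tendsto_ae Filter.atTop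
      (f := fun k a => slope (fun s => H s a) s₀ (s₀ + (((k + k₀ : ℕ) : ℂ) + 1)⁻¹)) (fun k => ?_)
      (Filter.Eventually.of_forall fun a => ?_)
    · simp only [slope_def_field, div_eq_mul_inv]
      exact ((hm _ (hk₀ _ (Nat.le_add_left _ _))).sub (hm s₀ hs₀)).mul_const _
    · exact (hasDerivAt_iff_tendsto_slope.mp
        (hda a s₀ (Metric.mem_ball_self hε)).hasDerivAt).comp hlim'
  · refine Filter.Eventually.of_forall fun a s hs => ?_
    have hsub : Metric.closedBall s (ε / 4) ⊆ Metric.ball s₀ ε := by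
      intro t ht
      rw [Metric.mem_closedBall] at ht
      rw [Metric.mem_ball] at hs ⊢
      linarith [dist_triangle t s s₀]
    refine Complex.norm_deriv_le_of_forall_mem_sphere_norm_le (by positivity) ?_ fun t ht =>
      (hball t (hsub (Metric.sphere_subset_closedBall ht))).1 a
    refine DifferentiableOn.diffContOnCl fun t ht => ?_
    exact (hda a t (hsub (Metric.closure_ball_subset_closedBall ht))).differentiableWithinAt
  · exact hbint.div_const _
  · refine Filter.Eventually.of_forall fun a s hs => (hda a s ?_).hasDerivAt
    exact Metric.ball_subset_ball (by linarith) hs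

/-- The function `|z| ^ (s - 2)` on `ℂ`, with the value `0` at the origin for every `s`. -/
def normPow (s : ℂ) (z : ℂ) : ℂ := if z = 0 then 0 else (‖z‖ : ℂ) ^ (s - 2)

theorem normPow_eq {s : ℂ} (hs : s ≠ 2) (z : ℂ) : normPow s z = (‖z‖ : ℂ) ^ (s - 2) := by
  rw [normPow]
  split_ifs with h
  · rw [h, norm_zero, Complex.ofReal_zero, Complex.zero_cpow (sub_ne_zero.mpr hs)]
  · rfl

theorem norm_normPow_le (s : ℂ) (z : ℂ) : ‖normPow s z‖ ≤ ‖z‖ ^ (s.re - 2) := by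
  rw [normPow]
  split_ifs with h
  · rw [norm_zero]; positivity
  · rw [Complex.norm_cpow_eq_rpow_re_of_pos (norm_pos_iff.mpr h)]
    simp

theorem measurable_normPow (s : ℂ) : Measurable (normPow s) := by
  unfold normPow
  refine Measurable.ite (measurableSet_singleton 0) measurable_const ?_
  exact (Complex.measurable_ofReal.comp measurable_norm).pow_const _

theorem differentiable_normPow (z : ℂ) : Differentiable ℂ (fun s => normPow s z) := by
  unfold normPow
  split_ifs with h
  · exact differentiable_const _
  · have h0 : (‖z‖ : ℂ) ≠ 0 := by simpa using h
    intro s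
    exact (differentiableAt_id.sub_const 2).const_cpow (Or.inl h0)

/-- `|z| ^ a` is integrable on discs for `a > -2`. -/
theorem integrableOn_norm_rpow {a : ℝ} (ha : -2 < a) (R : ℝ) :
    IntegrableOn (fun z : ℂ => ‖z‖ ^ a) (Metric.closedBall 0 R) := by
  rw [← integrable_indicator_iff Metric.isClosed_closedBall.measurableSet]
  have h : (Metric.closedBall (0 : ℂ) R).indicator (fun z : ℂ => ‖z‖ ^ a) =
      fun z => (Set.Iic R).indicator (fun r : ℝ => r ^ a) ‖z‖ := by
    funext z
    simp [Set.indicator]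
  rw [h, integrable_fun_norm_addHaar, Complex.finrank_real_complex]
  have h2 : IntegrableOn (fun r : ℝ => r ^ (a + 1)) (Set.Ioc 0 R) := by
    by_cases hR : 0 ≤ R
    · rw [← intervalIntegrable_iff_integrableOn_Ioc_of_le hR]
      exact intervalIntegral.intervalIntegrable_rpow' (by linarith)
    · rw [Set.Ioc_eq_empty (fun h => hR h.le)]
      exact integrableOn_empty
  refine (h2.integrable_indicator measurableSet_Ioc).integrableOn.congr_fun (fun r hr => ?_)
    measurableSet_Ioi
  have hr0 : (0 : ℝ) < r := hr
  by_cases hrR : r ≤ R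
  · rw [Set.indicator_of_mem (show r ∈ Set.Ioc 0 R from ⟨hr0, hrR⟩),
      Set.indicator_of_mem (show r ∈ Set.Iic R from hrR), Real.rpow_add_one hr0.ne']
    simp [mul_comm]
  · rw [Set.indicator_of_notMem (fun h => hrR h.2),
      Set.indicator_of_notMem (show r ∉ Set.Iic R from hrR), smul_zero]

theorem integral_normPow {s : ℂ} (hs : 0 < s.re) {R : ℝ} (hR : 0 < R) :
    ∫ z in Metric.closedBall (0 : ℂ) R, normPow s z = 2 * Real.pi * (R : ℂ) ^ s / s := by
  have hs0 : s ≠ 0 := fun h => by simp [h] at hs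
  rw [← MeasureTheory.integral_indicator Metric.isClosed_closedBall.measurableSet]
  have h : (Metric.closedBall (0 : ℂ) R).indicator (normPow s) =
      fun z => (Set.Iic R).indicator
        (fun r : ℝ => if r = 0 then 0 else (r : ℂ) ^ (s - 2)) ‖z‖ := by
    funext z
    simp [Set.indicator, normPow]
  rw [h, integral_fun_norm_addHaar, Complex.finrank_real_complex]
  have hball : (volume : Measure ℂ).real (Metric.ball 0 1) = Real.pi := by
    rw [Measure.real, Complex.volume_ball]
    simp
  have h2 : ∫ r in Set.Ioi (0 : ℝ), r ^ (2 - 1) • (Set.Iic R).indicator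
      (fun r : ℝ => if r = 0 then 0 else (r : ℂ) ^ (s - 2)) r = (R : ℂ) ^ s / s := by
    have h3 : ∫ r in (0 : ℝ)..R, (r : ℂ) ^ (s - 1) = (R : ℂ) ^ s / s := by
      rw [integral_cpow (Or.inl (by simpa using hs))]
      simp [Complex.zero_cpow hs0]
    rw [← h3, intervalIntegral.integral_of_le hR.le,
      ← MeasureTheory.integral_indicator measurableSet_Ioi,
      ← MeasureTheory.integral_indicator measurableSet_Ioc]
    congr 1
    funext r
    by_cases hr : 0 < r
    · by_cases hrR : r ≤ R
      · rw [Set.indicator_of_mem (show r ∈ Set.Ioi (0 : ℝ) from hr),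
          Set.indicator_of_mem (show r ∈ Set.Iic R from hrR),
          Set.indicator_of_mem (show r ∈ Set.Ioc 0 R from ⟨hr, hrR⟩), if_neg hr.ne']
        have h5 : (r : ℂ) ≠ 0 := Complex.ofReal_ne_zero.mpr hr.ne'
        rw [show s - 1 = (s - 2) + 1 by ring, Complex.cpow_add _ _ h5, Complex.cpow_one,
          Complex.real_smul]
        push_cast
        ring
      · rw [Set.indicator_of_mem (show r ∈ Set.Ioi (0 : ℝ) from hr),
          Set.indicator_of_notMem (show r ∉ Set.Iic R from hrR),
          Set.indicator_of_notMem (fun h => hrR h.2), smul_zero]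
    · rw [Set.indicator_of_notMem (show r ∉ Set.Ioi (0 : ℝ) from hr),
        Set.indicator_of_notMem (fun h => hr h.1)]
  rw [h2, hball, Complex.real_smul, nsmul_eq_mul]
  push_cast
  ring

end ZetaIntegral


section Continuation

open MeasureTheory

theorem norm_exp_sub_exp_le {T : ℝ} {a b : ℂ} (ha : ‖a‖ ≤ T) (hb : ‖b‖ ≤ T) :
    ‖Complex.exp a - Complex.exp b‖ ≤ Real.exp T * ‖a - b‖ := by
  refine Convex.norm_image_sub_le_of_norm_deriv_le (s := Metric.closedBall (0 : ℂ) T)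
    (fun x _ => Complex.differentiable_exp x) (fun x hx => ?_) (convex_closedBall 0 T)
    (by simpa using hb) (by simpa using ha)
  rw [Complex.deriv_exp]
  exact (Complex.norm_exp_le_exp_norm x).trans (Real.exp_le_exp.mpr (by simpa using hx))

theorem rpow_le_rpow_add_rpow {r σ σ₀ σ₁ : ℝ} (hr : 0 < r) (h₀ : σ₀ ≤ σ) (h₁ : σ ≤ σ₁) :
    r ^ σ ≤ r ^ σ₀ + r ^ σ₁ := by
  have p0 : 0 ≤ r ^ σ₀ := by positivity
  have p1 : 0 ≤ r ^ σ₁ := by positivity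
  rcases le_total r 1 with h | h
  · linarith [Real.rpow_le_rpow_of_exponent_ge hr h h₀]
  · linarith [Real.rpow_le_rpow_of_exponent_le h h₁]

/-- The holomorphic family `e ^ (s k) Ψ`. -/
def twist {P : Type*} (k : P → ℝ) (Ψ : P → ℂ) (s : ℂ) (p : P) : ℂ :=
  Complex.exp (s * k p) * Ψ p

theorem differentiable_twist {P : Type*} (k : P → ℝ) (Ψ : P → ℂ) (p : P) :
    Differentiable ℂ (fun s => twist k Ψ s p) := by
  unfold twist
  fun_prop

theorem norm_twist_le {P : Type*} {k : P → ℝ} {Ψ : P → ℂ} {S M C : ℝ} (hM : ∀ p, |k p| ≤ M)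
    (hC : ∀ p, ‖Ψ p‖ ≤ C) {s : ℂ} (hs : ‖s‖ ≤ S) (p : P) :
    ‖twist k Ψ s p‖ ≤ Real.exp (S * M) * C := by
  rw [twist, norm_mul]
  refine mul_le_mul ((Complex.norm_exp_le_exp_norm _).trans (Real.exp_le_exp.mpr ?_)) (hC p)
    (norm_nonneg _) (Real.exp_pos _).le
  rw [norm_mul, Complex.norm_real, Real.norm_eq_abs]
  exact mul_le_mul hs (hM p) (abs_nonneg _) ((norm_nonneg s).trans hs)

theorem norm_twist_sub_le {P : Type*} {k : P → ℝ} {Ψ : P → ℂ} {S M C L L' δ : ℝ}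
    (hM : ∀ p, |k p| ≤ M) (hC : ∀ p, ‖Ψ p‖ ≤ C) {s : ℂ} (hs : ‖s‖ ≤ S) {p p' : P}
    (hk : |k p - k p'| ≤ L * δ) (hΨ : ‖Ψ p - Ψ p'‖ ≤ L' * δ) :
    ‖twist k Ψ s p - twist k Ψ s p'‖ ≤ Real.exp (S * M) * (L' + S * L * C) * δ := by
  have hS : 0 ≤ S := (norm_nonneg s).trans hs
  have hexp : ∀ q, ‖s * k q‖ ≤ S * M := fun q => by
    rw [norm_mul, Complex.norm_real, Real.norm_eq_abs]
    exact mul_le_mul hs (hM q) (abs_nonneg _) hS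
  have h1 : twist k Ψ s p - twist k Ψ s p' = Complex.exp (s * k p) * (Ψ p - Ψ p') +
      (Complex.exp (s * k p) - Complex.exp (s * k p')) * Ψ p' := by
    rw [twist, twist]; ring
  have h2 : ‖Complex.exp (s * k p)‖ ≤ Real.exp (S * M) :=
    (Complex.norm_exp_le_exp_norm _).trans (Real.exp_le_exp.mpr (hexp p))
  have h3 : ‖Complex.exp (s * k p) - Complex.exp (s * k p')‖ ≤
      Real.exp (S * M) * (S * (L * δ)) := by
    refine (norm_exp_sub_exp_le (hexp p) (hexp p')).trans ?_
    refine mul_le_mul_of_nonneg_left ?_ (Real.exp_pos _).le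
    rw [← mul_sub, norm_mul, ← Complex.ofReal_sub, Complex.norm_real, Real.norm_eq_abs]
    exact mul_le_mul hs hk (abs_nonneg _) hS
  have hLδ : 0 ≤ L * δ := (abs_nonneg _).trans hk
  rw [h1]
  refine (norm_add_le _ _).trans ?_
  rw [norm_mul, norm_mul]
  have h4 := mul_le_mul h2 hΨ (norm_nonneg _) (Real.exp_pos (S * M)).le
  have h5 := mul_le_mul h3 (hC p') (norm_nonneg _) (by positivity)
  calc _ ≤ _ := add_le_add h4 h5
    _ = _ := by ring

variable {n : ℕ} {k : ℂ × (Fin n → ℂ) → ℝ} {Ψ : ℂ × (Fin n → ℂ) → ℂ}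

/-- The integrand of the zeta integral, after subtraction of its restriction to the hyperplane
(cut off to the disc of radius `R`). -/
def zetaRemainder (k : ℂ × (Fin n → ℂ) → ℝ) (Ψ : ℂ × (Fin n → ℂ) → ℂ) (R : ℝ) (s : ℂ)
    (p : ℂ × (Fin n → ℂ)) : ℂ :=
  normPow s p.1 * (twist k Ψ s p - if ‖p.1‖ ≤ R then twist k Ψ s (0, p.2) else 0)

/-- Meromorphic continuation of `∫ |z| ^ (s - 2) e ^ (s k) Ψ` to `Re s > -1`, with the residue
`2 π ∫ Ψ(0, w) dw` at `0`. -/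
theorem exists_zeta_continuation (hΨ : ContDiff ℝ 1 Ψ) (hΨc : HasCompactSupport Ψ)
    (hk : ContDiff ℝ 1 k) (hkc : HasCompactSupport k) :
    ∃ B : ℂ → ℂ, DifferentiableOn ℂ B {s | -1 < s.re} ∧
      B 0 = 2 * Real.pi * ∫ w, Ψ (0, w) ∧
      ∀ s : ℂ, 2 < s.re →
        Integrable (fun p : ℂ × (Fin n → ℂ) => (‖p.1‖ : ℂ) ^ (s - 2) * twist k Ψ s p) ∧
        s⁻¹ * B s = ∫ p : ℂ × (Fin n → ℂ), (‖p.1‖ : ℂ) ^ (s - 2) * twist k Ψ s p := by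
  obtain ⟨M, hM⟩ := hkc.exists_bound_of_continuous hk.continuous
  obtain ⟨C, hC⟩ := hΨc.exists_bound_of_continuous hΨ.continuous
  simp only [Real.norm_eq_abs] at hM
  obtain ⟨L, hL⟩ := hk.lipschitzWith_of_hasCompactSupport hkc one_ne_zero
  obtain ⟨L', hL'⟩ := hΨ.lipschitzWith_of_hasCompactSupport hΨc one_ne_zero
  have hC0 : 0 ≤ C := (norm_nonneg _).trans (hC 0)
  obtain ⟨R, hR, hRΨ⟩ : ∃ R : ℝ, 0 < R ∧ ∀ p, R < ‖p‖ → Ψ p = 0 := by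
    obtain ⟨R, hR⟩ := (hΨc.isCompact.isBounded).subset_closedBall 0
    refine ⟨max R 1, by positivity, fun p hp => ?_⟩
    by_contra h
    have := hR (subset_tsupport _ h)
    rw [mem_closedBall_zero_iff] at this
    exact absurd (this.trans (le_max_left R 1)) (not_le.mpr hp)
  have hnorm1 : ∀ p : ℂ × (Fin n → ℂ), ‖p.1‖ ≤ ‖p‖ := norm_fst_le
  have hnorm2 : ∀ p : ℂ × (Fin n → ℂ), ‖p.2‖ ≤ ‖p‖ := norm_snd_le
  have htw1 : ∀ s, ∀ p : ℂ × (Fin n → ℂ), R < ‖p‖ → twist k Ψ s p = 0 := fun s p hp => by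
    rw [twist, hRΨ p hp, mul_zero]
  have htw2 : ∀ s, ∀ w : Fin n → ℂ, R < ‖w‖ → twist k Ψ s (0, w) = 0 := fun s w hw =>
    htw1 s (0, w) (hw.trans_le (hnorm2 (0, w)))
  have htwc : ∀ s, Continuous (twist k Ψ s) := fun s => by
    have h1 := hk.continuous
    have h2 := hΨ.continuous
    unfold twist
    fun_prop
  have htwc0 : ∀ s, Continuous (fun w : Fin n → ℂ => twist k Ψ s (0, w)) := fun s =>
    (htwc s).comp (by fun_prop)
  have hHmeas : ∀ s, AEStronglyMeasurable (zetaRemainder k Ψ R s) volume := by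
    intro s
    refine Measurable.aestronglyMeasurable ?_
    unfold zetaRemainder
    refine ((measurable_normPow s).comp measurable_fst).mul ((htwc s).measurable.sub ?_)
    refine Measurable.ite ?_ ((htwc0 s).measurable.comp measurable_snd) measurable_const
    exact measurableSet_le (measurable_norm.comp measurable_fst) measurable_const
  have hindB : Integrable ((Metric.closedBall (0 : Fin n → ℂ) R).indicator fun _ => (1 : ℝ)) := by
    rw [integrable_indicator_iff Metric.isClosed_closedBall.measurableSet]
    exact integrableOn_const (isCompact_closedBall _ _).measure_lt_top.ne
  -- As `twist` is Lipschitz, the remainder is `O(|z| ^ (Re s - 1))`: integrable for `Re s > -1`.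
  have hHbound : ∀ s₀ : ℂ, -1 < s₀.re → ∃ b : ℂ × (Fin n → ℂ) → ℝ, Integrable b ∧
      ∀ᶠ s in 𝓝 s₀, ∀ p, ‖zetaRemainder k Ψ R s p‖ ≤ b p := by
    intro s₀ hs₀
    set σ₀ := (s₀.re - 1) / 2 with hσ₀
    set σ₁ := s₀.re + 1 with hσ₁
    set S := ‖s₀‖ + 1 with hS
    set K := Real.exp (S * M) * (L' + S * L * C) with hK
    have hS0 : 0 ≤ S := by positivity
    have hK0 : 0 ≤ K := by positivity
    refine ⟨fun p => (Metric.closedBall (0 : ℂ) R).indicator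
        (fun z => K * (‖z‖ ^ (σ₀ - 1) + ‖z‖ ^ (σ₁ - 1))) p.1 *
        (Metric.closedBall (0 : Fin n → ℂ) R).indicator (fun _ => (1 : ℝ)) p.2, ?_, ?_⟩
    · refine Integrable.mul_prod ?_ hindB
      rw [integrable_indicator_iff Metric.isClosed_closedBall.measurableSet]
      refine Integrable.const_mul ?_ K
      exact (integrableOn_norm_rpow (by rw [hσ₀]; linarith) R).add
        (integrableOn_norm_rpow (by rw [hσ₁]; linarith) R)
    · have e1 : ∀ᶠ s : ℂ in 𝓝 s₀, σ₀ < s.re :=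
        Complex.continuous_re.continuousAt.eventually_const_lt (by rw [hσ₀]; linarith)
      have e2 : ∀ᶠ s : ℂ in 𝓝 s₀, s.re < σ₁ :=
        Complex.continuous_re.continuousAt.eventually_lt_const (by rw [hσ₁]; linarith)
      have e3 : ∀ᶠ s : ℂ in 𝓝 s₀, ‖s‖ < S :=
        continuous_norm.continuousAt.eventually_lt_const (by rw [hS]; linarith)
      filter_upwards [e1, e2, e3] with s h1 h2 h3 p
      by_cases hp1 : ‖p.1‖ ≤ R
      swap
      · have h4 : twist k Ψ s p = 0 := htw1 s p ((not_le.mp hp1).trans_le (hnorm1 p))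
        rw [zetaRemainder, if_neg hp1, h4, sub_zero, mul_zero, norm_zero]
        refine mul_nonneg (Set.indicator_nonneg (fun z _ => ?_) _)
          (Set.indicator_nonneg (fun _ _ => zero_le_one) _)
        positivity
      by_cases hp2 : ‖p.2‖ ≤ R
      swap
      · have h4 : twist k Ψ s p = 0 := htw1 s p ((not_le.mp hp2).trans_le (hnorm2 p))
        rw [zetaRemainder, if_pos hp1, h4, htw2 s p.2 (not_le.mp hp2), sub_zero, mul_zero,
          norm_zero]
        refine mul_nonneg (Set.indicator_nonneg (fun z _ => ?_) _)
          (Set.indicator_nonneg (fun _ _ => zero_le_one) _)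
        positivity
      rw [Set.indicator_of_mem (by simpa using hp1), Set.indicator_of_mem (by simpa using hp2),
        mul_one, zetaRemainder, if_pos hp1]
      by_cases hp0 : p.1 = 0
      · rw [normPow, if_pos hp0, zero_mul, norm_zero]
        positivity
      have hpos : 0 < ‖p.1‖ := norm_pos_iff.mpr hp0
      have hdist : ‖p - (0, p.2)‖ = ‖p.1‖ := by
        rw [Prod.norm_def]
        simp
      have hkp : |k p - k (0, p.2)| ≤ L * ‖p.1‖ := by
        rw [← hdist, ← Real.norm_eq_abs]
        exact hL.norm_sub_le _ _
      have hΨp : ‖Ψ p - Ψ (0, p.2)‖ ≤ L' * ‖p.1‖ := by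
        rw [← hdist]
        exact hL'.norm_sub_le _ _
      have h5 := norm_twist_sub_le hM hC h3.le hkp hΨp
      rw [norm_mul]
      calc _ ≤ ‖p.1‖ ^ (s.re - 2) * (K * ‖p.1‖) :=
            mul_le_mul (norm_normPow_le s p.1) h5 (norm_nonneg _) (by positivity)
        _ = K * ‖p.1‖ ^ (s.re - 1) := by
            rw [show s.re - 1 = (s.re - 2) + 1 by ring, Real.rpow_add_one hpos.ne']
            ring
        _ ≤ _ := mul_le_mul_of_nonneg_left
            (rpow_le_rpow_add_rpow hpos (by linarith) (by linarith)) hK0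
  have hHdiff : ∀ p, Differentiable ℂ (fun s => zetaRemainder k Ψ R s p) := by
    intro p
    unfold zetaRemainder
    refine (differentiable_normPow p.1).mul ((differentiable_twist k Ψ p).sub ?_)
    split_ifs
    · exact differentiable_twist k Ψ _
    · exact differentiable_const _
  have hVo : IsOpen {s : ℂ | -1 < s.re} := isOpen_lt continuous_const Complex.continuous_re
  have hG : DifferentiableOn ℂ (fun s => ∫ p, zetaRemainder k Ψ R s p) {s : ℂ | -1 < s.re} :=
    differentiableOn_integral_of_dominated hVo (fun s _ => hHmeas s)
      (fun p => (hHdiff p).differentiableOn) fun s hs => hHbound s hs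
  have hJint : ∀ s, Integrable (fun w : Fin n → ℂ => twist k Ψ s (0, w)) := fun s =>
    (htwc0 s).integrable_of_hasCompactSupport (HasCompactSupport.intro
      (isCompact_closedBall (0 : Fin n → ℂ) R) fun w hw => htw2 s w (by simpa using hw))
  have hJ : DifferentiableOn ℂ (fun s => ∫ w : Fin n → ℂ, twist k Ψ s (0, w)) Set.univ := by
    refine differentiableOn_integral_of_dominated isOpen_univ
      (fun s _ => (htwc0 s).aestronglyMeasurable)
      (fun w => (differentiable_twist k Ψ (0, w)).differentiableOn) fun s₀ _ => ?_
    refine ⟨fun w => (Real.exp ((‖s₀‖ + 1) * M) * C) *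
      (Metric.closedBall (0 : Fin n → ℂ) R).indicator (fun _ => (1 : ℝ)) w,
      hindB.const_mul _, ?_⟩
    have e3 : ∀ᶠ s : ℂ in 𝓝 s₀, ‖s‖ < ‖s₀‖ + 1 :=
      continuous_norm.continuousAt.eventually_lt_const (by linarith)
    filter_upwards [e3] with s hs w
    by_cases hw : ‖w‖ ≤ R
    · rw [Set.indicator_of_mem (by simpa using hw), mul_one]
      exact norm_twist_le hM hC hs.le _
    · rw [htw2 s w (not_le.mp hw), norm_zero]
      exact mul_nonneg (by positivity) (Set.indicator_nonneg (fun _ _ => zero_le_one) _)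
  -- The subtracted term contributes the explicit integral of `|z| ^ (s - 2)` over the disc.
  refine ⟨fun s => s * (∫ p, zetaRemainder k Ψ R s p) +
    2 * Real.pi * (R : ℂ) ^ s * ∫ w : Fin n → ℂ, twist k Ψ s (0, w), ?_, ?_, ?_⟩
  · refine (differentiableOn_id.mul hG).add (DifferentiableOn.mul ?_ (hJ.mono (Set.subset_univ _)))
    refine DifferentiableOn.const_mul (fun s _ => ?_) _
    exact (differentiableAt_id.const_cpow
      (Or.inl (Complex.ofReal_ne_zero.mpr hR.ne'))).differentiableWithinAt
  · simp [twist]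
  · intro s hs
    have hs2 : s ≠ 2 := fun h => by simp [h] at hs
    have hs0 : s ≠ 0 := fun h => by simp [h] at hs; linarith
    have hHint : Integrable (zetaRemainder k Ψ R s) := by
      obtain ⟨b, hb, hbb⟩ := hHbound s (by linarith)
      exact hb.mono' (hHmeas s) (Filter.Eventually.of_forall hbb.self_of_nhds)
    have hpw : Integrable ((Metric.closedBall (0 : ℂ) R).indicator (normPow s)) := by
      rw [integrable_indicator_iff Metric.isClosed_closedBall.measurableSet]
      exact (integrableOn_norm_rpow (a := s.re - 2) (by linarith) R).mono'
        (measurable_normPow s).aestronglyMeasurable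
        (Filter.Eventually.of_forall (norm_normPow_le s))
    have hsplit : (fun p : ℂ × (Fin n → ℂ) => (‖p.1‖ : ℂ) ^ (s - 2) * twist k Ψ s p) =
        fun p => zetaRemainder k Ψ R s p +
          (Metric.closedBall (0 : ℂ) R).indicator (normPow s) p.1 * twist k Ψ s (0, p.2) := by
      funext p
      rw [← normPow_eq hs2, zetaRemainder]
      by_cases hp1 : ‖p.1‖ ≤ R
      · rw [if_pos hp1, Set.indicator_of_mem (by simpa using hp1)]
        ring
      · rw [if_neg hp1, Set.indicator_of_notMem (by simpa using hp1)]
        ring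
    have hprod : Integrable (fun p : ℂ × (Fin n → ℂ) =>
        (Metric.closedBall (0 : ℂ) R).indicator (normPow s) p.1 * twist k Ψ s (0, p.2)) :=
      hpw.mul_prod (hJint s)
    rw [hsplit]
    refine ⟨hHint.add hprod, ?_⟩
    rw [integral_add hHint hprod]
    have h6 : ∫ p : ℂ × (Fin n → ℂ), (Metric.closedBall (0 : ℂ) R).indicator (normPow s) p.1 *
        twist k Ψ s (0, p.2) = 2 * Real.pi * (R : ℂ) ^ s / s *
          ∫ w : Fin n → ℂ, twist k Ψ s (0, w) := by
      rw [← integral_normPow (by linarith : 0 < s.re) hR,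
        ← MeasureTheory.integral_indicator Metric.isClosed_closedBall.measurableSet]
      exact integral_prod_mul ((Metric.closedBall (0 : ℂ) R).indicator (normPow s))
        (fun w => twist k Ψ s (0, w))
    rw [h6]
    field_simp

end Continuation


/-! ### Residues of zeta functions -/

section ZetaResidue

variable {n : ℕ} {X : Type*} [TopologicalSpace X] [ChartedSpace (Fin n → ℂ) X]
  {μ : X → ℝ} {η : Form n X} {c c' : ℂ}

theorem IsCompactlySupported.smul (h : IsCompactlySupported η) (a : X → ℂ) :
    IsCompactlySupported (fun x => a x • η x) := by
  obtain ⟨K, hK, hη⟩ := h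
  exact ⟨K, hK, fun x hx => by simp only [hη x hx, smul_zero]⟩

variable [T2Space X] [SigmaCompactSpace X] [IsManifold 𝓘(ℂ, Fin n → ℂ) ω X]

/-- The zeta function `∫_X μ^{s/2} η` continues to a half-plane containing `0` with at most a simple
pole at `0`, of residue `c`: it equals `B s / s` with `B` holomorphic and `B 0 = c`. -/
def HasSimpleZetaPole (μ : X → ℝ) (η : Form n X) (c : ℂ) : Prop :=
  ∃ (δ : ℝ) (A : ℝ) (B : ℂ → ℂ), 0 < δ ∧ DifferentiableOn ℂ B {s : ℂ | -δ < s.re} ∧ B 0 = c ∧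
    ∀ s : ℂ, A < s.re →
      IsIntegrable (fun x => ((μ x : ℂ) ^ (s / 2)) • η x) ∧
      s⁻¹ * B s = integral (fun x => ((μ x : ℂ) ^ (s / 2)) • η x)

theorem HasSimpleZetaPole.isZetaResidue (h : HasSimpleZetaPole μ η c) : IsZetaResidue μ η c := by
  obtain ⟨δ, A, B, hδ, hB, hB0, hint⟩ := h
  have hopen : IsOpen {s : ℂ | -δ < s.re} := isOpen_lt continuous_const Complex.continuous_re
  refine ⟨δ, A, fun s => s⁻¹ * B s, hδ, ?_, hint, ?_⟩
  · exact (MeromorphicOn.id.inv).mul (hB.analyticOnNhd hopen).meromorphicOn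
  · filter_upwards [Ioo_mem_nhdsGT hδ] with r hr
    have h1 : DifferentiableOn ℂ B (Metric.closedBall 0 r) := by
      refine hB.mono fun s hs => ?_
      rw [mem_closedBall_zero_iff] at hs
      have := (abs_le.mp (Complex.abs_re_le_norm s)).1
      change -δ < s.re
      linarith [hr.2]
    have h2 := h1.circleIntegral_sub_inv_smul (Metric.mem_ball_self hr.1)
    simp only [sub_zero, smul_eq_mul, hB0] at h2
    exact h2

theorem IsZetaResidue.unique (h : IsZetaResidue μ η c) (h' : IsZetaResidue μ η c') : c = c' := by
  obtain ⟨δ, A, Z, hδ, hZ, hint, hc⟩ := h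
  obtain ⟨δ', A', Z', hδ', hZ', hint', hc'⟩ := h'
  set δ₀ := min δ δ' with hδ₀
  have hδ₀pos : 0 < δ₀ := lt_min hδ hδ'
  set V := {s : ℂ | -δ₀ < s.re} with hV
  have hm : MeromorphicOn (Z - Z') V := by
    refine (hZ.mono_set fun s hs => ?_).sub (hZ'.mono_set fun s hs => ?_)
    · exact lt_of_le_of_lt (neg_le_neg (min_le_left δ δ')) hs
    · exact lt_of_le_of_lt (neg_le_neg (min_le_right δ δ')) hs
  have hconv : Convex ℝ V := convex_halfSpace_re_gt (-δ₀)
  have h0V : (0 : ℂ) ∈ V := by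
    change -δ₀ < (0 : ℂ).re
    simpa using hδ₀pos
  set s₁ : ℂ := ((max (max A A') 0 + 1 : ℝ) : ℂ) with hs₁
  have hs₁re : s₁.re = max (max A A') 0 + 1 := Complex.ofReal_re _
  have hs₁V : s₁ ∈ V := by
    change -δ₀ < s₁.re
    have := le_max_right (max A A') 0
    rw [hs₁re]
    linarith
  -- Both continuations agree near `s₁`, hence near `0` by the identity theorem.
  have htop : meromorphicOrderAt (Z - Z') s₁ = ⊤ := by
    rw [meromorphicOrderAt_eq_top_iff]
    refine nhdsWithin_le_nhds ?_
    have h1 : ∀ᶠ s : ℂ in 𝓝 s₁, max A A' < s.re :=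
      Complex.continuous_re.continuousAt.eventually_const_lt (by
        rw [hs₁re]
        linarith [le_max_left (max A A') 0])
    filter_upwards [h1] with s hs
    rw [Pi.sub_apply, (hint s ((le_max_left _ _).trans_lt hs)).2,
      (hint' s ((le_max_right _ _).trans_lt hs)).2, sub_self]
  have h0top : meromorphicOrderAt (Z - Z') 0 = ⊤ := by
    by_contra hne
    exact hm.meromorphicOrderAt_ne_top_of_isPreconnected hconv.isPreconnected h0V hs₁V hne htop
  rw [meromorphicOrderAt_eq_top_iff] at h0top
  have hev : ∀ᶠ r : ℝ in 𝓝[>] 0, ∀ s : ℂ, ‖s‖ = r → Z s = Z' s := by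
    rw [eventually_nhdsWithin_iff, Metric.eventually_nhds_iff_ball] at h0top
    obtain ⟨ε, hε, hball⟩ := h0top
    filter_upwards [Ioo_mem_nhdsGT hε] with r hr s hs
    have h1 := hball s (by simpa [hs] using hr.2) (by
      rintro rfl
      rw [norm_zero] at hs
      exact hr.1.ne hs)
    exact sub_eq_zero.mp h1
  have hpos : ∀ᶠ r : ℝ in 𝓝[>] 0, 0 < r := self_mem_nhdsWithin
  obtain ⟨r, hr0, hr, hr', hrr⟩ := (hpos.and (hc.and (hc'.and hev))).exists
  have hcong : (∮ s in C(0, r), Z s) = ∮ s in C(0, r), Z' s :=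
    circleIntegral.integral_congr hr0.le fun s hs => hrr s (by simpa using hs)
  rw [hr, hr'] at hcong
  exact mul_left_cancel₀ Complex.two_pi_I_ne_zero hcong

theorem HasSimpleZetaPole.sum {κ : Type*} {S : Finset κ} {θ : κ → Form n X} {c : κ → ℂ}
    (hsupp : ∀ k ∈ S, IsCompactlySupported (θ k))
    (h : ∀ k ∈ S, HasSimpleZetaPole μ (θ k) (c k)) :
    HasSimpleZetaPole μ (fun x => ∑ k ∈ S, θ k x) (∑ k ∈ S, c k) := by
  choose! δ A B hδ hB hB0 hint using h
  obtain ⟨δ₀, hδ₀, hδ₀'⟩ : ∃ δ₀ : ℝ, 0 < δ₀ ∧ ∀ k ∈ S, δ₀ ≤ δ k := by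
    rcases S.eq_empty_or_nonempty with rfl | hS
    · exact ⟨1, one_pos, by simp⟩
    · exact ⟨S.inf' hS δ, (Finset.lt_inf'_iff hS).mpr hδ, fun k hk => Finset.inf'_le δ hk⟩
  obtain ⟨A₀, hA₀⟩ : ∃ A₀ : ℝ, ∀ k ∈ S, A k ≤ A₀ :=
    (S.finite_toSet.image A).bddAbove.imp fun M hM k hk => hM ⟨k, hk, rfl⟩
  refine ⟨δ₀, A₀, fun s => ∑ k ∈ S, B k s, hδ₀, ?_, Finset.sum_congr rfl hB0, fun s hs => ?_⟩
  · refine DifferentiableOn.fun_sum fun k hk => (hB k hk).mono fun s hs => ?_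
    exact (neg_le_neg (hδ₀' k hk)).trans_lt hs
  · have h1 := integral_sum (θ := fun k x => ((μ x : ℂ) ^ (s / 2)) • θ k x)
      (fun k hk => (hsupp k hk).smul _) fun k hk => (hint k hk s ((hA₀ k hk).trans_lt hs)).1
    simp only [← Finset.smul_sum] at h1
    refine ⟨h1.1, ?_⟩
    rw [h1.2, Finset.mul_sum]
    exact Finset.sum_congr rfl fun k hk => (hint k hk s ((hA₀ k hk).trans_lt hs)).2

end ZetaResidue


/-! ### The residue in a chart -/

section ChartResidue

open MeasureTheory

theorem contDiff_of_eq_zero_off {E F : Type*} [NormedAddCommGroup E] [NormedSpace ℝ E]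
    [NormedAddCommGroup F] [NormedSpace ℝ F] {g : E → F} {V L : Set E} (hL : IsClosed L)
    (hLV : L ⊆ V) (hg : ∀ z ∈ V, ContDiffAt ℝ ∞ g z) (hg0 : ∀ z, z ∉ L → g z = 0) :
    ContDiff ℝ ∞ g := by
  rw [contDiff_iff_contDiffAt]
  intro z
  by_cases hz : z ∈ V
  · exact hg z hz
  · refine (contDiffAt_const (c := (0 : F))).congr_of_eventuallyEq ?_
    filter_upwards [hL.isOpen_compl.mem_nhds fun h => hz (hLV h)] with y hy using hg0 y hy

/-- The identification of `ℂ × ℂⁿ` with `ℂⁿ⁺¹`. -/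
def consHomeomorph (n : ℕ) : ℂ × (Fin n → ℂ) ≃ₜ (Fin (n + 1) → ℂ) :=
  (Homeomorph.prodComm _ _).trans (consEquiv n).toHomeomorph

theorem consHomeomorph_apply (n : ℕ) (p : ℂ × (Fin n → ℂ)) :
    consHomeomorph n p = Fin.cons p.1 p.2 := rfl

theorem contDiff_consHomeomorph (n : ℕ) {r : WithTop ℕ∞} : ContDiff ℝ r (consHomeomorph n) := by
  rw [contDiff_pi]
  intro j
  refine Fin.cases ?_ (fun j => ?_) j
  · exact contDiff_fst
  · exact (contDiff_apply ℝ ℂ j).comp contDiff_snd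

theorem cpow_conformal {a r : ℝ} (ha : 0 < a) (hr : 0 < r) (s : ℂ) :
    ((a * r ^ 2 : ℝ) : ℂ) ^ (s / 2) =
      (r : ℂ) ^ (s - 2) * Complex.exp (s * (Real.log a / 2 : ℝ)) * (r : ℂ) ^ 2 := by
  have hr0 : (r : ℂ) ≠ 0 := Complex.ofReal_ne_zero.mpr hr.ne'
  have h1 : ((a * r ^ 2 : ℝ) : ℂ) ≠ 0 := Complex.ofReal_ne_zero.mpr (by positivity)
  have h2 : (r : ℂ) ^ 2 = Complex.exp (2 * Real.log r) := by
    rw [two_mul, Complex.exp_add, ← Complex.ofReal_exp, Real.exp_log hr, pow_two]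
  rw [Complex.cpow_def_of_ne_zero h1, Complex.cpow_def_of_ne_zero hr0, h2, ← Complex.exp_add,
    ← Complex.exp_add, ← Complex.ofReal_log (by positivity), ← Complex.ofReal_log hr.le,
    Real.log_mul ha.ne' (by positivity), Real.log_pow]
  congr 1
  push_cast
  ring

/-- The top coefficient in a chart of a smooth form with compact support in the chart domain is a
test function. -/
theorem contDiff_indicator_topCoeff {m : ℕ} {Y : Type*} [TopologicalSpace Y]
    [ChartedSpace (Fin m → ℂ) Y] [IsManifold 𝓘(ℂ, Fin m → ℂ) ω Y] {Γ : Form m Y} {K : Set Y}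
    {e : OpenPartialHomeomorph Y (Fin m → ℂ)} (he : e ∈ holoAtlas m Y) (hK : IsCompact K)
    (hKe : K ⊆ e.source) (hΓ0 : ∀ x, x ∉ K → Γ x = 0) (hΓs : ∀ x ∈ e.source, SmoothAt Γ x) :
    ContDiff ℝ ∞ (e.target.indicator fun z => topCoeff m (inChart e Γ z)) ∧
      ∀ z, z ∉ e '' K → e.target.indicator (fun z => topCoeff m (inChart e Γ z)) z = 0 := by
  have hL₀ : IsCompact (e '' K) := hK.image_of_continuousOn (e.continuousOn.mono hKe)
  have hL₀e : e '' K ⊆ e.target := by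
    rintro _ ⟨x, hx, rfl⟩
    exact e.map_source (hKe hx)
  have hΨ0 : ∀ z, z ∉ e '' K →
      e.target.indicator (fun z => topCoeff m (inChart e Γ z)) z = 0 := by
    intro z hz
    by_cases hze : z ∈ e.target
    · rw [Set.indicator_of_mem hze,
        inChart_eq_zero (hΓ0 _ fun h => hz ⟨_, h, e.right_inv hze⟩), map_zero]
    · rw [Set.indicator_of_notMem hze]
  refine ⟨contDiff_of_eq_zero_off hL₀.isClosed hL₀e (fun z hz => ?_) hΨ0, hΨ0⟩
  have h1 := (smoothAt_iff he (e.map_target hz)).mp (hΓs _ (e.map_target hz)) (topCoeff m)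
  rw [e.right_inv hz] at h1
  refine h1.congr_of_eventuallyEq ?_
  filter_upwards [e.open_target.mem_nhds hz] with y hy
  rw [Set.indicator_of_mem hy]

theorem integrableOn_topCoeff {m : ℕ} {Y : Type*} [TopologicalSpace Y]
    [ChartedSpace (Fin m → ℂ) Y] [IsManifold 𝓘(ℂ, Fin m → ℂ) ω Y] {Γ : Form m Y} {K : Set Y}
    {e : OpenPartialHomeomorph Y (Fin m → ℂ)} (he : e ∈ holoAtlas m Y) (hK : IsCompact K)
    (hKe : K ⊆ e.source) (hΓ0 : ∀ x, x ∉ K → Γ x = 0) (hΓs : ∀ x ∈ e.source, SmoothAt Γ x) :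
    IntegrableOn (fun z => topCoeff m (inChart e Γ z)) e.target := by
  obtain ⟨h1, h2⟩ := contDiff_indicator_topCoeff he hK hKe hΓ0 hΓs
  rw [← integrable_indicator_iff e.open_target.measurableSet]
  exact h1.continuous.integrable_of_hasCompactSupport (HasCompactSupport.intro
    (hK.image_of_continuousOn (e.continuousOn.mono hKe)) h2)

variable {n : ℕ} {X : Type*} [TopologicalSpace X] [ChartedSpace (Fin (n + 1) → ℂ) X]
  [T2Space X] [SigmaCompactSpace X] [IsManifold 𝓘(ℂ, Fin (n + 1) → ℂ) ω X] {μ h : X → ℝ}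
  {γ Γ : Form (n + 1) X} {e : OpenPartialHomeomorph X (Fin (n + 1) → ℂ)} {K : Set X}

/-- If `μ = h |z₀|²` and `Γ = |z₀|² γ` is smooth in a chart containing the support of `γ`, then the
zeta function of `γ` has a simple pole at `0` whose residue is an integral over `z₀ = 0`. -/
theorem hasSimpleZetaPole_of_chart (he : e ∈ holoAtlas (n + 1) X) (hK : IsCompact K)
    (hKe : K ⊆ e.source) (hγ0 : ∀ x, x ∉ K → γ x = 0) (hΓ0 : ∀ x, x ∉ K → Γ x = 0)
    (hΓs : ∀ x ∈ e.source, SmoothAt Γ x)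
    (hh : ContMDiffOn 𝓘(ℝ, Fin (n + 1) → ℂ) 𝓘(ℝ, ℝ) ∞ h e.source)
    (hμ : ∀ x ∈ e.source, 0 < h x ∧ μ x = h x * ‖e x 0‖ ^ 2)
    (hΓ : ∀ x ∈ e.source, e x 0 ≠ 0 → Γ x = (e x 0 * starRingEnd ℂ (e x 0)) • γ x) :
    HasSimpleZetaPole μ γ (2 * Real.pi * ∫ w : Fin n → ℂ,
      e.target.indicator (fun z => topCoeff (n + 1) (inChart e Γ z)) (Fin.cons 0 w)) := by
  set Ψ : (Fin (n + 1) → ℂ) → ℂ :=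
    e.target.indicator (fun z => topCoeff (n + 1) (inChart e Γ z)) with hΨdef
  obtain ⟨hΨs, hΨ0⟩ := contDiff_indicator_topCoeff he hK hKe hΓ0 hΓs
  rw [← hΨdef] at hΨs hΨ0
  have hL₀ : IsCompact (e '' K) := hK.image_of_continuousOn (e.continuousOn.mono hKe)
  have hL₀e : e '' K ⊆ e.target := by
    rintro _ ⟨x, hx, rfl⟩
    exact e.map_source (hKe hx)
  have hL₀mem : ∀ z ∈ e.target, z ∉ e '' K → e.symm z ∉ K := fun z hz hzK h =>
    hzK ⟨_, h, e.right_inv hz⟩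
  have hΨc : HasCompactSupport Ψ := HasCompactSupport.intro hL₀ hΨ0
  -- The function `(log h) / 2`, cut off away from the support of `Ψ`.
  obtain ⟨L, hL, hL₀L, hLe⟩ := exists_compact_between hL₀ e.open_target hL₀e
  obtain ⟨χ, hχ, -, hχsupp, hχ1⟩ := exists_contMDiff_support_eq_eq_one_iff
    𝓘(ℝ, Fin (n + 1) → ℂ) (isOpen_interior (s := L)) hL₀.isClosed hL₀L
  set k : (Fin (n + 1) → ℂ) → ℝ := fun z => χ z * (Real.log (h (e.symm z)) / 2) with hkdef
  have hk0 : ∀ z, z ∉ L → k z = 0 := by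
    intro z hz
    have : χ z = 0 := by
      by_contra h0
      have h1 : z ∈ Function.support χ := h0
      rw [hχsupp] at h1
      exact hz (interior_subset h1)
    rw [hkdef]
    simp only [this, zero_mul]
  have hks : ContDiff ℝ ∞ k := by
    refine contDiff_of_eq_zero_off hL.isClosed hLe (fun z hz => ?_) hk0
    have h1 : ContDiffAt ℝ ∞ (fun z => h (e.symm z)) z := by
      rw [← contMDiffAt_iff_contDiffAt]
      exact ContMDiffAt.comp z
        (hh.contMDiffAt (e.open_source.mem_nhds (e.map_target hz))) (contMDiffAt_chart_symm he hz)
    exact (hχ.contDiff.contDiffAt).mul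
      ((h1.log (hμ _ (e.map_target hz)).1.ne').div_const 2)
  have hkc : HasCompactSupport k := HasCompactSupport.intro hL hk0
  have hemb := (consHomeomorph n).isClosedEmbedding
  obtain ⟨B, hB, hB0, hBint⟩ := exists_zeta_continuation
    (Ψ := Ψ ∘ consHomeomorph n) (k := k ∘ consHomeomorph n)
    ((hΨs.of_le (by simp)).comp (contDiff_consHomeomorph n)) (hΨc.comp_isClosedEmbedding hemb)
    ((hks.of_le (by simp)).comp (contDiff_consHomeomorph n)) (hkc.comp_isClosedEmbedding hemb)
  refine ⟨1, 2, B, one_pos, hB, hB0, fun s hs => ?_⟩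
  have hs2 : s - 2 ≠ 0 := fun h => by
    rw [sub_eq_zero.mp h] at hs
    simp at hs
  have hs0 : s / 2 ≠ 0 := fun h => by
    have : s = 0 := by simpa using h
    rw [this] at hs
    simp at hs
    linarith
  obtain ⟨hint, hval⟩ := hBint s hs
  -- The integrand in the chart.
  have hcons : ∀ z : Fin (n + 1) → ℂ, consHomeomorph n (z 0, Fin.tail z) = z := fun z => by
    rw [consHomeomorph_apply]
    exact Fin.cons_self_tail z
  have hmp := volume_preserving_piFinSuccAbove (fun _ : Fin (n + 1) => ℂ) 0
  have hequiv : ∀ z : Fin (n + 1) → ℂ,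
      MeasurableEquiv.piFinSuccAbove (fun _ : Fin (n + 1) => ℂ) 0 z = (z 0, Fin.tail z) :=
    fun z => rfl
  set G : (Fin (n + 1) → ℂ) → ℂ := fun z => (‖z 0‖ : ℂ) ^ (s - 2) * twist k Ψ s z with hG
  have hGcomp : G = (fun p : ℂ × (Fin n → ℂ) => (‖p.1‖ : ℂ) ^ (s - 2) *
      twist (k ∘ consHomeomorph n) (Ψ ∘ consHomeomorph n) s p) ∘
        MeasurableEquiv.piFinSuccAbove (fun _ : Fin (n + 1) => ℂ) 0 := by
    funext z
    simp only [hG, Function.comp_apply, twist, hequiv, hcons]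
  have hGint : Integrable G := by
    rw [hGcomp]
    exact (hmp.integrable_comp_emb (MeasurableEquiv.measurableEmbedding _)).mpr hint
  have hGval : ∫ z, G z = s⁻¹ * B s := by
    rw [hval, hGcomp]
    exact hmp.integral_comp (MeasurableEquiv.measurableEmbedding _)
      (fun p : ℂ × (Fin n → ℂ) => (‖p.1‖ : ℂ) ^ (s - 2) *
        twist (k ∘ consHomeomorph n) (Ψ ∘ consHomeomorph n) s p)
  have hGe : ∀ z ∈ e.target, topCoeff (n + 1)
      (inChart e (fun x => ((μ x : ℂ) ^ (s / 2)) • γ x) z) = G z := by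
    intro z hz
    have hx := e.map_target hz
    have hzx : e (e.symm z) = z := e.right_inv hz
    rw [inChart_smul e (fun x => (μ x : ℂ) ^ (s / 2)), map_smul, smul_eq_mul]
    simp only [hG, twist]
    by_cases hz0 : z 0 = 0
    · have h0 : μ (e.symm z) = 0 := by rw [(hμ _ hx).2, hzx, hz0]; simp
      rw [h0, Complex.ofReal_zero, Complex.zero_cpow hs0, hz0, norm_zero, Complex.ofReal_zero,
        Complex.zero_cpow hs2, zero_mul, zero_mul]
    by_cases hzK : z ∈ e '' K
    swap
    · rw [hΨ0 z hzK, inChart_eq_zero (hγ0 _ (hL₀mem z hz hzK))]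
      simp
    have hΨz : Ψ z = (‖z 0‖ : ℂ) ^ 2 * topCoeff (n + 1) (inChart e γ z) := by
      have h1 := hΓ _ hx (by rwa [hzx])
      rw [hzx] at h1
      rw [hΨdef, Set.indicator_of_mem hz,
        inChart_congr_point e (η' := fun x => (z 0 * starRingEnd ℂ (z 0)) • γ x) h1,
        inChart_smul e (fun _ => z 0 * starRingEnd ℂ (z 0)), map_smul, smul_eq_mul, RCLike.mul_conj]
      rfl
    have hkz : k z = Real.log (h (e.symm z)) / 2 := by
      rw [hkdef]
      simp only [(hχ1 z).mp hzK, one_mul]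
    rw [hΨz, hkz, (hμ _ hx).2, hzx, cpow_conformal (hμ _ hx).1 (norm_pos_iff.mpr hz0)]
    ring
  have hGoff : ∀ z ∉ e.target, G z = 0 := by
    intro z hz
    simp only [hG, twist, hΨ0 z fun h => hz (hL₀e h), mul_zero]
  have hfin := integral_eq_setIntegral_chart (η := fun x => ((μ x : ℂ) ^ (s / 2)) • γ x) he hK hKe
    (fun x hx => by simp only [hγ0 x hx, smul_zero])
    (hGint.integrableOn.congr_fun (fun z hz => (hGe z hz).symm) e.open_target.measurableSet)
  refine ⟨hfin.1, ?_⟩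
  rw [hfin.2, ← hGval, setIntegral_congr_fun e.open_target.measurableSet hGe,
    setIntegral_eq_integral_of_forall_compl_eq_zero hGoff]

end ChartResidue

/-! ### Restriction to the hypersurface -/

section Restriction

variable {n : ℕ} {X Y : Type*} [TopologicalSpace X] [ChartedSpace (Fin (n + 1) → ℂ) X]
  [TopologicalSpace Y] [ChartedSpace (Fin n → ℂ) Y] {i : Y → X} {f : X → ℂ}
  {e : OpenPartialHomeomorph X (Fin (n + 1) → ℂ)} {e' : OpenPartialHomeomorph Y (Fin n → ℂ)}

namespace IsAdapted

theorem symm_cons (h : IsAdapted i f e e') {w : Fin n → ℂ} (hw : w ∈ e'.target) :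
    e.symm (Fin.cons 0 w) = i (e'.symm w) := by
  have hy := e'.map_target hw
  have h1 := h.incl _ hy
  rw [e'.right_inv hw] at h1
  rw [← h1, e.left_inv ((h.source_iff _).mp hy)]

theorem cons_mem_target_iff (h : IsAdapted i f e e') {w : Fin n → ℂ} :
    (Fin.cons 0 w : Fin (n + 1) → ℂ) ∈ e.target ↔ w ∈ e'.target := by
  constructor
  · intro hw
    have hx := e.map_target hw
    obtain ⟨y, hy⟩ := (h.mem_range_iff _ hx).mpr (by
      rw [h.coord _ hx, e.right_inv hw, Fin.cons_zero])
    have hys : y ∈ e'.source := (h.source_iff y).mpr (by rwa [hy])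
    have h1 := h.incl y hys
    rw [hy, e.right_inv hw] at h1
    rw [(Fin.cons_right_injective (α := fun _ : Fin (n + 1) => ℂ) 0) h1]
    exact e'.map_source hys
  · intro hw
    have hy := e'.map_target hw
    have h1 := h.incl _ hy
    rw [e'.right_inv hw] at h1
    rw [← h1]
    exact e.map_source ((h.source_iff _).mp hy)

theorem mdifferentiableAt (h : IsAdapted i f e e') {y : Y} (hy : y ∈ e'.source) :
    MDifferentiableAt 𝓘(ℝ, Fin n → ℂ) 𝓘(ℝ, Fin (n + 1) → ℂ) i y := by
  have h1 : i =ᶠ[𝓝 y] e.symm ∘ (hyperplaneInclusion n ∘ e') := by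
    filter_upwards [e'.open_source.mem_nhds hy] with z hz
    rw [Function.comp_apply, Function.comp_apply, hyperplaneInclusion_apply, ← h.incl z hz,
      e.left_inv ((h.source_iff z).mp hz)]
  have h2 : MDifferentiableAt 𝓘(ℝ, Fin n → ℂ) 𝓘(ℝ, Fin (n + 1) → ℂ)
      (hyperplaneInclusion n ∘ e') y :=
    MDifferentiableAt.comp y (I' := 𝓘(ℝ, Fin n → ℂ))
      (((hyperplaneInclusion n).restrictScalars ℝ).differentiableAt.mdifferentiableAt)
      (mdifferentiableAt_chart h.mem' hy)
  refine MDifferentiableAt.congr_of_eventuallyEq ?_ h1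
  refine MDifferentiableAt.comp y (I' := 𝓘(ℝ, Fin (n + 1) → ℂ)) ?_ h2
  refine mdifferentiableAt_chart_symm h.mem ?_
  rw [Function.comp_apply, hyperplaneInclusion_apply, ← h.incl y hy]
  exact e.map_source ((h.source_iff y).mp hy)

/-- In adapted charts, restricting a form to the hypersurface is restricting its coefficients to the
hyperplane and pulling covectors back along the inclusion of the hyperplane. -/
theorem inChart_pullback (h : IsAdapted i f e e') (θ : Form (n + 1) X) {w : Fin n → ℂ}
    (hw : w ∈ e'.target) :
    inChart e' (pullback (m := n) i θ) w = ExteriorAlgebra.map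
      (transpose ((hyperplaneInclusion n).restrictScalars ℝ)) (inChart e θ (Fin.cons 0 w)) := by
  have h1 : i ∘ e'.symm =ᶠ[𝓝 w] e.symm ∘ hyperplaneInclusion n := by
    filter_upwards [e'.open_target.mem_nhds hw] with z hz
    rw [Function.comp_apply, Function.comp_apply, hyperplaneInclusion_apply, h.symm_cons hz]
  have h2 : inChart e' (pullback (m := n) i θ) w =
      (pullback (m := n) e'.symm (pullback (m := n) i θ)).val w := rfl
  have h3 : MDifferentiableAt 𝓘(ℝ, Fin (n + 1) → ℂ) 𝓘(ℝ, Fin (n + 1) → ℂ) e.symm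
      (hyperplaneInclusion n w) :=
    mdifferentiableAt_chart_symm h.mem (h.cons_mem_target_iff.mpr hw)
  have h4 : HasFDerivAt (𝕜 := ℝ) (hyperplaneInclusion n : (Fin n → ℂ) → (Fin (n + 1) → ℂ))
      ((hyperplaneInclusion n).restrictScalars ℝ) w :=
    ((hyperplaneInclusion n).restrictScalars ℝ).hasFDerivAt
  rw [h2, ← pullback_comp (m := n) θ (h.mdifferentiableAt (e'.map_target hw))
      (mdifferentiableAt_chart_symm h.mem' hw), pullback_congr θ h1,
    pullback_comp (m := n + 1) θ h3 h4.differentiableAt.mdifferentiableAt, pullback_val,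
    tderiv_eq_fderiv, h4.fderiv]
  rfl

variable [IsManifold 𝓘(ℂ, Fin (n + 1) → ℂ) ω X] [IsManifold 𝓘(ℂ, Fin n → ℂ) ω Y]

theorem smoothAt_pullback (h : IsAdapted i f e e') {θ : Form (n + 1) X} {y : Y}
    (hy : y ∈ e'.source) (hθ : SmoothAt θ (i y)) : SmoothAt (pullback (m := n) i θ) y := by
  rw [smoothAt_iff h.mem' hy]
  have h1 := (smoothAt_iff h.mem ((h.source_iff y).mp hy)).mp hθ
  rw [h.incl y hy] at h1
  refine CoeffSmoothAt.congr (CoeffSmoothAt.map_transpose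
    (L := fun _ => (hyperplaneInclusion n).restrictScalars ℝ) contDiffAt_const
    (CoeffSmoothAt.comp (g := fun w => hyperplaneInclusion n w) h1
      ((hyperplaneInclusion n).restrictScalars ℝ).contDiff.contDiffAt)) ?_
  filter_upwards [e'.open_target.mem_nhds (e'.map_source hy)] with w hw
  exact h.inChart_pullback θ hw

end IsAdapted

end Restriction

/-! ### The residue pairing in a chart -/

section ChartPairing

open MeasureTheory

variable {n : ℕ} {X : Type*} [TopologicalSpace X] [ChartedSpace (Fin (n + 1) → ℂ) X]
  {D : Set X} {e : OpenPartialHomeomorph X (Fin (n + 1) → ℂ)} {μ : X → ℝ}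
  {η η₁₁ η₁₀ η₀₁ η₀₀ φ : Form (n + 1) X} {K : Set X}

theorem IsBilogarithmic.of_eqOn {U V : Set X} {f g : X → ℂ}
    (h : IsBilogarithmic D U f η η₁₁ η₁₀ η₀₁ η₀₀) (hV : IsOpen V) (hVU : V ⊆ U)
    (hfg : ∀ x ∈ V, f x = g x) : IsBilogarithmic D V g η η₁₁ η₁₀ η₀₁ η₀₀ := by
  have hmono : ∀ θ : Form (n + 1) X, IsSmoothOn θ U → IsSmoothOn θ V := fun θ hθ c hc l =>
    (hθ c hc l).mono fun z hz => ⟨hz.1, hVU hz.2⟩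
  refine ⟨hmono _ h.smooth₁₁, hmono _ h.smooth₁₀, hmono _ h.smooth₀₁, hmono _ h.smooth₀₀,
    fun x hx => ?_⟩
  have h1 : f =ᶠ[𝓝 x] g := by
    filter_upwards [hV.mem_nhds hx.1] with z hz
    exact hfg z hz
  have h2 : (fun z => starRingEnd ℂ (f z)) =ᶠ[𝓝 x] fun z => starRingEnd ℂ (g z) :=
    h1.mono fun z hz => by simp only [hz]
  rw [h.eq x ⟨hVU hx.1, hx.2⟩, d_congr h1, d_congr h2, hfg x hx.1]

theorem inChart_d_coord (he : e ∈ holoAtlas (n + 1) X) {z : Fin (n + 1) → ℂ} (hz : z ∈ e.target) :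
    inChart e (d fun x => e x 0) z = ExteriorAlgebra.ι ℂ (dz n) := by
  have h1 : (fun x => e x 0) ∘ e.symm =ᶠ[𝓝 z] dz n := by
    filter_upwards [e.open_target.mem_nhds hz] with z' hz'
    simp [e.right_inv hz', dz]
  have h2 : MDifferentiableAt 𝓘(ℝ, Fin (n + 1) → ℂ) 𝓘(ℝ, ℂ) (fun x => e x 0) (e.symm z) :=
    MDifferentiableAt.comp (g := dz n) (I' := 𝓘(ℝ, Fin (n + 1) → ℂ)) _
      (dz n).differentiableAt.mdifferentiableAt (mdifferentiableAt_chart he (e.map_target hz))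
  rw [inChart_d he hz h2, h1.fderiv_eq, ContinuousLinearMap.fderiv]

theorem inChart_d_coord_conj (he : e ∈ holoAtlas (n + 1) X) {z : Fin (n + 1) → ℂ}
    (hz : z ∈ e.target) :
    inChart e (d fun x => starRingEnd ℂ (e x 0)) z = ExteriorAlgebra.ι ℂ (dzbar n) := by
  have h1 : (fun x => starRingEnd ℂ (e x 0)) ∘ e.symm =ᶠ[𝓝 z] dzbar n := by
    filter_upwards [e.open_target.mem_nhds hz] with z' hz'
    simp [e.right_inv hz', dz, dzbar]
  have h2 : MDifferentiableAt 𝓘(ℝ, Fin (n + 1) → ℂ) 𝓘(ℝ, ℂ) (fun x => starRingEnd ℂ (e x 0))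
      (e.symm z) :=
    MDifferentiableAt.comp (g := dzbar n) (I' := 𝓘(ℝ, Fin (n + 1) → ℂ)) _
      (dzbar n).differentiableAt.mdifferentiableAt (mdifferentiableAt_chart he (e.map_target hz))
  rw [inChart_d he hz h2, h1.fderiv_eq, ContinuousLinearMap.fderiv]

variable [IsManifold 𝓘(ℂ, Fin (n + 1) → ℂ) ω X]

variable {Y : Type*} [TopologicalSpace Y] [ChartedSpace (Fin n → ℂ) Y]
  [IsManifold 𝓘(ℂ, Fin n → ℂ) ω Y] [T2Space Y] [SigmaCompactSpace Y]
  {i : Y → X} {f : X → ℂ} {e' : OpenPartialHomeomorph Y (Fin n → ℂ)}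

theorem IsAdapted.integral_eq (had : IsAdapted i f e e') (hi : Topology.IsClosedEmbedding i)
    {ρ : Form n Y} (hρ : ∀ y ∈ e'.source, SmoothAt ρ y) (hφ : ∀ x, SmoothAt φ x)
    (hK : IsCompact K) (hKe : K ⊆ e.source) (hφ0 : ∀ x, x ∉ K → φ x = 0) :
    IntegrableOn (fun w => topCoeff n (inChart e' (fun y => ρ y * pullback i φ y) w)) e'.target ∧
    IsIntegrable (fun y => ρ y * pullback i φ y) ∧
      integral (fun y => ρ y * pullback i φ y) =
        ∫ w in e'.target, topCoeff n (inChart e' (fun y => ρ y * pullback i φ y) w) := by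
  have hK' : IsCompact (i ⁻¹' K) := hi.isCompact_preimage hK
  have hKe' : i ⁻¹' K ⊆ e'.source := fun y hy => (had.source_iff y).mpr (hKe hy)
  have h0 : ∀ y, y ∉ i ⁻¹' K → ρ y * pullback i φ y = 0 := fun y hy => by
    have : pullback (m := n) i φ y = 0 := by
      rw [pullback, hφ0 _ hy, map_zero]
    rw [this, mul_zero]
  have hint := integrableOn_topCoeff had.mem' hK' hKe' h0 fun y hy =>
    (hρ y hy).mul (had.smoothAt_pullback hy (hφ _))
  exact ⟨hint, integral_eq_setIntegral_chart had.mem' hK' hKe' h0 hint⟩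

variable [T2Space X] [SigmaCompactSpace X]

/-- The residue of the zeta function of `η ∧ φ`, for `η` bilogarithmic and `φ` supported in a chart
whose first coordinate is a local equation. Only the term `η₁₁` survives on `z₀ = 0`. -/
theorem IsBilogarithmic.hasSimpleZetaPole (he : e ∈ holoAtlas (n + 1) X)
    (hD : ∀ x ∈ e.source, e x 0 = 0 ↔ x ∈ D) (hμ : IsCanonicalMorseBott (n := n + 1) D μ)
    (hb : IsBilogarithmic D e.source (fun x => e x 0) η η₁₁ η₁₀ η₀₁ η₀₀)
    (hφ : ∀ x, SmoothAt φ x) (hK : IsCompact K) (hKe : K ⊆ e.source)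
    (hφ0 : ∀ x, x ∉ K → φ x = 0) :
    HasSimpleZetaPole μ (fun x => η x * φ x) ((-4 * Real.pi * Complex.I) *
      ∫ w in {w : Fin n → ℂ | (Fin.cons 0 w : Fin (n + 1) → ℂ) ∈ e.target},
        topCoeff n (ExteriorAlgebra.map (transpose ((hyperplaneInclusion n).restrictScalars ℝ))
          (inChart e (fun x => η₁₁ x * φ x) (Fin.cons 0 w)))) := by
  have hf := isLocalEquation_coord he hD
  obtain ⟨h, hh, hhμ⟩ := hμ.conformal _ _ hf
  set p : Form (n + 1) X := d fun x => e x 0 with hp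
  set q : Form (n + 1) X := d fun x => starRingEnd ℂ (e x 0) with hq
  have hps : ∀ x ∈ e.source, SmoothAt p x := fun x hx =>
    smoothAt_d e.open_source hf.contMDiffOn_real hx
  have hqs : ∀ x ∈ e.source, SmoothAt q x := fun x hx =>
    smoothAt_d e.open_source hf.contMDiffOn_conj hx
  have hzs : ∀ x ∈ e.source, ContMDiffAt 𝓘(ℝ, Fin (n + 1) → ℂ) 𝓘(ℝ, ℂ) ∞ (fun x => e x 0) x :=
    fun x hx => hf.contMDiffOn_real.contMDiffAt (e.open_source.mem_nhds hx)
  have hzs' : ∀ x ∈ e.source,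
      ContMDiffAt 𝓘(ℝ, Fin (n + 1) → ℂ) 𝓘(ℝ, ℂ) ∞ (fun x => starRingEnd ℂ (e x 0)) x :=
    fun x hx => hf.contMDiffOn_conj.contMDiffAt (e.open_source.mem_nhds hx)
  have h₁₁ := (isSmoothOn_iff e.open_source).mp hb.smooth₁₁
  have h₁₀ := (isSmoothOn_iff e.open_source).mp hb.smooth₁₀
  have h₀₁ := (isSmoothOn_iff e.open_source).mp hb.smooth₀₁
  have h₀₀ := (isSmoothOn_iff e.open_source).mp hb.smooth₀₀
  set Γ : Form (n + 1) X := fun x => (p x * q x * η₁₁ x + starRingEnd ℂ (e x 0) • (p x * η₁₀ x) +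
    e x 0 • (q x * η₀₁ x) + (e x 0 * starRingEnd ℂ (e x 0)) • η₀₀ x) * φ x with hΓ
  have hΓs : ∀ x ∈ e.source, SmoothAt Γ x := fun x hx =>
    ((((((hps x hx).mul (hqs x hx)).mul (h₁₁ x hx)).add
      (((hps x hx).mul (h₁₀ x hx)).smul (hzs' x hx))).add
      (((hqs x hx).mul (h₀₁ x hx)).smul (hzs x hx))).add
      ((h₀₀ x hx).smul (contMDiffAt_mul (hzs x hx) (hzs' x hx)))).mul (hφ x)
  have key := hasSimpleZetaPole_of_chart (μ := μ) (γ := fun x => η x * φ x) (Γ := Γ) he hK hKe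
    (fun x hx => by simp only [hφ0 x hx, mul_zero])
    (fun x hx => by simp only [hΓ, hφ0 x hx, mul_zero]) hΓs hh hhμ (fun x hx h0 => by
      have hxD : x ∉ D := fun hxD => h0 ((hD x hx).mpr hxD)
      simp only [hΓ]
      rw [hb.eq x ⟨hx, hxD⟩]
      refine Eq.trans ?_ (smul_mul_assoc _ _ _)
      rw [bilog_smul h0 ((map_ne_zero (starRingEnd ℂ)).mpr h0)])
  convert key using 1
  have hset : MeasurableSet {w : Fin n → ℂ | (Fin.cons 0 w : Fin (n + 1) → ℂ) ∈ e.target} :=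
    (e.open_target.preimage (hyperplaneInclusion n).continuous).measurableSet
  rw [← integral_indicator hset, ← integral_const_mul,
    ← integral_const_mul]
  refine integral_congr_ae (Filter.Eventually.of_forall fun w => ?_)
  beta_reduce
  by_cases hw : (Fin.cons 0 w : Fin (n + 1) → ℂ) ∈ e.target
  swap
  · rw [Set.indicator_of_notMem hw, Set.indicator_of_notMem (by exact hw), mul_zero, mul_zero]
  have h0 : e (e.symm (Fin.cons 0 w)) 0 = 0 := by rw [e.right_inv hw, Fin.cons_zero]
  rw [Set.indicator_of_mem hw, Set.indicator_of_mem (by exact hw),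
    inChart_congr_point e (η := Γ) (η' := fun x => p x * q x * (η₁₁ x * φ x)) (by
      simp only [hΓ, h0, map_zero, zero_smul, zero_mul, add_zero, mul_assoc]),
    inChart_mul e (fun x => p x * q x), inChart_mul e p q, hp, hq, inChart_d_coord he hw,
    inChart_d_coord_conj he hw, topCoeff_dz_dzbar_mul]
  ring

/-- The residue pairing for a test form supported in an adapted chart. -/
theorem IsBilogarithmic.pairing_of_isAdapted (had : IsAdapted i f e e')
    (hi : Topology.IsClosedEmbedding i) (hμ : IsCanonicalMorseBott (n := n + 1) (Set.range i) μ)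
    (hb : IsBilogarithmic (Set.range i) e.source f η η₁₁ η₁₀ η₀₁ η₀₀)
    {ρ : Form n Y}
    (hρ : ∀ y ∈ e'.source, ρ y = (-4 * Real.pi * Complex.I : ℂ) • pullback i η₁₁ y)
    (hφ : ∀ x, SmoothAt φ x) (hK : IsCompact K) (hKe : K ⊆ e.source)
    (hφ0 : ∀ x, x ∉ K → φ x = 0) :
    IsIntegrable (fun y => ρ y * pullback i φ y) ∧
      HasSimpleZetaPole μ (fun x => η x * φ x) (integral (fun y => ρ y * pullback i φ y)) := by
  have h₁₁ := (isSmoothOn_iff e.open_source).mp hb.smooth₁₁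
  have hρs : ∀ y ∈ e'.source, SmoothAt ρ y := fun y hy => by
    refine SmoothAt.congr (SmoothAt.smul (c := fun _ => (-4 * Real.pi * Complex.I : ℂ))
      contMDiffAt_const (had.smoothAt_pullback hy (h₁₁ _ ((had.source_iff y).mp hy)))) ?_
    filter_upwards [e'.open_source.mem_nhds hy] with z hz
    exact hρ z hz
  obtain ⟨-, hint, hval⟩ := had.integral_eq hi hρs hφ hK hKe hφ0
  refine ⟨hint, ?_⟩
  have key := IsBilogarithmic.hasSimpleZetaPole had.mem
    (fun x hx => by rw [had.mem_range_iff x hx, had.coord x hx]) hμ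
    (hb.of_eqOn e.open_source subset_rfl had.coord) hφ hK hKe hφ0
  convert key using 1
  have hset : {w : Fin n → ℂ | (Fin.cons 0 w : Fin (n + 1) → ℂ) ∈ e.target} = e'.target :=
    Set.ext fun w => had.cons_mem_target_iff
  rw [hval, hset, ← integral_const_mul]
  refine setIntegral_congr_fun e'.open_target.measurableSet fun w hw => ?_
  beta_reduce
  rw [← had.inChart_pullback _ hw, ← smul_eq_mul, ← map_smul,
    ← inChart_smul e' (fun _ => (-4 * Real.pi * Complex.I : ℂ))]
  congr 1
  refine inChart_congr_point e' ?_
  rw [hρ _ (e'.map_target hw), pullback_mul, smul_mul_assoc]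

/-- A smooth form on the hypersurface is determined by its pairings with the restrictions of the
test forms supported in an adapted chart. -/
theorem IsAdapted.eq_of_integral_eq (had : IsAdapted i f e e') (hi : Topology.IsClosedEmbedding i)
    {ρ σ : Form n Y} (hρ : ∀ y ∈ e'.source, SmoothAt ρ y) (hσ : ∀ y ∈ e'.source, SmoothAt σ y)
    (h : ∀ (φ : Form (n + 1) X) (K : Set X), (∀ x, SmoothAt φ x) → IsCompact K → K ⊆ e.source →
      (∀ x, x ∉ K → φ x = 0) → integral (fun y => ρ y * pullback i φ y) =
        integral (fun y => σ y * pullback i φ y))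
    {y₀ : Y} (hy₀ : y₀ ∈ e'.source) : ρ y₀ = σ y₀ := by
  refine eq_of_inChart_eq had.mem' hy₀ ?_
  by_contra hne
  set w₀ := e' y₀ with hw₀
  obtain ⟨b, hb⟩ : ∃ b, topCoeff n ((inChart e' ρ w₀ - inChart e' σ w₀) * b) ≠ 0 := by
    by_contra! hall
    exact hne (sub_eq_zero.mp (eq_zero_of_forall_topCoeff_mul_eq_zero hall))
  set F : (Fin n → ℂ) → ℂ := fun w => topCoeff n ((inChart e' ρ w - inChart e' σ w) * b) with hF
  have hFs : ContDiffAt ℝ ∞ F w₀ :=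
    ((((smoothAt_iff had.mem' hy₀).mp (hρ _ hy₀)).sub ((smoothAt_iff had.mem' hy₀).mp
      (hσ _ hy₀))).mul (CoeffSmoothAt.const b)) (topCoeff n)
  set g : (Fin n → ℂ) → ℝ := fun w => (starRingEnd ℂ (F w₀) * F w).re with hg
  have hg0 : 0 < g w₀ := by
    simp only [hg]
    rw [mul_comm, Complex.mul_conj, Complex.ofReal_re]
    exact Complex.normSq_pos.mpr hb
  have hgc : ContinuousAt g w₀ :=
    Complex.continuous_re.continuousAt.comp (continuousAt_const.mul hFs.continuousAt)
  obtain ⟨V, hVg, hV, hw₀V⟩ := mem_nhds_iff.mp (hgc.eventually_const_lt hg0)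
  -- A cut-off function supported where the integrand is positive.
  have htail : Continuous (Fin.tail : (Fin (n + 1) → ℂ) → (Fin n → ℂ)) := by
    unfold Fin.tail; fun_prop
  set N : Set X := e.source ∩ e ⁻¹' (Fin.tail ⁻¹' V) with hN
  have hNo : IsOpen N := e.isOpen_inter_preimage (hV.preimage htail)
  have hx₀ : i y₀ ∈ e.source := (had.source_iff y₀).mp hy₀
  have hx₀N : {i y₀} ⊆ N := by
    rw [Set.singleton_subset_iff]
    refine ⟨hx₀, ?_⟩
    rw [Set.mem_preimage, Set.mem_preimage, had.incl y₀ hy₀, Fin.tail_cons]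
    exact hw₀V
  have : LocallyCompactSpace X := ChartedSpace.locallyCompactSpace (Fin (n + 1) → ℂ) X
  have := isManifold_real (n + 1) X
  obtain ⟨K, hK, hx₀K, hKN⟩ := exists_compact_between isCompact_singleton hNo hx₀N
  obtain ⟨χ, hχ, hχI, hχsupp, hχ1⟩ := exists_contMDiff_support_eq_eq_one_iff
    𝓘(ℝ, Fin (n + 1) → ℂ) (isOpen_interior (s := K)) (isClosed_singleton (x := i y₀)) hx₀K
  have hχ0 : ∀ x, x ∉ K → χ x = 0 := by
    intro x hx
    by_contra h0
    have h1 : x ∈ Function.support χ := h0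
    rw [hχsupp] at h1
    exact hx (interior_subset h1)
  have hχc : ContMDiff 𝓘(ℝ, Fin (n + 1) → ℂ) 𝓘(ℝ, ℂ) ∞ (fun x => (χ x : ℂ)) :=
    Complex.ofRealCLM.contDiff.contMDiff.comp hχ
  have hKe : K ⊆ e.source := fun x hx => (hKN hx).1
  -- The test form: cut-off extension of `b`, constant in the chart.
  let tailL : (Fin (n + 1) → ℂ) →L[ℝ] (Fin n → ℂ) :=
    (ContinuousLinearMap.fst ℝ (Fin n → ℂ) ℂ).comp
      (((consEquiv n).symm : (Fin (n + 1) → ℂ) →L[ℂ] (Fin n → ℂ) × ℂ).restrictScalars ℝ)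
  have htailL : tailL.comp ((hyperplaneInclusion n).restrictScalars ℝ) =
      ContinuousLinearMap.id ℝ _ := by
    ext w j
    rfl
  set B : CovectorAlgebra (n + 1) := ExteriorAlgebra.map (transpose tailL) b with hB
  set φ : Form (n + 1) X := fun x => (χ x : ℂ) • ofChart e (fun _ => B) x with hφdef
  have hφ0 : ∀ x, x ∉ K → φ x = 0 := fun x hx => by
    simp only [hφdef, hχ0 x hx, Complex.ofReal_zero, zero_smul]
  have hφs : ∀ x, SmoothAt φ x := by
    intro x
    by_cases hx : x ∈ e.source
    · refine SmoothAt.smul (hχc x) ((smoothAt_iff had.mem hx).mpr ?_)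
      refine (CoeffSmoothAt.const B).congr ?_
      filter_upwards [e.open_target.mem_nhds (e.map_source hx)] with z hz
      exact inChart_ofChart had.mem _ hz
    · refine SmoothAt.zero.congr ?_
      filter_upwards [hK.isClosed.isOpen_compl.mem_nhds fun h => hx (hKe h)] with z hz
      exact hφ0 z hz
  have hpb : ∀ w ∈ e'.target, inChart e' (pullback (m := n) i φ) w =
      (χ (i (e'.symm w)) : ℂ) • b := by
    intro w hw
    rw [had.inChart_pullback φ hw, hφdef, inChart_smul e (fun x => (χ x : ℂ)),
      inChart_ofChart had.mem _ (had.cons_mem_target_iff.mpr hw), map_smul, hB,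
      ← map_transpose_comp, htailL, map_transpose_id, had.symm_cons hw]
  obtain ⟨hρint, -, hρval⟩ := had.integral_eq hi hρ hφs hK hKe hφ0
  obtain ⟨hσint, -, hσval⟩ := had.integral_eq hi hσ hφs hK hKe hφ0
  have hzero := sub_eq_zero.mpr (h φ K hφs hK hKe hφ0)
  have hF' : ∀ w ∈ e'.target,
      topCoeff n (inChart e' (fun y => ρ y * pullback i φ y) w) -
        topCoeff n (inChart e' (fun y => σ y * pullback i φ y) w) =
      (χ (i (e'.symm w)) : ℂ) * F w := by
    intro w hw
    rw [inChart_mul, inChart_mul, hpb w hw, ← map_sub, ← sub_mul, mul_smul_comm, map_smul,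
      smul_eq_mul]
  rw [hρval, hσval, ← integral_sub hρint hσint,
    setIntegral_congr_fun e'.open_target.measurableSet hF'] at hzero
  have hχF : IntegrableOn (fun w => (χ (i (e'.symm w)) : ℂ) * F w) e'.target :=
    (hρint.sub hσint).congr_fun hF' e'.open_target.measurableSet
  set G : (Fin n → ℂ) → ℝ := fun w => χ (i (e'.symm w)) * g w with hG
  have hGeq : ∀ w, G w = (starRingEnd ℂ (F w₀) * ((χ (i (e'.symm w)) : ℂ) * F w)).re := by
    intro w
    simp only [hG, hg]
    rw [← Complex.re_ofReal_mul]
    congr 1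
    ring
  have hGint : IntegrableOn G e'.target := by
    have := (hχF.const_mul (starRingEnd ℂ (F w₀))).re
    exact this.congr (Filter.Eventually.of_forall fun w => (hGeq w).symm)
  have hGzero : ∫ w in e'.target, G w = 0 := by
    have h1 := congrArg Complex.re (integral_const_mul (μ := volume.restrict e'.target)
      (starRingEnd ℂ (F w₀)) fun w => (χ (i (e'.symm w)) : ℂ) * F w)
    rw [hzero, mul_zero, Complex.zero_re] at h1
    rw [← h1]
    simp only [hGeq]
    exact integral_re (hχF.const_mul (starRingEnd ℂ (F w₀)))
  have hGnn : ∀ w ∈ e'.target, 0 ≤ G w := by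
    intro w hw
    by_cases hwK : i (e'.symm w) ∈ K
    · have h1 : e (i (e'.symm w)) ∈ Fin.tail ⁻¹' V := (hKN hwK).2
      rw [had.incl _ (e'.map_target hw), e'.right_inv hw, Set.mem_preimage, Fin.tail_cons] at h1
      exact mul_nonneg (hχI (Set.mem_range_self _)).1 (hVg h1).le
    · simp only [hG, hχ0 _ hwK, zero_mul, le_refl]
  have hw₀t : w₀ ∈ e'.target := e'.map_source hy₀
  have hGw₀ : 0 < G w₀ := by
    have h1 : χ (i (e'.symm w₀)) = 1 := by
      rw [hw₀, e'.left_inv hy₀]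
      exact (hχ1 _).mp rfl
    simp only [hG, h1, one_mul, hg0]
  have hGc : ContinuousAt G w₀ := by
    refine ContinuousAt.mul ?_ hgc
    refine hχ.continuous.continuousAt.comp (hi.continuous.continuousAt.comp ?_)
    exact e'.symm.continuousAt hw₀t
  have hae := (setIntegral_eq_zero_iff_of_nonneg_ae (ae_restrict_of_forall_mem
    e'.open_target.measurableSet hGnn) hGint).mp hGzero
  rw [Filter.EventuallyEq, ae_restrict_iff' e'.open_target.measurableSet] at hae
  have hnhds : ∀ᶠ w in 𝓝 w₀, 0 < G w ∧ w ∈ e'.target :=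
    (hGc.eventually_const_lt hGw₀).and (e'.open_target.mem_nhds hw₀t)
  have hpos : 0 < volume {w | 0 < G w ∧ w ∈ e'.target} :=
    Measure.measure_pos_of_mem_nhds volume hnhds
  refine hpos.ne' (measure_mono_null (fun w hw => ?_) hae)
  exact fun h0 => hw.1.ne' (h0 hw.2)

end ChartPairing

/-! ### The residue form -/

section ResidueForm

variable {n : ℕ} {X : Type*} [TopologicalSpace X] [ChartedSpace (Fin (n + 1) → ℂ) X]
  [IsManifold 𝓘(ℂ, Fin (n + 1) → ℂ) ω X]

/-- Off the closed set `D` there are charts whose first coordinate has no zeros: it is a local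
equation of `D`, the empty one. -/
theorem exists_chart_coord_ne_zero {D : Set X} (hD : IsClosed D) {x : X} (hx : x ∉ D) :
    ∃ e ∈ holoAtlas (n + 1) X, x ∈ e.source ∧ ∀ z ∈ e.source, e z 0 ≠ 0 ∧ z ∉ D := by
  set e₀ := chartAt (Fin (n + 1) → ℂ) x with he₀
  set v : Fin (n + 1) → ℂ := Pi.single 0 (1 - e₀ x 0) with hv
  set e₁ := e₀ ≫ₕ (Homeomorph.addRight v).toOpenPartialHomeomorph with he₁def
  have he₁ : e₁ ∈ holoAtlas (n + 1) X := by
    refine trans_mem_holoAtlas (IsManifold.chart_mem_maximalAtlas x) ?_ ?_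
    · exact (contDiff_id.add contDiff_const).contDiffOn
    · exact (contDiff_id.add contDiff_const).contDiffOn
  have hxe₁ : x ∈ e₁.source := ⟨mem_chart_source _ x, trivial⟩
  have hval : e₁ x 0 = 1 := by
    change e₀ x 0 + v 0 = 1
    simp [hv]
  set O : Set X := Dᶜ ∩ (e₁.source ∩ e₁ ⁻¹' {z | z 0 ≠ 0}) with hO
  have hOo : IsOpen O := hD.isOpen_compl.inter (e₁.isOpen_inter_preimage
    (isOpen_ne_fun (continuous_apply 0) continuous_const))
  refine ⟨e₁.restr O, restr_mem_holoAtlas he₁ hOo, ?_, fun z hz => ?_⟩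
  · rw [OpenPartialHomeomorph.restr_source, hOo.interior_eq]
    refine ⟨hxe₁, hx, hxe₁, ?_⟩
    change e₁ x 0 ≠ 0
    rw [hval]
    exact one_ne_zero
  · rw [OpenPartialHomeomorph.restr_source, hOo.interior_eq] at hz
    exact ⟨hz.2.2.2, hz.2.1⟩

variable [T2Space X] [SigmaCompactSpace X]
  {Y : Type*} [TopologicalSpace Y] [ChartedSpace (Fin n → ℂ) Y]
  [IsManifold 𝓘(ℂ, Fin n → ℂ) ω Y] [T2Space Y] [SigmaCompactSpace Y]
  {i : Y → X} {μ : X → ℝ} {η : Form (n + 1) X}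

/-- The form `-4πi η₁₁` on the hypersurface does not depend on the local equation, nor on the
representation: near the given point both choices compute the same residues of zeta functions. -/
theorem IsBilogarithmic.pullback_eq
    (hi : Manifold.IsSmoothEmbedding 𝓘(ℂ, Fin n → ℂ) 𝓘(ℂ, Fin (n + 1) → ℂ) ω i)
    (hclosed : IsClosed (Set.range i)) (hμ : IsCanonicalMorseBott (n := n + 1) (Set.range i) μ)
    {U U' : Set X} {f f' : X → ℂ} (hf : IsLocalEquation (n := n + 1) (Set.range i) U f)
    (hf' : IsLocalEquation (n := n + 1) (Set.range i) U' f')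
    {η₁₁ η₁₀ η₀₁ η₀₀ η₁₁' η₁₀' η₀₁' η₀₀' : Form (n + 1) X}
    (h : IsBilogarithmic (Set.range i) U f η η₁₁ η₁₀ η₀₁ η₀₀)
    (h' : IsBilogarithmic (Set.range i) U' f' η η₁₁' η₁₀' η₀₁' η₀₀')
    {y : Y} (hy : i y ∈ U) (hy' : i y ∈ U') :
    (-4 * Real.pi * Complex.I : ℂ) • pullback (m := n) i η₁₁ y =
      (-4 * Real.pi * Complex.I : ℂ) • pullback i η₁₁' y := by
  have hemb : Topology.IsClosedEmbedding i := ⟨hi.isEmbedding, hclosed⟩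
  obtain ⟨e, e₀, hye, heU, had⟩ := hf.exists_isAdapted hi hy
  obtain ⟨e', e₀', hye', heU', had'⟩ := (hf'.mono (hf'.isOpen.inter e.open_source)
    Set.inter_subset_left).exists_isAdapted hi (y₀ := y) ⟨hy', hye⟩
  have hsm : ∀ (θ : Form (n + 1) X) (V : Set X), IsOpen V → IsSmoothOn θ V → e'.source ⊆ V →
      ∀ z ∈ e₀'.source, SmoothAt (fun z => (-4 * Real.pi * Complex.I : ℂ) •
        pullback (m := n) i θ z) z := fun θ V hV hθ hVe z hz =>
    SmoothAt.smul (c := fun _ => (-4 * Real.pi * Complex.I : ℂ)) contMDiffAt_const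
      (had'.smoothAt_pullback hz ((isSmoothOn_iff hV).mp hθ _ (hVe ((had'.source_iff z).mp hz))))
  have hee : e'.source ⊆ e.source := fun x hx => (heU' hx).2
  refine had'.eq_of_integral_eq hemb
    (ρ := fun y => (-4 * Real.pi * Complex.I : ℂ) • pullback (m := n) i η₁₁ y)
    (σ := fun y => (-4 * Real.pi * Complex.I : ℂ) • pullback (m := n) i η₁₁' y)
    (hsm η₁₁ U hf.isOpen h.smooth₁₁ (hee.trans heU))
    (hsm η₁₁' U' hf'.isOpen h'.smooth₁₁ fun x hx => (heU' hx).1) (fun φ K hφ hK hKe hφ0 => ?_)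
    ((had'.source_iff y).mpr hye')
  have h1 := ((h.of_eqOn e.open_source heU fun _ _ => rfl).pairing_of_isAdapted had hemb hμ
    (fun _ _ => rfl) hφ hK (hKe.trans hee) hφ0).2
  have h2 := ((h'.of_eqOn e'.open_source (fun x hx => (heU' hx).1) fun _ _ =>
    rfl).pairing_of_isAdapted had' hemb hμ (fun _ _ => rfl) hφ hK hKe hφ0).2
  exact h1.isZetaResidue.unique h2.isZetaResidue

/-- The forms `-4πi η₁₁` glue to a form on the hypersurface. -/
theorem IsTame.exists_residueForm (ht : IsTame (Set.range i) 1 μ η)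
    (hi : Manifold.IsSmoothEmbedding 𝓘(ℂ, Fin n → ℂ) 𝓘(ℂ, Fin (n + 1) → ℂ) ω i)
    (hclosed : IsClosed (Set.range i)) (hμ : IsCanonicalMorseBott (n := n + 1) (Set.range i) μ) :
    ∃ ρ : Form n Y, ∀ (U : Set X) (f : X → ℂ), IsLocalEquation (n := n + 1) (Set.range i) U f →
      ∀ η₁₁ η₁₀ η₀₁ η₀₀ : Form (n + 1) X,
        IsBilogarithmic (Set.range i) U f η η₁₁ η₁₀ η₀₁ η₀₀ →
        ∀ y : Y, i y ∈ U → ρ y = (-4 * Real.pi * Complex.I : ℂ) • pullback i η₁₁ y := by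
  have hex : ∀ y : Y, ∃ (U : Set X) (f : X → ℂ), i y ∈ U ∧
      IsLocalEquation (n := n + 1) (Set.range i) U f ∧ ∃ η₁₁ η₁₀ η₀₁ η₀₀ : Form (n + 1) X,
        IsBilogarithmic (Set.range i) U f η η₁₁ η₁₀ η₀₁ η₀₀ := fun y => by
    obtain ⟨e, e', hy, had⟩ := exists_isAdapted hi y
    exact ⟨_, _, hy, had.isLocalEquation,
      ht.exists_isBilogarithmic hμ (dense_compl_range hi) had.isLocalEquation⟩
  choose V g hyV hg θ₁₁ θ₁₀ θ₀₁ θ₀₀ hθ using hex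
  exact ⟨fun y => (-4 * Real.pi * Complex.I : ℂ) • pullback i (θ₁₁ y) y,
    fun U f hf η₁₁ η₁₀ η₀₁ η₀₀ hb y hy =>
      (hθ y).pullback_eq hi hclosed hμ (hg y) hf hb (hyV y) hy⟩

/-- Forms are paired with test forms locally: a partition of unity reduces the general test form to
those of small support. -/
theorem hasSimpleZetaPole_of_local {ρ : Form n Y}
    (hloc : ∀ x : X, ∃ O : Set X, IsOpen O ∧ x ∈ O ∧ ∀ (φ : Form (n + 1) X) (K : Set X),
      (∀ x, SmoothAt φ x) → IsCompact K → K ⊆ O → (∀ x, x ∉ K → φ x = 0) →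
      IsIntegrable (fun y => ρ y * pullback i φ y) ∧
        HasSimpleZetaPole μ (fun x => η x * φ x) (integral (fun y => ρ y * pullback i φ y)))
    (hi : Topology.IsClosedEmbedding i) {φ : Form (n + 1) X} (hφ : ∀ x, SmoothAt φ x)
    (hφc : IsCompactlySupported φ) :
    HasSimpleZetaPole μ (fun x => η x * φ x) (integral (fun y => ρ y * pullback i φ y)) := by
  obtain ⟨K, hK, hφ0⟩ := hφc
  choose O hO hxO hpair using hloc
  have := isManifold_real (n + 1) X
  obtain ⟨ψ, hψ⟩ := SmoothPartitionOfUnity.exists_isSubordinate 𝓘(ℝ, Fin (n + 1) → ℂ)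
    isClosed_univ O hO fun x _ => Set.mem_iUnion.mpr ⟨x, hxO x⟩
  set S : Finset X := (ψ.locallyFinite.finite_nonempty_inter_compact hK).toFinset with hS
  set θ : X → Form (n + 1) X := fun c x => (ψ c x : ℂ) • φ x with hθ
  have hθs : ∀ c x, SmoothAt (θ c) x := fun c x =>
    SmoothAt.smul (Complex.ofRealCLM.contDiff.contMDiff.comp (ψ c).contMDiff x) (hφ x)
  have hKc : ∀ c, IsCompact (K ∩ tsupport (ψ c)) := fun c => hK.inter_right (isClosed_tsupport _)
  have hθ0 : ∀ c x, x ∉ K ∩ tsupport (ψ c) → θ c x = 0 := by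
    intro c x hx
    by_cases hxK : x ∈ K
    · have h1 : ψ c x = 0 := image_eq_zero_of_notMem_tsupport fun h => hx ⟨hxK, h⟩
      simp only [hθ, h1, Complex.ofReal_zero, zero_smul]
    · simp only [hθ, hφ0 x hxK, smul_zero]
  have hsum : φ = fun x => ∑ c ∈ S, θ c x := by
    funext x
    by_cases hxK : x ∈ K
    · have h1 : ∑ c ∈ S, ψ c x = 1 := by
        rw [← ψ.sum_eq_one (Set.mem_univ x)]
        refine (finsum_eq_sum_of_support_subset _ fun c hc => ?_).symm
        rw [hS, Set.Finite.coe_toFinset]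
        exact ⟨x, hc, hxK⟩
      rw [← Finset.sum_smul, ← Complex.ofReal_sum, h1, Complex.ofReal_one, one_smul]
    · simp only [hθ, hφ0 x hxK, smul_zero, Finset.sum_const_zero]
  have hp := fun c => hpair c (θ c) _ (hθs c) (hKc c) (fun x hx => hψ c hx.2) (hθ0 c)
  have h1 := HasSimpleZetaPole.sum (S := S) (μ := μ) (θ := fun c x => η x * θ c x)
    (fun c _ => ⟨_, hKc c, fun x hx => by simp only [hθ0 c x hx, mul_zero]⟩) fun c _ => (hp c).2
  have h2 := integral_sum (s := S) (θ := fun c y => ρ y * pullback (m := n) i (θ c) y)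
    (fun c _ => ⟨i ⁻¹' (K ∩ tsupport (ψ c)), hi.isCompact_preimage (hKc c), fun y hy => by
      simp only [pullback, hθ0 c _ hy, map_zero, mul_zero]⟩) fun c _ => (hp c).1
  have h3 : ∀ y, pullback (m := n) i φ y = ∑ c ∈ S, pullback (m := n) i (θ c) y := fun y => by
    rw [hsum]
    exact map_sum _ _ _
  have h4 : ∀ x, η x * φ x = ∑ c ∈ S, η x * θ c x := fun x => by
    rw [← Finset.mul_sum]
    exact congrArg _ (congrFun hsum x)
  simp only [h3, h4, Finset.mul_sum]
  rw [h2.2]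
  exact h1

/-- A form restricting to `-4πi η₁₁` for all local equations and representations is the residue. -/
theorem IsTame.isResidue (ht : IsTame (Set.range i) 1 μ η)
    (hi : Manifold.IsSmoothEmbedding 𝓘(ℂ, Fin n → ℂ) 𝓘(ℂ, Fin (n + 1) → ℂ) ω i)
    (hclosed : IsClosed (Set.range i)) (hμ : IsCanonicalMorseBott (n := n + 1) (Set.range i) μ)
    {ρ : Form n Y}
    (hρ : ∀ (U : Set X) (f : X → ℂ), IsLocalEquation (n := n + 1) (Set.range i) U f →
      ∀ η₁₁ η₁₀ η₀₁ η₀₀ : Form (n + 1) X,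
        IsBilogarithmic (Set.range i) U f η η₁₁ η₁₀ η₀₁ η₀₀ →
        ∀ y : Y, i y ∈ U → ρ y = (-4 * Real.pi * Complex.I : ℂ) • pullback i η₁₁ y) :
    IsResidue i μ η ρ := by
  have hemb : Topology.IsClosedEmbedding i := ⟨hi.isEmbedding, hclosed⟩
  have hdense := dense_compl_range hi
  constructor
  · rw [isSmoothOn_iff isOpen_univ]
    intro y _
    obtain ⟨e, e', hy, had⟩ := exists_isAdapted hi y
    obtain ⟨η₁₁, η₁₀, η₀₁, η₀₀, hb⟩ := ht.exists_isBilogarithmic hμ hdense had.isLocalEquation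
    have hye := (had.source_iff y).mpr hy
    refine SmoothAt.congr (SmoothAt.smul (c := fun _ => (-4 * Real.pi * Complex.I : ℂ))
      contMDiffAt_const (had.smoothAt_pullback hye
        ((isSmoothOn_iff e.open_source).mp hb.smooth₁₁ _ hy))) ?_
    filter_upwards [e'.open_source.mem_nhds hye] with z hz
    exact hρ _ _ had.isLocalEquation _ _ _ _ hb z ((had.source_iff z).mp hz)
  · intro φ hφ hφc
    have hφs := fun x => (isSmoothOn_iff (η := φ) isOpen_univ).mp hφ x trivial
    refine (hasSimpleZetaPole_of_local (n := n) (X := X) (fun x => ?_) hemb hφs hφc).isZetaResidue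
    by_cases hx : x ∈ Set.range i
    · obtain ⟨y, rfl⟩ := hx
      obtain ⟨e, e', hy, had⟩ := exists_isAdapted hi y
      obtain ⟨η₁₁, η₁₀, η₀₁, η₀₀, hb⟩ := ht.exists_isBilogarithmic hμ hdense had.isLocalEquation
      exact ⟨e.source, e.open_source, hy, fun φ K hφ hK hKe hφ0 =>
        hb.pairing_of_isAdapted had hemb hμ (fun z hz => hρ _ _ had.isLocalEquation _ _ _ _ hb z
          ((had.source_iff z).mp hz)) hφ hK hKe hφ0⟩
    · obtain ⟨e, he, hxe, he0⟩ := exists_chart_coord_ne_zero (n := n) hclosed hx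
      have hD : ∀ z ∈ e.source, e z 0 = 0 ↔ z ∈ Set.range i := fun z hz =>
        iff_of_false (he0 z hz).1 (he0 z hz).2
      obtain ⟨η₁₁, η₁₀, η₀₁, η₀₀, hb⟩ :=
        ht.exists_isBilogarithmic hμ hdense (isLocalEquation_coord he hD)
      refine ⟨e.source, e.open_source, hxe, fun φ K hφ hK hKe hφ0 => ?_⟩
      -- Both sides of the pairing vanish.
      have hz : (fun y => ρ y * pullback (m := n) i φ y) = fun _ => 0 := by
        funext y
        have h1 : φ (i y) = 0 := hφ0 _ fun h => (he0 _ (hKe h)).2 ⟨y, rfl⟩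
        rw [pullback, h1, map_zero, mul_zero]
      have h0 := integral_sum (s := (∅ : Finset ℕ)) (θ := fun _ => (fun _ => 0 : Form n Y))
        (by simp) (by simp)
      simp only [Finset.sum_empty] at h0
      have hempty : {w : Fin n → ℂ | (Fin.cons 0 w : Fin (n + 1) → ℂ) ∈ e.target} = ∅ := by
        refine Set.eq_empty_of_forall_notMem fun w hw => (he0 _ (e.map_target hw)).1 ?_
        rw [e.right_inv hw, Fin.cons_zero]
      have hp := hb.hasSimpleZetaPole he hD hμ hφ hK hKe hφ0
      rw [hempty, MeasureTheory.setIntegral_empty, mul_zero] at hp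
      rw [hz, h0.2]
      exact ⟨h0.1, hp⟩

theorem IsResidue.unique {ρ ρ' : Form n Y} (h : IsResidue i μ η ρ) (h' : IsResidue i μ η ρ')
    (hi : Manifold.IsSmoothEmbedding 𝓘(ℂ, Fin n → ℂ) 𝓘(ℂ, Fin (n + 1) → ℂ) ω i)
    (hclosed : IsClosed (Set.range i)) : ρ = ρ' := by
  funext y
  obtain ⟨e, e', hy, had⟩ := exists_isAdapted hi y
  refine had.eq_of_integral_eq ⟨hi.isEmbedding, hclosed⟩
    (fun z _ => (isSmoothOn_iff isOpen_univ).mp h.smooth z trivial)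
    (fun z _ => (isSmoothOn_iff isOpen_univ).mp h'.smooth z trivial)
    (fun φ K hφ hK _ hφ0 => ?_) ((had.source_iff y).mpr hy)
  have hφs : IsSmoothOn φ Set.univ := (isSmoothOn_iff isOpen_univ).mpr fun x _ => hφ x
  exact (h.pairing φ hφs ⟨K, hK, hφ0⟩).unique (h'.pairing φ hφs ⟨K, hK, hφ0⟩)

end ResidueForm

end HadamardResidue

end

open HadamardResidue in
theorem mainTheorem8 (n : ℕ)
    (X : Type*) [TopologicalSpace X] [ChartedSpace (Fin (n + 1) → ℂ) X]
    [IsManifold 𝓘(ℂ, Fin (n + 1) → ℂ) ω X] [T2Space X] [SigmaCompactSpace X]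
    (Y : Type*) [TopologicalSpace Y] [ChartedSpace (Fin n → ℂ) Y]
    [IsManifold 𝓘(ℂ, Fin n → ℂ) ω Y] [T2Space Y] [SigmaCompactSpace Y]
    (i : Y → X)
    (hi : Manifold.IsSmoothEmbedding 𝓘(ℂ, Fin n → ℂ) 𝓘(ℂ, Fin (n + 1) → ℂ) ω i)
    (hclosed : IsClosed (Set.range i))
    (μ : X → ℝ) (hμ : IsCanonicalMorseBott (n := n + 1) (Set.range i) μ)
    (η : Form (n + 1) X) (hη : HasFinitePole (Set.range i) μ η) :
    (IsTame (Set.range i) 1 μ η ↔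
      ∀ (U : Set X) (f : X → ℂ), IsLocalEquation (n := n + 1) (Set.range i) U f →
        ∃ η₁₁ η₁₀ η₀₁ η₀₀ : Form (n + 1) X,
          IsBilogarithmic (Set.range i) U f η η₁₁ η₁₀ η₀₁ η₀₀) ∧
    (IsTame (Set.range i) 1 μ η ↔
      ∀ x ∈ Set.range i, ∃ (U : Set X) (f : X → ℂ),
        x ∈ U ∧ IsLocalEquation (n := n + 1) (Set.range i) U f ∧
        ∃ η₁₁ η₁₀ η₀₁ η₀₀ : Form (n + 1) X,
          IsBilogarithmic (Set.range i) U f η η₁₁ η₁₀ η₀₁ η₀₀) ∧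
    (IsTame (Set.range i) 1 μ η →
      ∃ ρ : Form n Y,
        IsResidue i μ η ρ ∧
        (∀ ρ' : Form n Y, IsResidue i μ η ρ' → ρ' = ρ) ∧
        ∀ (U : Set X) (f : X → ℂ), IsLocalEquation (n := n + 1) (Set.range i) U f →
          ∀ η₁₁ η₁₀ η₀₁ η₀₀ : Form (n + 1) X,
            IsBilogarithmic (Set.range i) U f η η₁₁ η₁₀ η₀₁ η₀₀ →
            ∀ y : Y, i y ∈ U →
              ρ y = (-4 * Real.pi * Complex.I : ℂ) • pullback i η₁₁ y) := by
  have hdense := dense_compl_range hi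
  have hbil : IsTame (Set.range i) 1 μ η → ∀ (U : Set X) (f : X → ℂ),
      IsLocalEquation (n := n + 1) (Set.range i) U f → ∃ η₁₁ η₁₀ η₀₁ η₀₀ : Form (n + 1) X,
        IsBilogarithmic (Set.range i) U f η η₁₁ η₁₀ η₀₁ η₀₀ := fun ht U f hf =>
    ht.exists_isBilogarithmic hμ hdense hf
  have hloc : (∀ (U : Set X) (f : X → ℂ), IsLocalEquation (n := n + 1) (Set.range i) U f →
      ∃ η₁₁ η₁₀ η₀₁ η₀₀ : Form (n + 1) X,
        IsBilogarithmic (Set.range i) U f η η₁₁ η₁₀ η₀₁ η₀₀) →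
      ∀ x ∈ Set.range i, ∃ (U : Set X) (f : X → ℂ),
        x ∈ U ∧ IsLocalEquation (n := n + 1) (Set.range i) U f ∧
        ∃ η₁₁ η₁₀ η₀₁ η₀₀ : Form (n + 1) X,
          IsBilogarithmic (Set.range i) U f η η₁₁ η₁₀ η₀₁ η₀₀ := by
    rintro h _ ⟨y, rfl⟩
    obtain ⟨e, e', hy, had⟩ := exists_isAdapted hi y
    exact ⟨_, _, hy, had.isLocalEquation, h _ _ had.isLocalEquation⟩
  have htame := isTame_of_isBilogarithmic hμ hη hclosed hdense
  refine ⟨⟨hbil, fun h => htame (hloc h)⟩, ⟨fun ht => hloc (hbil ht), htame⟩, fun ht => ?_⟩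
  obtain ⟨ρ, hρ⟩ := ht.exists_residueForm hi hclosed hμ
  have hres := ht.isResidue hi hclosed hμ hρ
  exact ⟨ρ, hres, fun ρ' hρ' => hρ'.unique hres hi hclosed, hρ⟩
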